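/- **Conventions.** A Boolean function $f\colon\mathbb F_2^n\to\mathbb F_2$ is *homogeneous cubic* if all monomials of its algebraic normal form have degree 3. With $D_{\mathbf a}f(\mathbf x)=f(\mathbf x\oplus\mathbf a)\oplus f(\mathbf x)$, $f$ is *bent* if for all $\mathbf a\ne\mathbf 0$ and $b\in\mathbb F_2$ the equation $D_{\mathbf a}f(\mathbf x)=b$ has $2^{n-1}$ solutions. Functions $f,f'$ are *equivalent* if $f'(\mathbf x)=f(A\mathbf x)\oplus l(\mathbf x)$ for an invertible affine transformation $A$ and an affine function $l$. For $\pi\colon\mathbb F_2^s\to\mathbb F_2^r$ and $\phi\colon\mathbb F_2^s\to\mathbb F_2$ put $h_{\pi,\phi}(\mathbf x,\mathbf y)=\langle\mathbf x,\pi(\mathbf y)\rangle\oplus\phi(\mathbf y)$. A *primary* function $h^{2m}_{pr}$ is any homogeneous cubic bent function of the form $h_{id,\phi}((\mathbf x,\mathbf y)T)$, with $T$ an invertible matrix and $\phi$ a homogeneous cubic function on $\mathbb F_2^m$ all of whose derivatives $D_{\mathbf a}\phi$, $\mathbf a\neq\mathbf 0$, are non-affine. *Modification algorithm.* Let $h$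 be a $d$-homogeneous bent function on $\mathbb F_2^{r+s}$. For an $r$-dimensional subspace $U$ with $D_{\mathbf b}D_{\mathbf a}h=0$ for all $\mathbf a,\mathbf b\in U$, let $A_U$ be the matrix whose first $r$ rows are the Gauss–Jordan (reduced row echelon) basis of $U$ and whose last $s$ rows are the unit vectors at the non-pivot positions, in increasing order; write $h((\mathbf x,\mathbf y)A_U)=h_{\pi,\phi}(\mathbf x,\mathbf y)$ and $T=A_U^{-1}$. Let $\Omega_T(h_{\pi,\phi})$ be the set of all $\omega\colon\mathbb F_2^s\to\mathbb F_2$ such that $h_{\pi,\phi\oplus\omega}((\mathbf x,\mathbf y)T)$ is $d$-homogeneous bent. The output of the algorithm for $h$ consists of all functions $h_{\pi,\phi\oplus\omega}((\mathbf x,\mathbf y)T)$ with $\omega\in\Omega_T(h_{\pi,\phi})$, over all such $U$. *Smith normal form.* $\mathrm{SNF}(f)$ is the multiset of elementary divisors of the $2^{n+1}\times 2^{n+1}$ integer matrix with rows and columns indexed by $\mathbb F_2^n\times\mathbb F_2$, whose entry at row $g$ and column $p$ is $1$ if $p\in G_f+g$ and $0$ otherwise, where $G_f=\{(\mathbf x,f(\mathbf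 x)):\mathbf x\in\mathbb F_2^n\}$. **Theorem.** Let $h_1,\dots,h_7\colon\mathbb F_2^{12}\to\mathbb F_2$ be the functions in the variables $x_0,\dots,x_{11}$ listed below. Then: 1. $h_1,\dots,h_7$ are homogeneous cubic bent functions; 2. they are pairwise inequivalent (so there are at least 7 pairwise inequivalent homogeneous cubic bent functions on $\mathbb F_2^{12}$); 3. none of them is equivalent to any primary function $h^{12}_{pr}$; 4. $h_6$ and $h_7$ belong to the output of the modification algorithm for $h_3$, with $r=s=6$ and $d=3$; 5. $\mathrm{SNF}(h_6)\ne \mathrm{SNF}(h_i)$ for all $i\ne6$, and $\mathrm{SNF}(h_7)\neq \mathrm{SNF}(h_i)$ for all $i\neq 7$. The list: each function is the sum of the monomials shown; three symbols $ijk$ stand for $x_ix_jx_k$, with $a=10$ and $b=11$. - $h_1$: 024 027 02a 02b 034 038 046 049 056 05a 068 06b 078 08a 09a 123 127 135 138 13b 145 149 157 15a 167 16b 179 189 19b 1ab 235 236 237 24b 25b 26b 278 289 29a 346 347 348 389 39a 3ab 457 458 459 49a 4ab 568 569 56a 5ab 679 67a 67b 78a 78b 89b - $h_2$: 024 025 027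 029 02a 02b 034 036 038 03a 046 047 049 04b 056 058 05a 068 069 06b 078 07a 08a 08b 09a 123 125 127 129 135 136 138 13a 13b 145 147 149 14b 157 158 15a 167 169 16b 179 17a 189 18b 19b 1ab 237 239 23a 245 247 249 256 257 25a 26b 278 279 27a 28b 29b 348 34a 34b 356 358 35a 367 368 36b 389 38a 38b 459 45b 467 469 46b 478 479 49a 49b 56a 578 57a 589 58a 5ab 67b 689 68b 69a 69b 79a 7ab 8ab - $h_3$: 023 024 026 027 028 02a 035 038 03b 045 046 048 049 04a 057 05a 067 068 06a 06b 079 089 08a 09b 0ab 124 127 12a 12b 134 135 137 138 139 13b 146 149 156 157 159 15a 15b 168 16b 178 179 17b 18a 19a 19b 234 235 237 239 23b 246 24a 24b 256 26b 278 28a 28b 29a 2ab 345 346 348 34a 357 35b 367 389 39b 3ab 456 457 459 45b 468 478 49a 567 568 56a 579 589 5ab 678 679 67b 68a 69a 789 78a 79b 7ab 89a 89b 9ab - $h_4$: 023 025 026 027 028 029 036 038 03a 045 047 048 049 04a 04b 058 05a 067 069 06a 06b 07a 089 08b 0ab 125 127 129 12b 134 136 137 138 139 13a 147 149 14b 156 158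 159 15a 15b 169 16b 178 17a 17b 18b 19a 234 235 237 239 23b 246 24a 24b 256 26b 278 28a 28b 29a 2ab 345 346 348 34a 357 35b 367 389 39b 3ab 456 457 459 45b 468 478 49a 567 568 56a 579 589 5ab 678 679 67b 68a 69a 789 78a 79b 7ab 89a 89b 9ab - $h_5$: 024 025 027 02a 038 03a 046 047 049 05a 068 069 06b 08a 08b 127 129 135 136 138 13b 149 14b 157 158 15a 16b 179 17a 19b 234 235 239 23a 23b 245 247 249 24b 256 257 25a 279 27a 28b 29a 29b 2ab 345 346 34a 34b 356 358 35a 367 368 36b 38a 38b 3ab 456 457 45b 467 469 46b 478 479 49b 567 568 578 57a 589 58a 678 679 689 68b 69a 69b 789 78a 79a 7ab 89a 89b 8ab 9ab - $h_6$: 027 029 02a 02b 037 038 03a 03b 047 048 049 04b 057 058 059 05a 068 069 06a 06b 078 07b 089 09a 0ab 123 126 127 128 129 12a 134 138 139 13a 13b 145 147 149 14a 14b 156 157 158 15a 15b 167 168 169 16b 237 23a 23b 248 24a 258 25b 269 26a 26b 278 289 28b 29a 29b 347 348 34b 359 35b 367 369 379 37a 389 39a 3ab 456 457 458 459 45b 467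 47b 48a 48b 49a 568 56a 578 579 57b 5ab 678 67a 67b 689 68a 69a 9ab - $h_7$: 027 029 02a 02b 037 038 03a 03b 047 048 049 04b 057 058 059 05a 068 069 06a 06b 078 07b 089 09a 0ab 123 126 127 128 129 12a 134 138 139 13a 13b 145 147 149 14a 14b 156 157 158 15a 15b 167 168 169 16b 237 23a 23b 248 24a 258 25b 269 26a 26b 278 289 28b 29a 29b 347 348 34b 356 359 367 369 36a 379 37a 389 39a 457 458 459 467 46a 47b 48a 48b 49a 4ab 569 56a 578 579 57b 58b 59b 5ab 678 67a 67b 689 8ab -/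

import Mathlib

open scoped Matrix

/-- Boolean functions in `n` variables. -/
abbrev BoolFn (n : ℕ) : Type := (Fin n → ZMod 2) → ZMod 2

/-- `f` is `d`-homogeneous: all monomials `∏ i ∈ S, x i` of its algebraic normal form
`f x = ∑ S, c S * ∏ i ∈ S, x i` (whose coefficients `c S` are determined by `f`) have degree `d`. -/
def IsHomogeneousFn {n : ℕ} (d : ℕ) (f : BoolFn n) : Prop :=
  ∃ c : Finset (Fin n) → ZMod 2,
    (∀ x, f x = ∑ S : Finset (Fin n), c S * ∏ i ∈ S, x i) ∧
    ∀ S, c S ≠ 0 → S.card = d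

/-- The first-order derivative `D_a f`. -/
def derivFn {n : ℕ} (a : Fin n → ZMod 2) (f : BoolFn n) : BoolFn n :=
  fun x => f (x + a) + f x

/-- `f` is bent: for `a ≠ 0`, the equation `D_a f (x) = b` has `2 ^ (n - 1)` solutions. -/
def IsBent {n : ℕ} (f : BoolFn n) : Prop :=
  ∀ a : Fin n → ZMod 2, a ≠ 0 → ∀ b : ZMod 2,
    (Finset.univ.filter fun x => derivFn a f x = b).card = 2 ^ (n - 1)

/-- `f` is an affine function `x ↦ ⟨a, x⟩ + b`. -/
def IsAffineFn {n : ℕ} (f : BoolFn n) : Prop :=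
  ∃ (a : Fin n → ZMod 2) (b : ZMod 2), ∀ x, f x = a ⬝ᵥ x + b

/-- Equivalence of Boolean functions: `f' x = f (A x) + l x` with `A` an invertible affine
transformation and `l` an affine function. -/
def EquivalentFn {n : ℕ} (f f' : BoolFn n) : Prop :=
  ∃ (A : (Fin n → ZMod 2) ≃ᵃ[ZMod 2] (Fin n → ZMod 2)) (l : BoolFn n),
    IsAffineFn l ∧ ∀ x, f' x = f (A x) + l x

/-- The Maiorana-McFarland function `f_{π,φ}(x, y) = ⟨x, π y⟩ + φ y`. -/
def mmFn {r s : ℕ} (π : (Fin s → ZMod 2) → (Fin r → ZMod 2)) (φ : BoolFn s) :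
    (Fin r → ZMod 2) × (Fin s → ZMod 2) → ZMod 2 :=
  fun z => z.1 ⬝ᵥ π z.2 + φ z.2

/-- `h` is a primary homogeneous cubic bent function in `2 * m` variables:
`h = f_{id,φ} ∘ T` is homogeneous cubic bent, where `T` is linear and invertible and `φ` is
homogeneous cubic without affine derivatives on `𝔽₂^m`. -/
def IsPrimary (m : ℕ) (h : BoolFn (2 * m)) : Prop :=
  IsHomogeneousFn 3 h ∧ IsBent h ∧
  ∃ φ : BoolFn m, IsHomogeneousFn 3 φ ∧ (∀ a, a ≠ 0 → ¬ IsAffineFn (derivFn a φ)) ∧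
    ∃ T : (Fin (2 * m) → ZMod 2) ≃ₗ[ZMod 2] (Fin m → ZMod 2) × (Fin m → ZMod 2),
      ∀ z, h z = mmFn id φ (T z)

/-- `U` is an `M`-subspace of `f`: the second-order derivatives `D_{a,b} f` with `a, b ∈ U`
vanish identically. -/
def IsMSubspace {n : ℕ} (f : BoolFn n) (U : Submodule (ZMod 2) (Fin n → ZMod 2)) : Prop :=
  ∀ a ∈ U, ∀ b ∈ U, ∀ x, derivFn b (derivFn a f) x = 0

/-- The rows of `B` are in reduced row echelon form with pivot columns `p` (no zero rows). -/
def IsGaussJordan {r n : ℕ} (B : Matrix (Fin r) (Fin n) (ZMod 2)) (p : Fin r → Fin n) : Prop :=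
  StrictMono p ∧ (∀ i j, B i (p j) = if i = j then 1 else 0) ∧ ∀ i, ∀ k < p i, B i k = 0

/-- `A` is the linear transformation `A_U`, that is `A (x, y) = x B + y C`: the rows of `B` are
the Gauss-Jordan basis of `U`, and the rows of `C` are the unit vectors at the non-pivot positions
(the Gauss-Jordan basis of a complement of `U`). -/
def IsAdaptedMap {r s n : ℕ} (U : Submodule (ZMod 2) (Fin n → ZMod 2))
    (A : ((Fin r → ZMod 2) × (Fin s → ZMod 2)) ≃ₗ[ZMod 2] (Fin n → ZMod 2)) : Prop :=
  ∃ (B : Matrix (Fin r) (Fin n) (ZMod 2)) (p : Fin r → Fin n) (q : Fin s → Fin n),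
    IsGaussJordan B p ∧ Submodule.span (ZMod 2) (Set.range B) = U ∧
    StrictMono q ∧ Set.range q = (Set.range p)ᶜ ∧
    ∀ x y, A (x, y) = x ᵥ* B + ∑ j, y j • (Pi.single (q j) 1 : Fin n → ZMod 2)

/-- `Ω_T(h_{π,φ})`: all `ω` on `𝔽₂^s` such that `h_{π,φ+ω} ∘ T` is `d`-homogeneous bent. -/
def omegaSet {r s n : ℕ} (d : ℕ)
    (T : (Fin n → ZMod 2) ≃ₗ[ZMod 2] (Fin r → ZMod 2) × (Fin s → ZMod 2))
    (π : (Fin s → ZMod 2) → (Fin r → ZMod 2)) (φ : BoolFn s) : Set (BoolFn s) :=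
  {ω | IsHomogeneousFn d (fun z => mmFn π (φ + ω) (T z)) ∧
    IsBent (fun z => mmFn π (φ + ω) (T z))}

/-- The output of the modification algorithm for the input `h`: for each `r`-dimensional
`M`-subspace `U` of `h`, write `h ∘ A_U = h_{π,φ}` and collect the functions `h_{π,φ+ω} ∘ T`,
where `T = A_U⁻¹` and `ω ∈ Ω_T(h_{π,φ})`. -/
def newFromOld {n : ℕ} (r s d : ℕ) (h : BoolFn n) : Set (BoolFn n) :=
  {g | ∃ U : Submodule (ZMod 2) (Fin n → ZMod 2),
    Module.finrank (ZMod 2) U = r ∧ IsMSubspace h U ∧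
    ∃ A : ((Fin r → ZMod 2) × (Fin s → ZMod 2)) ≃ₗ[ZMod 2] (Fin n → ZMod 2),
      IsAdaptedMap U A ∧
      ∃ (π : (Fin s → ZMod 2) → (Fin r → ZMod 2)) (φ : BoolFn s),
        (∀ w, h (A w) = mmFn π φ w) ∧
        ∃ ω ∈ omegaSet d A.symm π φ, ∀ z, g z = mmFn π (φ + ω) (A.symm z)}

/-- The graph `G_f` of `f`, a subset of the additive group `𝔽₂^n × 𝔽₂`. -/
def graphFn {n : ℕ} (f : BoolFn n) : Set ((Fin n → ZMod 2) × ZMod 2) :=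
  Set.range fun x => (x, f x)

/-- The incidence matrix of the development of `S ⊆ G`: the lines (rows) are the translates `S + g`,
the points (columns) are the elements of `G`. -/
noncomputable def devMatrix {G : Type*} [AddGroup G] (S : Set G) : Matrix G G ℤ :=
  Matrix.of fun g p => Set.indicator ((fun a => a + g) '' S) 1 p

/-- The multiset `D` consists of the diagonal entries of a Smith normal form of the square integral
matrix `M`: there are nonnegative `d_1 ∣ d_2 ∣ ⋯` and unimodular `P`, `Q` with
`P M Q = diag(d_1, d_2, …)`. -/
def HasSmithNormalForm {ι : Type*} [Fintype ι] [DecidableEq ι] (M : Matrix ι ι ℤ)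
    (D : Multiset ℕ) : Prop :=
  ∃ (e : ι ≃ Fin (Fintype.card ι)) (d : Fin (Fintype.card ι) → ℕ) (P Q : Matrix ι ι ℤ),
    (∀ i j, i ≤ j → d i ∣ d j) ∧ IsUnit P.det ∧ IsUnit Q.det ∧
    P * M * Q = Matrix.diagonal (fun i => (d (e i) : ℤ)) ∧
    D = Finset.univ.val.map d

/-- `SNF(f)`: the multiset of elementary divisors of the incidence matrix of the development of the
graph of `f`. -/
noncomputable def snf {n : ℕ} (f : BoolFn n) : Multiset ℕ :=
  Classical.epsilon (HasSmithNormalForm (devMatrix (graphFn f)))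

/-- The sum of the cubic monomials `x_i x_j x_k`, for `(i, j, k)` in the list. -/
def cubicOf {n : ℕ} (L : List (Fin n × Fin n × Fin n)) : BoolFn n :=
  fun x => (L.map fun t => x t.1 * x t.2.1 * x t.2.2).sum

/-- The function `h_1` in 12 variables. -/
def h12_1 : BoolFn 12 := cubicOf [
  (0,2,4), (0,2,7), (0,2,10), (0,2,11), (0,3,4), (0,3,8), (0,4,6), (0,4,9), (0,5,6), (0,5,10),
  (0,6,8), (0,6,11), (0,7,8), (0,8,10), (0,9,10), (1,2,3), (1,2,7), (1,3,5), (1,3,8), (1,3,11),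
  (1,4,5), (1,4,9), (1,5,7), (1,5,10), (1,6,7), (1,6,11), (1,7,9), (1,8,9), (1,9,11), (1,10,11),
  (2,3,5), (2,3,6), (2,3,7), (2,4,11), (2,5,11), (2,6,11), (2,7,8), (2,8,9), (2,9,10), (3,4,6),
  (3,4,7), (3,4,8), (3,8,9), (3,9,10), (3,10,11), (4,5,7), (4,5,8), (4,5,9), (4,9,10),
  (4,10,11), (5,6,8), (5,6,9), (5,6,10), (5,10,11), (6,7,9), (6,7,10), (6,7,11), (7,8,10),
  (7,8,11), (8,9,11)]

/-- The function `h_2` in 12 variables. -/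
def h12_2 : BoolFn 12 := cubicOf [
  (0,2,4), (0,2,5), (0,2,7), (0,2,9), (0,2,10), (0,2,11), (0,3,4), (0,3,6), (0,3,8), (0,3,10),
  (0,4,6), (0,4,7), (0,4,9), (0,4,11), (0,5,6), (0,5,8), (0,5,10), (0,6,8), (0,6,9), (0,6,11),
  (0,7,8), (0,7,10), (0,8,10), (0,8,11), (0,9,10), (1,2,3), (1,2,5), (1,2,7), (1,2,9), (1,3,5),
  (1,3,6), (1,3,8), (1,3,10), (1,3,11), (1,4,5), (1,4,7), (1,4,9), (1,4,11), (1,5,7), (1,5,8),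
  (1,5,10), (1,6,7), (1,6,9), (1,6,11), (1,7,9), (1,7,10), (1,8,9), (1,8,11), (1,9,11),
  (1,10,11), (2,3,7), (2,3,9), (2,3,10), (2,4,5), (2,4,7), (2,4,9), (2,5,6), (2,5,7), (2,5,10),
  (2,6,11), (2,7,8), (2,7,9), (2,7,10), (2,8,11), (2,9,11), (3,4,8), (3,4,10), (3,4,11),
  (3,5,6), (3,5,8), (3,5,10), (3,6,7), (3,6,8), (3,6,11), (3,8,9), (3,8,10), (3,8,11), (4,5,9),
  (4,5,11), (4,6,7), (4,6,9), (4,6,11), (4,7,8), (4,7,9), (4,9,10), (4,9,11), (5,6,10), (5,7,8),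
  (5,7,10), (5,8,9), (5,8,10), (5,10,11), (6,7,11), (6,8,9), (6,8,11), (6,9,10), (6,9,11),
  (7,9,10), (7,10,11), (8,10,11)]

/-- The function `h_3` in 12 variables. -/
def h12_3 : BoolFn 12 := cubicOf [
  (0,2,3), (0,2,4), (0,2,6), (0,2,7), (0,2,8), (0,2,10), (0,3,5), (0,3,8), (0,3,11), (0,4,5),
  (0,4,6), (0,4,8), (0,4,9), (0,4,10), (0,5,7), (0,5,10), (0,6,7), (0,6,8), (0,6,10), (0,6,11),
  (0,7,9), (0,8,9), (0,8,10), (0,9,11), (0,10,11), (1,2,4), (1,2,7), (1,2,10), (1,2,11),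
  (1,3,4), (1,3,5), (1,3,7), (1,3,8), (1,3,9), (1,3,11), (1,4,6), (1,4,9), (1,5,6), (1,5,7),
  (1,5,9), (1,5,10), (1,5,11), (1,6,8), (1,6,11), (1,7,8), (1,7,9), (1,7,11), (1,8,10),
  (1,9,10), (1,9,11), (2,3,4), (2,3,5), (2,3,7), (2,3,9), (2,3,11), (2,4,6), (2,4,10), (2,4,11),
  (2,5,6), (2,6,11), (2,7,8), (2,8,10), (2,8,11), (2,9,10), (2,10,11), (3,4,5), (3,4,6),
  (3,4,8), (3,4,10), (3,5,7), (3,5,11), (3,6,7), (3,8,9), (3,9,11), (3,10,11), (4,5,6), (4,5,7),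
  (4,5,9), (4,5,11), (4,6,8), (4,7,8), (4,9,10), (5,6,7), (5,6,8), (5,6,10), (5,7,9), (5,8,9),
  (5,10,11), (6,7,8), (6,7,9), (6,7,11), (6,8,10), (6,9,10), (7,8,9), (7,8,10), (7,9,11),
  (7,10,11), (8,9,10), (8,9,11), (9,10,11)]

/-- The function `h_4` in 12 variables. -/
def h12_4 : BoolFn 12 := cubicOf [
  (0,2,3), (0,2,5), (0,2,6), (0,2,7), (0,2,8), (0,2,9), (0,3,6), (0,3,8), (0,3,10), (0,4,5),
  (0,4,7), (0,4,8), (0,4,9), (0,4,10), (0,4,11), (0,5,8), (0,5,10), (0,6,7), (0,6,9), (0,6,10),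
  (0,6,11), (0,7,10), (0,8,9), (0,8,11), (0,10,11), (1,2,5), (1,2,7), (1,2,9), (1,2,11),
  (1,3,4), (1,3,6), (1,3,7), (1,3,8), (1,3,9), (1,3,10), (1,4,7), (1,4,9), (1,4,11), (1,5,6),
  (1,5,8), (1,5,9), (1,5,10), (1,5,11), (1,6,9), (1,6,11), (1,7,8), (1,7,10), (1,7,11),
  (1,8,11), (1,9,10), (2,3,4), (2,3,5), (2,3,7), (2,3,9), (2,3,11), (2,4,6), (2,4,10), (2,4,11),
  (2,5,6), (2,6,11), (2,7,8), (2,8,10), (2,8,11), (2,9,10), (2,10,11), (3,4,5), (3,4,6),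
  (3,4,8), (3,4,10), (3,5,7), (3,5,11), (3,6,7), (3,8,9), (3,9,11), (3,10,11), (4,5,6), (4,5,7),
  (4,5,9), (4,5,11), (4,6,8), (4,7,8), (4,9,10), (5,6,7), (5,6,8), (5,6,10), (5,7,9), (5,8,9),
  (5,10,11), (6,7,8), (6,7,9), (6,7,11), (6,8,10), (6,9,10), (7,8,9), (7,8,10), (7,9,11),
  (7,10,11), (8,9,10), (8,9,11), (9,10,11)]

/-- The function `h_5` in 12 variables. -/
def h12_5 : BoolFn 12 := cubicOf [
  (0,2,4), (0,2,5), (0,2,7), (0,2,10), (0,3,8), (0,3,10), (0,4,6), (0,4,7), (0,4,9), (0,5,10),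
  (0,6,8), (0,6,9), (0,6,11), (0,8,10), (0,8,11), (1,2,7), (1,2,9), (1,3,5), (1,3,6), (1,3,8),
  (1,3,11), (1,4,9), (1,4,11), (1,5,7), (1,5,8), (1,5,10), (1,6,11), (1,7,9), (1,7,10),
  (1,9,11), (2,3,4), (2,3,5), (2,3,9), (2,3,10), (2,3,11), (2,4,5), (2,4,7), (2,4,9), (2,4,11),
  (2,5,6), (2,5,7), (2,5,10), (2,7,9), (2,7,10), (2,8,11), (2,9,10), (2,9,11), (2,10,11),
  (3,4,5), (3,4,6), (3,4,10), (3,4,11), (3,5,6), (3,5,8), (3,5,10), (3,6,7), (3,6,8), (3,6,11),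
  (3,8,10), (3,8,11), (3,10,11), (4,5,6), (4,5,7), (4,5,11), (4,6,7), (4,6,9), (4,6,11),
  (4,7,8), (4,7,9), (4,9,11), (5,6,7), (5,6,8), (5,7,8), (5,7,10), (5,8,9), (5,8,10), (6,7,8),
  (6,7,9), (6,8,9), (6,8,11), (6,9,10), (6,9,11), (7,8,9), (7,8,10), (7,9,10), (7,10,11),
  (8,9,10), (8,9,11), (8,10,11), (9,10,11)]

/-- The function `h_6` in 12 variables. -/
def h12_6 : BoolFn 12 := cubicOf [
  (0,2,7), (0,2,9), (0,2,10), (0,2,11), (0,3,7), (0,3,8), (0,3,10), (0,3,11), (0,4,7), (0,4,8),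
  (0,4,9), (0,4,11), (0,5,7), (0,5,8), (0,5,9), (0,5,10), (0,6,8), (0,6,9), (0,6,10), (0,6,11),
  (0,7,8), (0,7,11), (0,8,9), (0,9,10), (0,10,11), (1,2,3), (1,2,6), (1,2,7), (1,2,8), (1,2,9),
  (1,2,10), (1,3,4), (1,3,8), (1,3,9), (1,3,10), (1,3,11), (1,4,5), (1,4,7), (1,4,9), (1,4,10),
  (1,4,11), (1,5,6), (1,5,7), (1,5,8), (1,5,10), (1,5,11), (1,6,7), (1,6,8), (1,6,9), (1,6,11),
  (2,3,7), (2,3,10), (2,3,11), (2,4,8), (2,4,10), (2,5,8), (2,5,11), (2,6,9), (2,6,10),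
  (2,6,11), (2,7,8), (2,8,9), (2,8,11), (2,9,10), (2,9,11), (3,4,7), (3,4,8), (3,4,11), (3,5,9),
  (3,5,11), (3,6,7), (3,6,9), (3,7,9), (3,7,10), (3,8,9), (3,9,10), (3,10,11), (4,5,6), (4,5,7),
  (4,5,8), (4,5,9), (4,5,11), (4,6,7), (4,7,11), (4,8,10), (4,8,11), (4,9,10), (5,6,8),
  (5,6,10), (5,7,8), (5,7,9), (5,7,11), (5,10,11), (6,7,8), (6,7,10), (6,7,11), (6,8,9),
  (6,8,10), (6,9,10), (9,10,11)]

/-- The function `h_7` in 12 variables. -/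
def h12_7 : BoolFn 12 := cubicOf [
  (0,2,7), (0,2,9), (0,2,10), (0,2,11), (0,3,7), (0,3,8), (0,3,10), (0,3,11), (0,4,7), (0,4,8),
  (0,4,9), (0,4,11), (0,5,7), (0,5,8), (0,5,9), (0,5,10), (0,6,8), (0,6,9), (0,6,10), (0,6,11),
  (0,7,8), (0,7,11), (0,8,9), (0,9,10), (0,10,11), (1,2,3), (1,2,6), (1,2,7), (1,2,8), (1,2,9),
  (1,2,10), (1,3,4), (1,3,8), (1,3,9), (1,3,10), (1,3,11), (1,4,5), (1,4,7), (1,4,9), (1,4,10),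
  (1,4,11), (1,5,6), (1,5,7), (1,5,8), (1,5,10), (1,5,11), (1,6,7), (1,6,8), (1,6,9), (1,6,11),
  (2,3,7), (2,3,10), (2,3,11), (2,4,8), (2,4,10), (2,5,8), (2,5,11), (2,6,9), (2,6,10),
  (2,6,11), (2,7,8), (2,8,9), (2,8,11), (2,9,10), (2,9,11), (3,4,7), (3,4,8), (3,4,11), (3,5,6),
  (3,5,9), (3,6,7), (3,6,9), (3,6,10), (3,7,9), (3,7,10), (3,8,9), (3,9,10), (4,5,7), (4,5,8),
  (4,5,9), (4,6,7), (4,6,10), (4,7,11), (4,8,10), (4,8,11), (4,9,10), (4,10,11), (5,6,9),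
  (5,6,10), (5,7,8), (5,7,9), (5,7,11), (5,8,11), (5,9,11), (5,10,11), (6,7,8), (6,7,10),
  (6,7,11), (6,8,9), (8,10,11)]

/-- The family of the seven functions: `h12 0, …, h12 6` are `h_1, …, h_7`. -/
def h12 : Fin 7 → BoolFn 12 :=
  ![h12_1, h12_2, h12_3, h12_4, h12_5, h12_6, h12_7]

/-! All inequivalences and all inequalities between Smith normal forms come from one family of
invariants. Let M be the incidence matrix of the development of the graph of f, reduced modulo 8
(`devMod f`). For c = 4, 2, 1 take the least m such that c·M is a product of two matrices over ℤ/8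
with inner dimension m. Unimodular matrices stay invertible modulo 8, so m is the number of
elementary divisors not divisible by 2, 4, 8 respectively (`HasSmithNormalForm.factorsThrough_iff`);
hence `snf f` determines it. An equivalence of functions only permutes the rows and the columns of M
(`EquivalentFn.exists_submatrix`), so m is an invariant of equivalence as well.

Up to an error of one, m is the number of generators of the ℤ/8-module spanned by c times the
translates of f and by the constant c. A lower bound is certified by an echelon system of elements
of this module, all of whose linear relations have even coefficients (`le_of_lowerCheck`). An upper
bound is certified by a set of translates whose span contains their shifts by unit vectors, hence
contains every translate (`factorsThrough_of_upperCheck`). The case c = 4 splits the seven functions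
into {1, 2, 4}, {3, 6, 7} and {5}; c = 2 separates 1, 2, 4 from each other and 3 from 6 and 7; c = 1
separates 6 from 7.

Bentness is a count: every derivative in a nonzero direction takes the value 1 at 2048 points
(`isBent_of_bentCheckAux`). A primary function in 12 variables has affine derivatives in 64
directions, those with vanishing y-part in the coordinates given by T; an equivalence carries such
directions injectively to such directions, while each of the seven functions has at most four of
them (`not_equivalentFn_of_isPrimary`). Finally, h₆ and h₇ have the same derivatives as h₃ along a
6-dimensional M-subspace of h₃, so in adapted coordinates they share the map π and differ by a
function of y alone (`mem_newFromOld`).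

For the computations a truth table is stored as the binary digits of one natural number, so that
translations, sums and row operations act on all points at once. -/

/-! ### Existence of the Smith normal form -/

namespace SmithForm

/-- Equivalence of integral matrices under unimodular row and column operations. -/
def Rel {ι : Type*} [Fintype ι] [DecidableEq ι] (M N : Matrix ι ι ℤ) : Prop :=
  ∃ P Q : Matrix ι ι ℤ, IsUnit P.det ∧ IsUnit Q.det ∧ P * M * Q = N

variable {ι κ : Type*} [Fintype ι] [DecidableEq ι] [Fintype κ] [DecidableEq κ]

theorem Rel.refl (M : Matrix ι ι ℤ) : Rel M M := ⟨1, 1, by simp, by simp, by simp⟩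

theorem Rel.trans {M N K : Matrix ι ι ℤ} : Rel M N → Rel N K → Rel M K := by
  rintro ⟨P, Q, hP, hQ, rfl⟩ ⟨P', Q', hP', hQ', rfl⟩
  refine ⟨P' * P, Q * Q', ?_, ?_, by simp only [Matrix.mul_assoc]⟩
  · rw [Matrix.det_mul]; exact hP'.mul hP
  · rw [Matrix.det_mul]; exact hQ.mul hQ'

theorem Rel.mul_left {P : Matrix ι ι ℤ} (hP : IsUnit P.det) (M : Matrix ι ι ℤ) : Rel M (P * M) :=
  ⟨P, 1, hP, by simp, by simp⟩

theorem Rel.mul_right {Q : Matrix ι ι ℤ} (hQ : IsUnit Q.det) (M : Matrix ι ι ℤ) : Rel M (M * Q) :=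
  ⟨1, Q, by simp, hQ, by simp⟩

theorem Rel.submatrix {M N : Matrix ι ι ℤ} (h : Rel M N) (e : κ ≃ ι) :
    Rel (M.submatrix e e) (N.submatrix e e) := by
  obtain ⟨P, Q, hP, hQ, rfl⟩ := h
  refine ⟨P.submatrix e e, Q.submatrix e e, by simpa using hP, by simpa using hQ, ?_⟩
  rw [Matrix.submatrix_mul_equiv, Matrix.submatrix_mul_equiv]

theorem isUnit_det_one_submatrix (e : ι ≃ ι) :
    IsUnit ((1 : Matrix ι ι ℤ).submatrix e id).det := by
  rw [Matrix.det_permute]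
  simp

theorem Rel.permute (e f : ι ≃ ι) (M : Matrix ι ι ℤ) : Rel M (M.submatrix e f) := by
  refine ⟨(1 : Matrix ι ι ℤ).submatrix e id, (1 : Matrix ι ι ℤ).submatrix id f,
    isUnit_det_one_submatrix e, ?_, ?_⟩
  · have h := isUnit_det_one_submatrix f
    rw [← Matrix.det_transpose, Matrix.transpose_submatrix] at h
    simpa using h
  · ext i j
    simp [Matrix.mul_apply, Matrix.one_apply]

/-- A nonzero entry dividing every nonzero entry's row and column mates: if `a = N k k` has least
absolute value among the nonzero entries of all matrices equivalent to `M`, then it divides its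
row. -/
theorem dvd_row {M N : Matrix ι ι ℤ} (hN : Rel M N) {k : ι} (h0 : N k k ≠ 0)
    (hmin : ∀ N', Rel M N' → ∀ i j, N' i j ≠ 0 → (N k k).natAbs ≤ (N' i j).natAbs) (j : ι) :
    N k k ∣ N k j := by
  rcases eq_or_ne k j with rfl | hj
  · exact dvd_rfl
  by_contra hd
  have hdet : IsUnit (Matrix.transvection k j (-(N k j / N k k))).det := by
    rw [Matrix.det_transvection_of_ne _ _ hj]; exact isUnit_one
  have hR := hN.trans (Rel.mul_right hdet N)
  -- Subtracting the quotient times column `k` leaves the remainder, which is smaller than the pivot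
  -- and so must vanish by minimality.
  have hval : (N * Matrix.transvection k j (-(N k j / N k k))) k j = N k j % N k k := by
    rw [Matrix.mul_transvection_apply_same, Int.emod_def]; ring
  have hne : N k j % N k k ≠ 0 := fun h => hd (Int.dvd_of_emod_eq_zero h)
  have := hmin _ hR k j (by rw [hval]; exact hne)
  rw [hval] at this
  have h1 := Int.emod_nonneg (N k j) h0
  have h2 := Int.emod_lt_abs (N k j) h0
  rw [Int.abs_eq_natAbs] at h2
  omega

theorem dvd_col {M N : Matrix ι ι ℤ} (hN : Rel M N) {k : ι} (h0 : N k k ≠ 0)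
    (hmin : ∀ N', Rel M N' → ∀ i j, N' i j ≠ 0 → (N k k).natAbs ≤ (N' i j).natAbs) (j : ι) :
    N k k ∣ N j k := by
  rcases eq_or_ne j k with rfl | hj
  · exact dvd_rfl
  by_contra hd
  have hdet : IsUnit (Matrix.transvection j k (-(N j k / N k k))).det := by
    rw [Matrix.det_transvection_of_ne _ _ hj]; exact isUnit_one
  have hR := hN.trans (Rel.mul_left hdet N)
  have hval : (Matrix.transvection j k (-(N j k / N k k)) * N) j k = N j k % N k k := by
    rw [Matrix.transvection_mul_apply_same, Int.emod_def]; ring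
  have hne : N j k % N k k ≠ 0 := fun h => hd (Int.dvd_of_emod_eq_zero h)
  have := hmin _ hR j k (by rw [hval]; exact hne)
  rw [hval] at this
  have h1 := Int.emod_nonneg (N j k) h0
  have h2 := Int.emod_lt_abs (N j k) h0
  rw [Int.abs_eq_natAbs] at h2
  omega

/-- Well-ordering replaces the Euclidean algorithm: among all nonzero entries of all equivalent
matrices one has least absolute value, and row and column swaps move it to the diagonal position
`k`. -/
theorem exists_min_entry [Nonempty ι] {M : Matrix ι ι ℤ} (hM : M ≠ 0) (k : ι) :
    ∃ N, Rel M N ∧ N k k ≠ 0 ∧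
      ∀ N', Rel M N' → ∀ i j, N' i j ≠ 0 → (N k k).natAbs ≤ (N' i j).natAbs := by
  classical
  have hex : ∃ m : ℕ, ∃ N, Rel M N ∧ ∃ i j, N i j ≠ 0 ∧ (N i j).natAbs = m := by
    obtain ⟨i, j, hij⟩ : ∃ i j, M i j ≠ 0 := by
      by_contra! h
      exact hM (by ext i j; exact h i j)
    exact ⟨_, M, Rel.refl M, i, j, hij, rfl⟩
  obtain ⟨N, hN, i, j, hne, habs⟩ := Nat.find_spec hex
  refine ⟨N.submatrix (Equiv.swap k i) (Equiv.swap k j), hN.trans (Rel.permute _ _ _), ?_, ?_⟩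
  · simpa using hne
  · intro N' hN' i' j' hne'
    have : (N.submatrix (Equiv.swap k i) (Equiv.swap k j)) k k = N i j := by simp
    rw [this, habs]
    exact Nat.find_min' hex ⟨N', hN', i', j', hne', rfl⟩

/-- Splitting off the first index. -/
def succEquiv (n : ℕ) : Unit ⊕ Fin n ≃ Fin (n + 1) where
  toFun := Sum.elim (fun _ => 0) Fin.succ
  invFun := Fin.cases (Sum.inl ()) Sum.inr
  left_inv := by rintro (_ | i) <;> rfl
  right_inv := by intro i; refine Fin.cases ?_ (fun i => ?_) i <;> rfl

/-- The minimal entry divides its row and its column, so both can be cleared; minimality then also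
makes it divide the whole remaining block, which is why `a` can be taken out of that block. -/
theorem exists_block {ν : Type*} [Fintype ν] [DecidableEq ν]
    (M : Matrix (Unit ⊕ ν) (Unit ⊕ ν) ℤ) (hM : M ≠ 0) :
    ∃ (a : ℕ) (D : Matrix ν ν ℤ),
      Rel M (Matrix.fromBlocks (Matrix.of fun _ _ => (a : ℤ)) 0 0 ((a : ℤ) • D)) := by
  obtain ⟨N, hN, h0, hmin⟩ := exists_min_entry hM (Sum.inl ())
  set a := N (Sum.inl ()) (Sum.inl ()) with ha
  choose r hr using fun j : ν => dvd_row hN h0 hmin (Sum.inr j)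
  choose c hc using fun j : ν => dvd_col hN h0 hmin (Sum.inr j)
  -- clear the first row and the first column
  have hclear : Rel M (Matrix.fromBlocks (Matrix.of fun _ _ => a) 0 0
      (Matrix.of fun i j => N (Sum.inr i) (Sum.inr j) - c i * (a * r j))) := by
    refine hN.trans ⟨Matrix.fromBlocks 1 0 (Matrix.of fun i _ => -c i) 1,
      Matrix.fromBlocks 1 (Matrix.of fun _ j => -r j) 0 1, ?_, ?_, ?_⟩
    · rw [Matrix.det_fromBlocks_zero₁₂]; simp
    · rw [Matrix.det_fromBlocks_zero₂₁]; simp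
    · ext i j
      rcases i with i | i <;> rcases j with j | j <;>
        simp [Matrix.mul_apply, Matrix.fromBlocks, Fintype.sum_sum_type, Matrix.one_apply,
          hr, hc, ← ha] <;> ring
  set D₀ : Matrix ν ν ℤ := Matrix.of fun i j => N (Sum.inr i) (Sum.inr j) - c i * (a * r j)
  have hdvd : ∀ i j, a ∣ D₀ i j := by
    intro i j
    set K := Matrix.fromBlocks (Matrix.of fun _ _ => a) 0 0 D₀ with hK
    -- Adding row `i` of the block to the first row keeps the corner `a` and copies the entries `D₀
    -- i j` into the first row, where `dvd_row` applies again.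
    have hdet : IsUnit (Matrix.transvection (Sum.inl () : Unit ⊕ ν) (Sum.inr i) (1 : ℤ)).det := by
      rw [Matrix.det_transvection_of_ne _ _ (by simp)]; exact isUnit_one
    have hR := hclear.trans (Rel.mul_left hdet K)
    have hK0 : (Matrix.transvection (Sum.inl () : Unit ⊕ ν) (Sum.inr i) (1 : ℤ) * K)
        (Sum.inl ()) (Sum.inl ()) = a := by
      rw [Matrix.transvection_mul_apply_same]; simp [hK]
    have hKj : (Matrix.transvection (Sum.inl () : Unit ⊕ ν) (Sum.inr i) (1 : ℤ) * K)
        (Sum.inl ()) (Sum.inr j) = D₀ i j := by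
      rw [Matrix.transvection_mul_apply_same]; simp [hK]
    have := dvd_row hR (by rw [hK0]; exact h0) (by rw [hK0]; exact hmin) (Sum.inr j)
    rwa [hK0, hKj] at this
  choose D hD using hdvd
  -- Multiplying the first row by the sign of `a` makes the corner nonnegative; the same sign is
  -- absorbed into `D`.
  have hsign : (a.sign * a : ℤ) = (a.natAbs : ℤ) := Int.sign_mul_self_eq_natAbs a
  refine ⟨a.natAbs, Matrix.of fun i j => a.sign * D i j, hclear.trans
    ⟨Matrix.fromBlocks (Matrix.of fun _ _ => a.sign) 0 0 1, 1, ?_, by simp, ?_⟩⟩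
  · rw [Matrix.det_fromBlocks_zero₁₂]
    simp only [Matrix.det_unique, Matrix.of_apply, Matrix.det_one, mul_one]
    exact Int.isUnit_iff.2 (by rcases lt_or_gt_of_ne h0 with h | h
                               · right; exact Int.sign_eq_neg_one_of_neg h
                               · left; exact Int.sign_eq_one_of_pos h)
  · rw [Matrix.mul_one, Matrix.fromBlocks_multiply]
    congr 1
    · ext i j; simp [Matrix.mul_apply, hsign]
    · simp
    · simp
    · ext i j
      have hs : a.sign * a.sign = 1 := by
        rcases lt_or_gt_of_ne h0 with h | h
        · rw [Int.sign_eq_neg_one_of_neg h]; norm_num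
        · rw [Int.sign_eq_one_of_pos h]; norm_num
      simp only [Matrix.mul_zero, Matrix.one_mul, zero_add, Matrix.smul_apply, Matrix.of_apply,
        smul_eq_mul, ← hsign, hD i j]
      linear_combination (-(a * D i j)) * hs

/-- Induction on the size. Since the common factor `a` is removed before the induction hypothesis is
used and put back afterwards, `a` divides all later entries and the divisibility chain is automatic.
-/
theorem exists_diagonal (n : ℕ) : ∀ M : Matrix (Fin n) (Fin n) ℤ, ∃ d : Fin n → ℕ,
    (∀ i j, i ≤ j → d i ∣ d j) ∧ Rel M (Matrix.diagonal fun i => (d i : ℤ)) := by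
  induction n with
  | zero => exact fun M => ⟨fun _ => 0, fun i => i.elim0, by
      convert Rel.refl M using 1; exact Subsingleton.elim _ _⟩
  | succ n ih =>
    intro M
    by_cases hM : M = 0
    · refine ⟨fun _ => 0, fun _ _ _ => dvd_rfl, ?_⟩
      rw [hM]
      convert Rel.refl (0 : Matrix (Fin (n + 1)) (Fin (n + 1)) ℤ)
      ext i j; simp [Matrix.diagonal_apply]
    · have hM' : M.submatrix (succEquiv n) (succEquiv n) ≠ 0 := by
        intro h
        apply hM
        ext i j
        have := congrFun (congrFun h ((succEquiv n).symm i)) ((succEquiv n).symm j)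
        simpa using this
      obtain ⟨a, D, hD⟩ := exists_block _ hM'
      obtain ⟨d, hd, P, Q, hP, hQ, hPQ⟩ := ih D
      refine ⟨Fin.cons a fun i => a * d i, ?_, ?_⟩
      · intro i j
        refine Fin.cases ?_ (fun i => ?_) i <;> refine Fin.cases ?_ (fun j => ?_) j
        · simp
        · simp
        · intro h; exact absurd h (by simp)
        · intro h
          simpa using mul_dvd_mul_left a (hd i j (by simpa using h))
      · have h2 : Rel (M.submatrix (succEquiv n) (succEquiv n))
            ((Matrix.diagonal fun i => (((Fin.cons a fun i => a * d i : Fin (n + 1) → ℕ) i : ℕ) : ℤ)).submatrix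
              (succEquiv n) (succEquiv n)) := by
          refine hD.trans ⟨Matrix.fromBlocks 1 0 0 P, Matrix.fromBlocks 1 0 0 Q, ?_, ?_, ?_⟩
          · rw [Matrix.det_fromBlocks_zero₁₂]; simpa using hP
          · rw [Matrix.det_fromBlocks_zero₁₂]; simpa using hQ
          · rw [Matrix.fromBlocks_multiply, Matrix.fromBlocks_multiply]
            ext i j
            rcases i with i | i <;> rcases j with j | j
            · simp [succEquiv]
            · simp [succEquiv, (Fin.succ_ne_zero j).symm]
            · simp [succEquiv]
            · have := congrFun (congrFun hPQ i) j
              have hs : P * ((a : ℤ) • D) * Q = (a : ℤ) • (P * D * Q) := by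
                rw [Matrix.mul_smul, Matrix.smul_mul]
              simp only [Matrix.zero_mul, Matrix.mul_zero, zero_add, Matrix.fromBlocks_apply₂₂, hs,
                Matrix.smul_apply, this]
              simp [succEquiv, Matrix.diagonal_apply]
        have h3 := h2.submatrix (succEquiv n).symm
        rwa [Matrix.submatrix_submatrix, Matrix.submatrix_submatrix, Equiv.self_comp_symm,
          Matrix.submatrix_id_id, Matrix.submatrix_id_id] at h3

end SmithForm

/-- This guarantees that the choice made in `snf` is an actual normal form. Uniqueness is not
needed: the invariants below can be read from any normal form. -/
theorem exists_hasSmithNormalForm {ι : Type*} [Fintype ι] [DecidableEq ι] (M : Matrix ι ι ℤ) :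
    ∃ D, HasSmithNormalForm M D := by
  let e := Fintype.equivFin ι
  obtain ⟨d, hd, h⟩ := SmithForm.exists_diagonal _ (M.submatrix e.symm e.symm)
  obtain ⟨P, Q, hP, hQ, hPQ⟩ := h.submatrix e
  refine ⟨_, e, d, P, Q, hd, hP, hQ, ?_, rfl⟩
  rw [Matrix.submatrix_submatrix, Equiv.symm_comp_self, Matrix.submatrix_id_id] at hPQ
  rw [hPQ]
  ext i j
  simp [Matrix.diagonal_apply]

/-! ### Factorizations of matrices over `ZMod 8` -/

namespace Matrix

variable {ι κ ι' κ' : Type*}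

/-- `M` is a product of two matrices with inner dimension `m`. -/
def FactorsThrough (M : Matrix ι κ (ZMod 8)) (m : ℕ) : Prop :=
  ∃ (A : Matrix ι (Fin m) (ZMod 8)) (B : Matrix (Fin m) κ (ZMod 8)), A * B = M

theorem factorsThrough_iff {M : Matrix ι κ (ZMod 8)} {m : ℕ} :
    M.FactorsThrough m ↔ ∃ B : Fin m → κ → ZMod 8,
      ∀ i, M i ∈ Submodule.span (ZMod 8) (Set.range B) := by
  constructor
  · rintro ⟨A, B, rfl⟩
    refine ⟨B, fun i => (Submodule.mem_span_range_iff_exists_fun _).2 ⟨A i, ?_⟩⟩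
    ext j
    simp [Matrix.mul_apply]
  · rintro ⟨B, h⟩
    choose A hA using fun i => (Submodule.mem_span_range_iff_exists_fun _).1 (h i)
    refine ⟨Matrix.of A, Matrix.of B, ?_⟩
    ext i j
    rw [← hA i]
    simp [Matrix.mul_apply]

theorem FactorsThrough.submatrix {M : Matrix ι κ (ZMod 8)} {m : ℕ} (h : M.FactorsThrough m)
    (e : ι' → ι) (f : κ' → κ) : (M.submatrix e f).FactorsThrough m := by
  obtain ⟨A, B, rfl⟩ := h
  exact ⟨A.submatrix e id, B.submatrix id f, by ext i j; simp [Matrix.mul_apply]⟩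

theorem FactorsThrough.mul_left [Fintype ι] {M : Matrix ι κ (ZMod 8)} {m : ℕ}
    (h : M.FactorsThrough m) (P : Matrix ι' ι (ZMod 8)) : (P * M).FactorsThrough m := by
  obtain ⟨A, B, rfl⟩ := h
  exact ⟨P * A, B, by rw [Matrix.mul_assoc]⟩

theorem FactorsThrough.mul_right [Fintype κ] {M : Matrix ι κ (ZMod 8)} {m : ℕ}
    (h : M.FactorsThrough m) (Q : Matrix κ κ' (ZMod 8)) : (M * Q).FactorsThrough m := by
  obtain ⟨A, B, rfl⟩ := h
  exact ⟨A, B * Q, by rw [Matrix.mul_assoc]⟩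

theorem FactorsThrough.mono {M : Matrix ι κ (ZMod 8)} {m n : ℕ} (h : M.FactorsThrough m)
    (hmn : m ≤ n) : M.FactorsThrough n := by
  rw [factorsThrough_iff] at h ⊢
  obtain ⟨B, hB⟩ := h
  refine ⟨fun i => if hi : (i : ℕ) < m then B ⟨i, hi⟩ else 0, fun i => ?_⟩
  refine Submodule.span_mono ?_ (hB i)
  rintro _ ⟨k, rfl⟩
  exact ⟨Fin.castLE hmn k, by simp⟩

/-- A wide family of vectors over `ZMod 8` satisfies a relation with an odd coefficient. -/
theorem exists_odd_vecMul_eq_zero {m k : ℕ} (h : k < m) (C : Matrix (Fin m) (Fin k) (ZMod 8)) :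
    ∃ u : Fin m → ZMod 8, u ᵥ* C = 0 ∧ ∃ i, 4 * u i ≠ 0 := by
  -- Over ℤ, more than `k` vectors in rank `k` are dependent. Dividing a relation by the gcd of its
  -- coefficients makes these coprime, so not all of them are even.
  let C' : Matrix (Fin m) (Fin k) ℤ := C.map fun a => (a.val : ℤ)
  have hC' : C'.map (Int.cast : ℤ → ZMod 8) = C := by ext i j; simp [C']
  obtain ⟨u, hu, hu0⟩ : ∃ u : Fin m → ℤ, u ᵥ* C' = 0 ∧ u ≠ 0 := by
    by_contra! hcon
    have hinj : Function.Injective C'.vecMulLinear := by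
      rw [injective_iff_map_eq_zero]
      exact fun u hu => hcon u hu
    exact absurd (le_of_fin_injective ℤ C'.vecMulLinear hinj) (by omega)
  have hne : (Finset.univ : Finset (Fin m)).Nonempty := ⟨⟨0, by omega⟩, Finset.mem_univ _⟩
  obtain ⟨g, hg, hg1⟩ := Finset.extract_gcd u hne
  have hgcd : Finset.univ.gcd u ≠ 0 := by
    intro h0
    apply hu0
    ext i
    exact Finset.gcd_eq_zero_iff.1 h0 i (Finset.mem_univ i)
  have hgC : g ᵥ* C' = 0 := by
    have : u = Finset.univ.gcd u • g := by ext i; simpa using hg i (Finset.mem_univ i)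
    rw [this, Matrix.smul_vecMul] at hu
    exact (smul_eq_zero.1 hu).resolve_left hgcd
  refine ⟨fun i => (g i : ZMod 8), ?_, ?_⟩
  · ext j
    have := congrArg (Int.cast : ℤ → ZMod 8) (congrFun hgC j)
    rw [← hC']
    simpa [Matrix.vecMul, dotProduct] using this
  · by_contra! hcon
    have h2 : (2 : ℤ) ∣ Finset.univ.gcd g := by
      refine Finset.dvd_gcd fun i _ => ?_
      have h8 : ((8 : ℕ) : ℤ) ∣ 4 * g i := by
        rw [← ZMod.intCast_zmod_eq_zero_iff_dvd]
        simpa using hcon i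
      omega
    rw [hg1] at h2
    norm_num at h2

/-- All coefficients of a linear relation between the `w i` are even. -/
def EvenIndep {m : ℕ} (w : Fin m → κ → ZMod 8) : Prop :=
  ∀ u : Fin m → ZMod 8, ∑ i, u i • w i = 0 → ∀ i, 4 * u i = 0

/-- If the `w i` were combinations of fewer than `m` vectors, a relation between the coefficient
vectors with an odd entry would carry over to the `w i`. -/
theorem FactorsThrough.le_of_evenIndep {M : Matrix ι κ (ZMod 8)} {m k : ℕ}
    (h : M.FactorsThrough k) {w : Fin m → κ → ZMod 8} (hw : EvenIndep w)
    (hM : ∀ i, w i ∈ Submodule.span (ZMod 8) (Set.range M)) : m ≤ k := by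
  rw [factorsThrough_iff] at h
  obtain ⟨B, hB⟩ := h
  have hMB : Submodule.span (ZMod 8) (Set.range M) ≤ Submodule.span (ZMod 8) (Set.range B) := by
    rw [Submodule.span_le]
    rintro _ ⟨i, rfl⟩
    exact hB i
  choose C hC using fun i => (Submodule.mem_span_range_iff_exists_fun _).1 (hMB (hM i))
  by_contra! hlt
  obtain ⟨u, hu, i, hi⟩ := exists_odd_vecMul_eq_zero hlt (Matrix.of C)
  refine hi (hw u ?_ i)
  simp only [← hC, Finset.smul_sum, smul_smul]
  rw [Finset.sum_comm]
  refine Finset.sum_eq_zero fun j _ => ?_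
  rw [← Finset.sum_smul]
  have := congrFun hu j
  simp only [Matrix.vecMul, dotProduct, Matrix.of_apply, Pi.zero_apply] at this
  rw [this, zero_smul]

/-- The nonzero rows suffice as generators. Conversely they are even-independent, because a unit
cannot annihilate a nonzero element of ℤ/8 and the units are exactly the odd classes. -/
theorem factorsThrough_diagonal [Fintype ι] [DecidableEq ι] {v : ι → ZMod 8} {m : ℕ} :
    (Matrix.diagonal v).FactorsThrough m ↔ (Finset.univ.filter fun i => v i ≠ 0).card ≤ m := by
  let e := (Finset.univ.filter fun i => v i ≠ 0).equivFin
  constructor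
  · intro h
    refine h.le_of_evenIndep (w := fun k => Matrix.diagonal v (e.symm k)) ?_ ?_
    · intro u hu i
      have := congrFun hu (e.symm i)
      rw [Finset.sum_apply, Finset.sum_eq_single i] at this
      · have hv : v (e.symm i) ≠ 0 := (Finset.mem_filter.1 (e.symm i).2).2
        simp only [Pi.smul_apply, Matrix.diagonal_apply_eq, smul_eq_mul, Pi.zero_apply] at this
        revert this hv
        generalize u i = a
        generalize v (e.symm i) = b
        revert a b
        decide
      · intro j _ hj
        have : ((e.symm j : _) : ι) ≠ e.symm i := fun h => hj (e.symm.injective (Subtype.ext h))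
        simp [Matrix.diagonal_apply_ne _ this]
      · simp
    · exact fun i => Submodule.subset_span ⟨_, rfl⟩
  · intro h
    refine FactorsThrough.mono ?_ h
    rw [factorsThrough_iff]
    refine ⟨fun k => Matrix.diagonal v (e.symm k), fun i => ?_⟩
    by_cases hi : v i = 0
    · have : Matrix.diagonal v i = 0 := by
        ext j; by_cases hij : i = j <;> simp [hij]
        rw [← hij, hi]
      rw [this]; exact Submodule.zero_mem _
    · refine Submodule.subset_span ⟨e ⟨i, by simpa using hi⟩, by simp⟩

theorem factorsThrough_mul_mul_iff [Fintype ι] [DecidableEq ι] {P Q M : Matrix ι ι (ZMod 8)}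
    (hP : IsUnit P.det) (hQ : IsUnit Q.det) {m : ℕ} :
    (P * M * Q).FactorsThrough m ↔ M.FactorsThrough m := by
  refine ⟨fun h => ?_, fun h => (h.mul_left P).mul_right Q⟩
  have := (h.mul_left P⁻¹).mul_right Q⁻¹
  rwa [Matrix.mul_assoc P, Matrix.nonsing_inv_mul_cancel_left _ _ hP, Matrix.mul_assoc,
    Matrix.mul_nonsing_inv _ hQ, Matrix.mul_one] at this

end Matrix

/-! ### Elementary divisors and the incidence matrix modulo 8. -/

section

open Matrix

/-- For c = 4, 2, 1 the right-hand side counts the elementary divisors not divisible by 2, 4, 8. The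
transformation to diagonal form remains invertible over ℤ/8. -/
theorem HasSmithNormalForm.factorsThrough_iff {ι : Type*} [Fintype ι] [DecidableEq ι]
    {M : Matrix ι ι ℤ} {D : Multiset ℕ} (h : HasSmithNormalForm M D) (c : ZMod 8) {m : ℕ} :
    (c • M.map (Int.cast : ℤ → ZMod 8)).FactorsThrough m ↔
      (D.filter fun d : ℕ => c * (d : ZMod 8) ≠ 0).card ≤ m := by
  obtain ⟨e, d, P, Q, -, hP, hQ, hPQ, rfl⟩ := h
  have hdet : ∀ R : Matrix ι ι ℤ, IsUnit R.det →
      IsUnit (R.map (Int.cast : ℤ → ZMod 8)).det := by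
    intro R hR
    have := hR.map (Int.castRingHom (ZMod 8))
    rwa [RingHom.map_det] at this
  rw [← factorsThrough_mul_mul_iff (hdet P hP) (hdet Q hQ)]
  have hmul : P.map (Int.cast : ℤ → ZMod 8) * (c • M.map (Int.cast : ℤ → ZMod 8)) *
      Q.map (Int.cast : ℤ → ZMod 8) = Matrix.diagonal fun i => c * (d (e i) : ZMod 8) := by
    have := congrArg (fun R : Matrix ι ι ℤ => R.map (Int.castRingHom (ZMod 8))) hPQ
    simp only [Matrix.map_mul] at this
    rw [Matrix.mul_smul, Matrix.smul_mul]
    have h2 : P.map (Int.cast : ℤ → ZMod 8) * M.map (Int.cast : ℤ → ZMod 8) *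
      Q.map (Int.cast : ℤ → ZMod 8) = _ := this
    rw [h2]
    ext i j
    by_cases hij : i = j <;> simp [hij]
  rw [hmul, factorsThrough_diagonal, Multiset.filter_map, Multiset.card_map]
  have : (Finset.univ.filter fun i => c * (d (e i) : ZMod 8) ≠ 0).card =
      (Finset.univ.filter fun k => c * (d k : ZMod 8) ≠ 0).card := by
    refine Finset.card_bij (fun i _ => e i) ?_ ?_ ?_
    · intro i hi; simpa using hi
    · intro i _ j _ hij; exact e.injective hij
    · intro k hk; exact ⟨e.symm k, by simpa using hk, by simp⟩
  rw [this]
  rfl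

/-- The incidence matrix of the development of the graph of `f`, modulo `8`. -/
noncomputable def devMod {n : ℕ} (f : BoolFn n) :
    Matrix ((Fin n → ZMod 2) × ZMod 2) ((Fin n → ZMod 2) × ZMod 2) (ZMod 8) :=
  (devMatrix (graphFn f)).map (Int.cast : ℤ → ZMod 8)

theorem devMod_apply {n : ℕ} (f : BoolFn n) (g p : (Fin n → ZMod 2) × ZMod 2) :
    devMod f g p = if p.2 - g.2 = f (p.1 - g.1) then 1 else 0 := by
  classical
  have : p ∈ (fun a => a + g) '' graphFn f ↔ p.2 - g.2 = f (p.1 - g.1) := by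
    simp only [graphFn, Set.mem_image, Set.mem_range, exists_exists_eq_and]
    constructor
    · rintro ⟨x, rfl⟩; simp
    · intro h
      refine ⟨p.1 - g.1, ?_⟩
      rw [← h]
      ext <;> simp
  rw [devMod, Matrix.map_apply, devMatrix, Matrix.of_apply, Set.indicator_apply]
  simp only [this]
  split_ifs <;> simp

theorem factorsThrough_of_snf_eq {n : ℕ} {f g : BoolFn n} (h : snf f = snf g) (c : ZMod 8) {m : ℕ}
    (hf : (c • devMod f).FactorsThrough m) : (c • devMod g).FactorsThrough m := by
  have hF : HasSmithNormalForm (devMatrix (graphFn f)) (snf f) :=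
    Classical.epsilon_spec (exists_hasSmithNormalForm _)
  have hG : HasSmithNormalForm (devMatrix (graphFn g)) (snf g) :=
    Classical.epsilon_spec (exists_hasSmithNormalForm _)
  rw [devMod, hG.factorsThrough_iff, ← h, ← hF.factorsThrough_iff]
  exact hf

/-- The map (x, y) ↦ (A x, y + l x) takes the graph of `f'` to the graph of `f`, and its linear part
describes how translates are permuted; this gives the column permutation `ψ` and the row permutation
`φ`. -/
theorem EquivalentFn.exists_submatrix {n : ℕ} {f f' : BoolFn n} (h : EquivalentFn f f') :
    ∃ φ ψ : ((Fin n → ZMod 2) × ZMod 2) ≃ ((Fin n → ZMod 2) × ZMod 2),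
      devMod f' = (devMod f).submatrix φ ψ := by
  obtain ⟨A, l, ⟨a, b, hl⟩, hf⟩ := h
  let φ : ((Fin n → ZMod 2) × ZMod 2) → ((Fin n → ZMod 2) × ZMod 2) :=
    fun g => (A.linear g.1, g.2 + a ⬝ᵥ g.1)
  let ψ : ((Fin n → ZMod 2) × ZMod 2) → ((Fin n → ZMod 2) × ZMod 2) :=
    fun p => (A p.1, p.2 + l p.1)
  have hφ : Function.Injective φ := by
    rintro ⟨x, v⟩ ⟨y, w⟩ hxy
    simp only [φ, Prod.mk.injEq] at hxy
    obtain ⟨h1, h2⟩ := hxy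
    have : x = y := A.linear.injective h1
    subst this
    simpa using h2
  have hψ : Function.Injective ψ := by
    rintro ⟨x, v⟩ ⟨y, w⟩ hxy
    simp only [ψ, Prod.mk.injEq] at hxy
    obtain ⟨h1, h2⟩ := hxy
    have : x = y := A.injective h1
    subst this
    simpa using h2
  refine ⟨Equiv.ofBijective φ (Finite.injective_iff_bijective.1 hφ),
    Equiv.ofBijective ψ (Finite.injective_iff_bijective.1 hψ), ?_⟩
  ext g p
  simp only [Matrix.submatrix_apply, Equiv.ofBijective_apply, devMod_apply, φ, ψ]
  have hA : A (p.1 - g.1) = A p.1 - A.linear g.1 := by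
    have := A.toAffineMap.map_vadd p.1 (-g.1)
    simp only [vadd_eq_add, AffineEquiv.coe_toAffineMap, map_neg] at this
    rw [sub_eq_neg_add, this, sub_eq_neg_add]
    rfl
  have hlin : l (p.1 - g.1) = l p.1 - a ⬝ᵥ g.1 := by
    rw [hl, hl, dotProduct_sub]; ring
  rw [hf, hA, hlin]
  congr 1
  apply propext
  generalize f (A p.1 - A.linear g.1) = s
  generalize l p.1 = t
  generalize a ⬝ᵥ g.1 = r
  generalize p.2 = y
  generalize g.2 = z
  revert s t r y z
  decide

theorem EquivalentFn.factorsThrough_iff {n : ℕ} {f f' : BoolFn n} (h : EquivalentFn f f')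
    (c : ZMod 8) {m : ℕ} :
    (c • devMod f').FactorsThrough m ↔ (c • devMod f).FactorsThrough m := by
  obtain ⟨φ, ψ, hφψ⟩ := h.exists_submatrix
  constructor
  · intro hf
    have := hf.submatrix φ.symm ψ.symm
    rw [hφψ] at this
    convert this using 1
    ext i j; simp
  · intro hf
    rw [hφψ]
    exact hf.submatrix φ ψ

/-- The translates of `f`, as functions with values in `ZMod 8`. -/
def translateFn {n : ℕ} (f : BoolFn n) (a x : Fin n → ZMod 2) : ZMod 8 := ((f (x + a)).val : ZMod 8)

/-- On the columns (x, 1) the row of (a, 0) is the translate of `f` by `a`, so lower bounds may be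
proved inside the smaller space of functions on 𝔽₂ⁿ. -/
theorem le_of_factorsThrough {n : ℕ} {f : BoolFn n} {c : ZMod 8} {m k : ℕ}
    (h : (c • devMod f).FactorsThrough k) {w : Fin m → (Fin n → ZMod 2) → ZMod 8}
    (hw : EvenIndep w)
    (hspan : ∀ i, w i ∈ Submodule.span (ZMod 8)
      (insert (fun _ => c) (Set.range fun a => c • translateFn f a))) :
    m ≤ k := by
  have h' := h.submatrix id (fun x : Fin n → ZMod 2 => (x, (1 : ZMod 2)))
  have hsub : ∀ x : Fin n → ZMod 2, ∀ a, x - a = x + a := by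
    intro x a; ext i; simp [CharTwo.sub_eq_add]
  have hM : ∀ a, ((c • devMod f).submatrix id fun x : Fin n → ZMod 2 => (x, (1 : ZMod 2))) (a, 0) =
      c • translateFn f a := by
    intro a
    ext x
    simp only [Matrix.submatrix_apply, Matrix.smul_apply, devMod_apply, Pi.smul_apply,
      translateFn, sub_zero, id, hsub]
    congr 1
    generalize f (x + a) = s
    revert s
    decide
  -- The rows of (0, 0) and (0, 1) are indicators of complementary sets, which is how the constant
  -- enters the row space.
  have hM1 : ((c • devMod f).submatrix id fun x : Fin n → ZMod 2 => (x, (1 : ZMod 2))) (0, 0) +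
      ((c • devMod f).submatrix id fun x : Fin n → ZMod 2 => (x, (1 : ZMod 2))) (0, 1) =
        fun _ => c := by
    ext x
    simp only [Matrix.submatrix_apply, Matrix.smul_apply, devMod_apply, Pi.add_apply,
      sub_zero, id, ← smul_add]
    have key : ∀ (c : ZMod 8) (s : ZMod 2),
        c • ((if 1 = s then 1 else 0) + if 1 - 1 = s then 1 else 0 : ZMod 8) = c := by decide
    exact key c (f x)
  refine h'.le_of_evenIndep hw fun i => ?_
  refine Submodule.span_le.2 ?_ (hspan i)
  rintro _ (rfl | ⟨a, rfl⟩)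
  · rw [SetLike.mem_coe, ← hM1]
    exact Submodule.add_mem _ (Submodule.subset_span ⟨_, rfl⟩) (Submodule.subset_span ⟨_, rfl⟩)
  · change c • translateFn f a ∈ _
    rw [← hM]
    exact Submodule.subset_span ⟨_, rfl⟩

/-- The columns (x, 0) carry the complement 1 - f of what the columns (x, 1) carry. The sign in `L`
accounts for -f and the single extra generator `e₀` for the 1; hence the bound `m + 1`. -/
theorem factorsThrough_of_span {n : ℕ} {f : BoolFn n} {c : ZMod 8} {m : ℕ}
    (B : Fin m → (Fin n → ZMod 2) → ZMod 8)
    (hf : ∀ a, c • translateFn f a ∈ Submodule.span (ZMod 8) (Set.range B))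
    (hc : (fun _ => c) ∈ Submodule.span (ZMod 8) (Set.range B)) :
    (c • devMod f).FactorsThrough (m + 1) := by
  let L : ((Fin n → ZMod 2) → ZMod 8) →ₗ[ZMod 8] ((Fin n → ZMod 2) × ZMod 2 → ZMod 8) :=
    { toFun := fun b p => if p.2 = 1 then b p.1 else -b p.1
      map_add' := by
        intro b b'; ext p; by_cases hp : p.2 = 1 <;> simp [hp]; ring
      map_smul' := by
        intro r b; ext p; by_cases hp : p.2 = 1 <;> simp [hp] }
  let e₀ : (Fin n → ZMod 2) × ZMod 2 → ZMod 8 := fun p => if p.2 = 1 then 0 else 1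
  rw [Matrix.factorsThrough_iff]
  refine ⟨Fin.cons e₀ fun i => L (B i), ?_⟩
  set S := Submodule.span (ZMod 8) (Set.range (Fin.cons e₀ fun i => L (B i) :
    Fin (m + 1) → (Fin n → ZMod 2) × ZMod 2 → ZMod 8)) with hS
  have he : e₀ ∈ S := Submodule.subset_span ⟨0, rfl⟩
  have hL : ∀ b ∈ Submodule.span (ZMod 8) (Set.range B), L b ∈ S := by
    intro b hb
    have : Submodule.span (ZMod 8) (Set.range B) ≤ S.comap L := by
      rw [Submodule.span_le]
      rintro _ ⟨i, rfl⟩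
      exact Submodule.subset_span ⟨i.succ, rfl⟩
    exact this hb
  rintro ⟨a, v⟩
  have hsub : ∀ x : Fin n → ZMod 2, x - a = x + a := by
    intro x; ext i; simp [CharTwo.sub_eq_add]
  have hv : v = 0 ∨ v = 1 := by revert v; decide
  have key₀ : ∀ (c : ZMod 8) (s y : ZMod 2), (c * if y - 0 = s then 1 else 0) =
      (if y = 1 then c * (s.val : ZMod 8) else -(c * (s.val : ZMod 8))) +
        c * if y = 1 then 0 else 1 := by decide
  have key₁ : ∀ (c : ZMod 8) (s y : ZMod 2), (c * if y - 1 = s then 1 else 0) =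
      ((if y = 1 then c else -c) + c * if y = 1 then 0 else 1) -
        if y = 1 then c * (s.val : ZMod 8) else -(c * (s.val : ZMod 8)) := by decide
  rcases hv with rfl | rfl
  · have : (c • devMod f) (a, 0) = L (c • translateFn f a) + c • e₀ := by
      ext ⟨x, y⟩
      simp only [Matrix.smul_apply, devMod_apply, hsub, L, e₀, translateFn, LinearMap.coe_mk,
        AddHom.coe_mk, Pi.add_apply, Pi.smul_apply, smul_eq_mul]
      exact key₀ c (f (x + a)) y
    rw [this]
    exact S.add_mem (hL _ (hf a)) (S.smul_mem _ he)
  · have : (c • devMod f) (a, 1) = L (fun _ => c) + c • e₀ - L (c • translateFn f a) := by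
      ext ⟨x, y⟩
      simp only [Matrix.smul_apply, devMod_apply, hsub, L, e₀, translateFn, LinearMap.coe_mk,
        AddHom.coe_mk, Pi.add_apply, Pi.sub_apply, Pi.smul_apply, smul_eq_mul]
      exact key₁ c (f (x + a)) y
    rw [this]
    exact S.sub_mem (S.add_mem (hL _ hc) (S.smul_mem _ he)) (hL _ (hf a))

end

/-! ### Bit tables of Boolean functions -/

namespace Nat

theorem xor_one_eq (a : ℕ) : a ^^^ 1 = 2 * (a / 2) + (1 - a % 2) := by
  have h := Nat.mod_two_eq_zero_or_one a
  refine Nat.eq_of_testBit_eq fun i => ?_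
  rcases i with _ | i
  · rcases h with h | h <;> simp [Nat.testBit_zero, h] <;> omega
  · rw [Nat.testBit_xor, Nat.testBit_succ, Nat.testBit_succ, Nat.testBit_succ,
      show (2 * (a / 2) + (1 - a % 2)) / 2 = a / 2 by omega]
    simp

theorem xor_two_pow_eq (k i : ℕ) : k ^^^ 2 ^ i = 2 ^ i * (k / 2 ^ i ^^^ 1) + k % 2 ^ i := by
  have h : k % 2 ^ i < 2 ^ i := Nat.mod_lt _ (by positivity)
  refine Nat.eq_of_testBit_eq fun j => ?_
  rw [Nat.testBit_two_pow_mul_add _ h, Nat.testBit_xor, Nat.testBit_two_pow]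
  split_ifs with hj
  · rw [Nat.testBit_mod_two_pow]; simp [hj, hj.ne']
  · rw [Nat.testBit_xor, Nat.testBit_div_two_pow, Nat.sub_add_cancel (by omega)]
    congr 1
    rcases Nat.eq_or_lt_of_le (not_lt.1 hj) with rfl | h'
    · simp
    · rw [Nat.testBit_lt_two_pow (Nat.one_lt_two_pow (by omega))]
      simp [h'.ne]

theorem xor_two_pow_of_testBit_false {k i : ℕ} (h : k.testBit i = false) :
    k ^^^ 2 ^ i = k + 2 ^ i := by
  rw [Nat.testBit_eq_decide_div_mod_eq, decide_eq_false_iff_not] at h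
  rw [xor_two_pow_eq, xor_one_eq]
  have h1 := Nat.div_add_mod k (2 ^ i)
  have h2 : 2 * (k / 2 ^ i / 2) + (1 - k / 2 ^ i % 2) = k / 2 ^ i + 1 := by omega
  rw [h2]
  linarith [Nat.mul_add (2 ^ i) (k / 2 ^ i) 1]

theorem xor_two_pow_of_testBit_true {k i : ℕ} (h : k.testBit i = true) :
    (k ^^^ 2 ^ i) + 2 ^ i = k := by
  rw [Nat.testBit_eq_decide_div_mod_eq, decide_eq_true_iff] at h
  rw [xor_two_pow_eq, xor_one_eq]
  have h1 := Nat.div_add_mod k (2 ^ i)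
  have h2 : 2 * (k / 2 ^ i / 2) + (1 - k / 2 ^ i % 2) + 1 = k / 2 ^ i := by omega
  calc _ = 2 ^ i * (2 * (k / 2 ^ i / 2) + (1 - k / 2 ^ i % 2) + 1) + k % 2 ^ i := by ring
    _ = k := by rw [h2, h1]

end Nat

namespace BitTable

/-- The number with base `2 ^ w` digits `c 0, …, c (n - 1)`. -/
def pack (w n : ℕ) (c : ℕ → ℕ) : ℕ := ∑ j ∈ Finset.range n, c j * 2 ^ (w * j)

theorem pack_lt {w : ℕ} {c : ℕ → ℕ} (hc : ∀ j, c j < 2 ^ w) (n : ℕ) :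
    pack w n c < 2 ^ (w * n) := by
  induction n with
  | zero => simp [pack]
  | succ n ih =>
    rw [pack, Finset.sum_range_succ, ← pack, Nat.mul_succ, pow_add]
    have : (c n + 1) * 2 ^ (w * n) ≤ 2 ^ w * 2 ^ (w * n) := Nat.mul_le_mul_right _ (hc n)
    nlinarith

theorem testBit_pack {w : ℕ} {c : ℕ → ℕ} (hc : ∀ j, c j < 2 ^ w) (n j : ℕ) {k : ℕ} (hk : k < w) :
    (pack w n c).testBit (w * j + k) = (decide (j < n) && (c j).testBit k) := by
  induction n with
  | zero => simp [pack]
  | succ n ih =>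
    rw [pack, Finset.sum_range_succ, ← pack, add_comm, mul_comm (c n),
      Nat.testBit_two_pow_mul_add _ (pack_lt hc n)]
    split_ifs with h
    · have hj : j < n := by
        by_contra hcon
        have := Nat.mul_le_mul_left w (not_lt.1 hcon)
        omega
      rw [ih]; simp [hj, hj.trans (Nat.lt_succ_self n)]
    · have hj : n ≤ j := by
        by_contra! hcon
        have := Nat.mul_le_mul_left w (Nat.succ_le_of_lt hcon)
        rw [Nat.mul_succ] at this
        omega
      rcases hj.eq_or_lt with rfl | hlt
      · simp
      · have hlarge : (c n).testBit (w * j + k - w * n) = false := by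
          refine Nat.testBit_lt_two_pow ((hc n).trans_le (Nat.pow_le_pow_right (by norm_num) ?_))
          have := Nat.mul_le_mul_left w (Nat.succ_le_of_lt hlt)
          rw [Nat.mul_succ] at this
          omega
        rw [hlarge]
        simp [show ¬ j < n + 1 by omega]

/-- The number with `n` digits `1` in base `2 ^ w`. -/
def repunit (w n : ℕ) : ℕ := (2 ^ (w * n) - 1) / (2 ^ w - 1)

theorem repunit_eq_pack {w : ℕ} (hw : 0 < w) (n : ℕ) : repunit w n = pack w n fun _ => 1 := by
  have h2 : 2 ≤ 2 ^ w := Nat.le_self_pow hw.ne' 2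
  rw [repunit, pow_mul, ← Nat.geomSum_eq h2, pack]
  simp [pow_mul]

theorem testBit_repunit {w : ℕ} (hw : 0 < w) (n j : ℕ) {k : ℕ} (hk : k < w) :
    (repunit w n).testBit (w * j + k) = (decide (j < n) && decide (k = 0)) := by
  rw [repunit_eq_pack hw, testBit_pack (fun _ => Nat.one_lt_two_pow hw.ne') _ _ hk]
  congr 1
  rcases k with _ | k
  · simp
  · rw [Nat.testBit_lt_two_pow (Nat.one_lt_two_pow (by omega))]; simp

theorem and_repunit {w : ℕ} (hw : 0 < w) (n v : ℕ) :
    v &&& repunit w n = pack w n fun j => (v.testBit (w * j)).toNat := by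
  have hlt : ∀ j, (v.testBit (w * j)).toNat < 2 ^ w := fun j =>
    (Bool.toNat_lt _).trans_le (Nat.le_self_pow hw.ne' 2)
  refine Nat.eq_of_testBit_eq fun i => ?_
  rw [← Nat.div_add_mod i w, Nat.testBit_and, testBit_repunit hw _ _ (Nat.mod_lt _ hw),
    testBit_pack hlt _ _ (Nat.mod_lt _ hw), Nat.testBit_bool_toNat]
  by_cases h : i % w = 0 <;> by_cases h' : i / w < n <;> simp [h, h']

/-- Since `e` fits into one digit, the product has no carries: it writes a copy of `e` into each
block whose lowest bit is set in `v`. One multiplication thus performs a row operation on all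
vectors of a block. -/
theorem testBit_mul_and_repunit {w : ℕ} (hw : 0 < w) {e : ℕ} (he : e < 2 ^ w) (n v j : ℕ) {k : ℕ}
    (hk : k < w) :
    (e * (v &&& repunit w n)).testBit (w * j + k) =
      ((decide (j < n) && v.testBit (w * j)) && e.testBit k) := by
  have hlt : ∀ j, (v.testBit (w * j)).toNat * e < 2 ^ w := fun j => by
    cases v.testBit (w * j) <;> simp [he]
  have : e * (v &&& repunit w n) = pack w n fun j => (v.testBit (w * j)).toNat * e := by
    rw [and_repunit hw, pack, pack, Finset.mul_sum]
    exact Finset.sum_congr rfl fun j _ => by ring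
  rw [this, testBit_pack hlt _ _ hk]
  cases v.testBit (w * j) <;> simp

/-- If only bits at multiples of `w` are kept, the remainder modulo `2 ^ w - 1` counts them. -/
theorem and_repunit_mod {w : ℕ} (hw : 0 < w) {n : ℕ} (hn : n < 2 ^ w - 1) (v : ℕ) :
    (v &&& repunit w n) % (2 ^ w - 1) =
      ∑ j ∈ Finset.range n, (v.testBit (w * j)).toNat := by
  have h1 : 1 ≤ 2 ^ w := Nat.one_le_two_pow
  have hpow : ∀ j, 2 ^ (w * j) ≡ 1 [MOD 2 ^ w - 1] := by
    intro j
    have : 2 ^ w ≡ 1 [MOD 2 ^ w - 1] := by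
      exact ((Nat.modEq_iff_dvd' h1).2 dvd_rfl).symm
    simpa [pow_mul] using this.pow j
  have hmod : (v &&& repunit w n) ≡ ∑ j ∈ Finset.range n, (v.testBit (w * j)).toNat
      [MOD 2 ^ w - 1] := by
    rw [and_repunit hw, pack]
    have : ∀ m, ∑ j ∈ Finset.range m, (v.testBit (w * j)).toNat * 2 ^ (w * j) ≡
        ∑ j ∈ Finset.range m, (v.testBit (w * j)).toNat [MOD 2 ^ w - 1] := by
      intro m
      induction m with
      | zero => exact Nat.ModEq.refl _
      | succ m ih =>
        rw [Finset.sum_range_succ, Finset.sum_range_succ]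
        exact ih.add (by simpa using (Nat.ModEq.refl _).mul (hpow m))
    exact this n
  have hle : ∑ j ∈ Finset.range n, (v.testBit (w * j)).toNat ≤ n := by
    calc _ ≤ ∑ _j ∈ Finset.range n, 1 := Finset.sum_le_sum fun j _ => Bool.toNat_le _
      _ = n := by simp
  rw [hmod, Nat.mod_eq_of_lt (hle.trans_lt hn)]

/-- The set of `k < 2 ^ N` whose bit `i` is not set, for `i < N`. -/
def lowMask : ℕ → ℕ → ℕ
  | 0, _ => 0
  | N + 1, i => cond (Nat.beq N i) (2 ^ 2 ^ i - 1) (lowMask N i ||| lowMask N i <<< 2 ^ N)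

theorem testBit_lowMask {N i : ℕ} (hi : i < N) (k : ℕ) :
    (lowMask N i).testBit k = (decide (k < 2 ^ N) && !k.testBit i) := by
  induction N generalizing k with
  | zero => omega
  | succ N ih =>
    rw [lowMask]
    by_cases hN : N = i
    · subst hN
      simp only [Nat.beq_refl, cond_true, Nat.testBit_two_pow_sub_one]
      by_cases hk : k < 2 ^ N
      · simp [hk, hk.trans (Nat.pow_lt_pow_right (by norm_num) (Nat.lt_succ_self N)),
          Nat.testBit_lt_two_pow hk]
      · by_cases hk' : k < 2 ^ (N + 1)
        · have : k.testBit N = true := by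
            rw [Nat.testBit_eq_decide_div_mod_eq, decide_eq_true_iff]
            have : k / 2 ^ N = 1 := by
              rw [pow_succ] at hk'
              exact Nat.div_eq_of_lt_le (by omega) (by omega)
            rw [this]
          simp [hk, this]
        · simp [hk, hk']
    · have hb : Nat.beq N i = false := by
        rw [Bool.eq_false_iff]; exact fun h => hN (Nat.eq_of_beq_eq_true h)
      have hiN : i < N := by omega
      rw [hb, cond_false, Nat.testBit_or, Nat.testBit_shiftLeft, ih hiN, ih hiN]
      by_cases hk : k < 2 ^ N
      · have hk' : k < 2 ^ (N + 1) := hk.trans (Nat.pow_lt_pow_right (by norm_num) (by omega))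
        simp [hk, hk', show ¬ 2 ^ N ≤ k by omega]
      · have hadd : k = 2 ^ N * 1 + (k - 2 ^ N) := by omega
        by_cases hk' : k < 2 ^ (N + 1)
        · have hlt : k - 2 ^ N < 2 ^ N := by rw [pow_succ] at hk'; omega
          have : k.testBit i = (k - 2 ^ N).testBit i := by
            conv_lhs => rw [hadd]
            rw [Nat.testBit_two_pow_mul_add _ hlt, if_pos hiN]
          simp [hk, hk', hlt, this, show 2 ^ N ≤ k by omega]
        · have hlt : ¬ k - 2 ^ N < 2 ^ N := by rw [pow_succ] at hk'; omega
          simp [hk, hk', hlt]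

/-- The table of the `i`-th variable on `N`-bit indices. -/
def varTable (N i : ℕ) : ℕ := lowMask N i <<< 2 ^ i

theorem testBit_varTable {N i k : ℕ} (hi : i < N) (hk : k < 2 ^ N) :
    (varTable N i).testBit k = k.testBit i := by
  rw [varTable, Nat.testBit_shiftLeft, testBit_lowMask hi]
  cases h : k.testBit i
  · by_cases hle : 2 ^ i ≤ k
    · have : (k - 2 ^ i).testBit i = true := by
        by_contra hcon
        have h2 := Nat.xor_two_pow_of_testBit_false (Bool.not_eq_true _ ▸ hcon)
        rw [Nat.sub_add_cancel hle] at h2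
        rw [← h2, Nat.testBit_xor, Nat.testBit_two_pow_self] at h
        simp_all
      simp [this]
    · simp [hle]
  · have h1 := Nat.xor_two_pow_of_testBit_true h
    have h2 : k - 2 ^ i = k ^^^ 2 ^ i := by omega
    rw [h2, Nat.testBit_xor, h, Nat.testBit_two_pow_self]
    have : k ^^^ 2 ^ i < 2 ^ N := lt_of_le_of_lt (Nat.le.intro h1) hk
    simp [this, show 2 ^ i ≤ k by omega]

/-- The table with the indices `k` and `k ^^^ 2 ^ i` interchanged. -/
def flip (N i v : ℕ) : ℕ :=
  Nat.lor (Nat.land (Nat.shiftRight v (Nat.pow 2 i)) (lowMask N i))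
    (Nat.shiftLeft (Nat.land v (lowMask N i)) (Nat.pow 2 i))

theorem flip_eq (N i v : ℕ) :
    flip N i v = (v >>> 2 ^ i &&& lowMask N i) ||| (v &&& lowMask N i) <<< 2 ^ i := rfl

theorem testBit_flip {N i k : ℕ} (hi : i < N) (hk : k < 2 ^ N) (v : ℕ) :
    (flip N i v).testBit k = v.testBit (k ^^^ 2 ^ i) := by
  rw [flip_eq, Nat.testBit_or, Nat.testBit_and, Nat.testBit_shiftRight, Nat.testBit_shiftLeft,
    Nat.testBit_and, testBit_lowMask hi, testBit_lowMask hi]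
  cases h : k.testBit i
  · rw [Nat.xor_two_pow_of_testBit_false h]
    by_cases hle : 2 ^ i ≤ k
    · have : (k - 2 ^ i).testBit i = true := by
        by_contra hcon
        have h2 := Nat.xor_two_pow_of_testBit_false (Bool.not_eq_true _ ▸ hcon)
        rw [Nat.sub_add_cancel hle] at h2
        rw [← h2, Nat.testBit_xor, Nat.testBit_two_pow_self] at h
        simp_all
      simp [this, hk, add_comm]
    · simp [hle, hk, add_comm]
  · have h1 := Nat.xor_two_pow_of_testBit_true h
    have h2 : k - 2 ^ i = k ^^^ 2 ^ i := by omega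
    rw [h2, Nat.testBit_xor, h, Nat.testBit_two_pow_self]
    have : k ^^^ 2 ^ i < 2 ^ N := lt_of_le_of_lt (Nat.le.intro h1) hk
    simp [this, show 2 ^ i ≤ k by omega]

/-- A bit as an element of the field with two elements. -/
def bitZ (b : Bool) : ZMod 2 := cond b 1 0

theorem bitZ_xor (a b : Bool) : bitZ (a ^^ b) = bitZ a + bitZ b := by
  revert a b; decide

theorem bitZ_and (a b : Bool) : bitZ (a && b) = bitZ a * bitZ b := by
  revert a b; decide

theorem bitZ_decide (s : ZMod 2) : bitZ (decide (s = 1)) = s := by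
  revert s; decide

/-- The point of `𝔽₂ⁿ` given by the bits `o, …, o + n - 1` of `k`. -/
def point (n o k : ℕ) : Fin n → ZMod 2 := fun i => bitZ (k.testBit (i + o))

theorem point_xor (n o k m : ℕ) : point n o (k ^^^ m) = point n o k + point n o m := by
  ext i; simp [point, bitZ_xor, Nat.testBit_xor]

theorem point_shiftLeft (n o m : ℕ) : point n o (m <<< o) = point n 0 m := by
  ext i; simp [point, Nat.testBit_shiftLeft]

theorem point_mod (n o k N : ℕ) (h : n + o ≤ N) : point n o (k % 2 ^ N) = point n o k := by
  ext i
  have : (i : ℕ) + o < N := by omega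
  simp [point, Nat.testBit_mod_two_pow, this]

/-- The number with the coordinates of `x` as binary digits. -/
def code {n : ℕ} (x : Fin n → ZMod 2) : ℕ := Nat.ofBits fun i => decide (x i = 1)

theorem code_lt {n : ℕ} (x : Fin n → ZMod 2) : code x < 2 ^ n := Nat.ofBits_lt_two_pow _

theorem testBit_code {n : ℕ} (x : Fin n → ZMod 2) (i : Fin n) :
    (code x).testBit i = decide (x i = 1) := Nat.testBit_ofBits_lt _ _ i.2

@[simp] theorem point_code {n : ℕ} (x : Fin n → ZMod 2) : point n 0 (code x) = x := by
  ext i; rw [point, Nat.add_zero, testBit_code, bitZ_decide]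

theorem code_point {n k : ℕ} (h : k < 2 ^ n) : code (point n 0 k) = k := by
  refine Nat.eq_of_testBit_eq fun i => ?_
  by_cases hi : i < n
  · rw [show i = ((⟨i, hi⟩ : Fin n) : ℕ) from rfl, testBit_code, point]
    cases k.testBit i <;> simp [bitZ]
  · have hin : 2 ^ n ≤ 2 ^ i := Nat.pow_le_pow_right (by norm_num) (not_lt.1 hi)
    rw [Nat.testBit_lt_two_pow ((code_lt _).trans_le hin), Nat.testBit_lt_two_pow (h.trans_le hin)]

theorem point_two_pow (n : ℕ) (i : Fin n) : point n 0 (2 ^ (i : ℕ)) = Pi.single i 1 := by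
  ext j
  rcases eq_or_ne j i with rfl | h
  · simp [point, bitZ]
  · simp [point, bitZ, h, Fin.val_inj, h.symm]

@[simp] theorem point_zero (n o : ℕ) : point n o 0 = 0 := by
  ext i; simp [point, bitZ]

/-- The bits of `T` are the values of `f`: the argument of `f` is read off from the bits
`o, …, o + n - 1` of an index with `N` bits. -/
def IsTable {n : ℕ} (N o T : ℕ) (f : BoolFn n) : Prop :=
  ∀ k < 2 ^ N, bitZ (T.testBit k) = f (point n o k)

theorem IsTable.apply {n T : ℕ} {f : BoolFn n} (h : IsTable n 0 T f) (x : Fin n → ZMod 2) :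
    bitZ (T.testBit (code x)) = f x := by
  rw [h _ (code_lt x), point_code]

theorem IsTable.xor {n N o T T' : ℕ} {f f' : BoolFn n} (h : IsTable N o T f)
    (h' : IsTable N o T' f') : IsTable N o (Nat.xor T T') (f + f') := by
  intro k hk
  change bitZ ((T ^^^ T').testBit k) = _
  rw [Nat.testBit_xor, bitZ_xor, h k hk, h' k hk]; rfl

theorem IsTable.flip {n N o T : ℕ} {f : BoolFn n} (h : IsTable N o T f) {i : ℕ} (hi : i + o < N) :
    IsTable N o (flip N (i + o) T) fun x => f (x + point n 0 (2 ^ i)) := by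
  intro k hk
  rw [testBit_flip hi hk, h _ (Nat.xor_lt_two_pow hk (Nat.pow_lt_pow_right (by norm_num) hi)),
    point_xor]
  congr 2
  ext j
  simp [point, Nat.testBit_two_pow]

/-- The table of a sum of cubic monomials. -/
noncomputable def cubicTable (N o : ℕ) {n : ℕ} (L : List (Fin n × Fin n × Fin n)) : ℕ :=
  List.rec 0 (fun t _ T => Nat.xor (Nat.land (Nat.land (varTable N (Nat.add t.1 o))
    (varTable N (Nat.add t.2.1 o))) (varTable N (Nat.add t.2.2 o))) T) L

theorem isTable_cubicTable {n N o : ℕ} (h : n + o ≤ N) (L : List (Fin n × Fin n × Fin n)) :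
    IsTable N o (cubicTable N o L) (cubicOf L) := by
  induction L with
  | nil => intro k _; simp [cubicTable, cubicOf, bitZ]
  | cons t L ih =>
    intro k hk
    have hv : ∀ i : Fin n, (varTable N (Nat.add i o)).testBit k = k.testBit (i + o) := fun i =>
      testBit_varTable (show (i : ℕ) + o < N by omega) hk
    have ht : cubicTable N o (t :: L) = (varTable N (Nat.add t.1 o) &&& varTable N (Nat.add t.2.1 o)
      &&& varTable N (Nat.add t.2.2 o)) ^^^ cubicTable N o L := rfl
    rw [ht, Nat.testBit_xor, Nat.testBit_and, Nat.testBit_and, hv, hv, hv, bitZ_xor, ih k hk,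
      bitZ_and, bitZ_and]
    simp [cubicOf, point]

/-- Whether the bit `i` of `v` is set. -/
def bitSet (v i : ℕ) : Bool := Nat.beq (Nat.land (Nat.shiftRight v i) 1) 1

theorem bitSet_eq (v i : ℕ) : bitSet v i = v.testBit i := by
  have h : ∀ n : ℕ, Nat.beq n 1 = decide (n = 1) := fun n => by
    rw [Bool.eq_iff_iff, Nat.beq_eq, decide_eq_true_iff]
  change Nat.beq ((v >>> i) &&& 1) 1 = _
  rw [h, Nat.and_one_is_mod, Nat.testBit_eq_decide_div_mod_eq, Nat.shiftRight_eq_div_pow]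

/-- The table of the translate by the point with the lowest `m` bits of the code `S`. -/
noncomputable def translate (N o T S m : ℕ) : ℕ :=
  Nat.rec T (fun i T => Bool.rec T (flip N (Nat.add i o) T) (bitSet S i)) m

theorem IsTable.translate {n N o T : ℕ} {f : BoolFn n} (h : IsTable N o T f) (S : ℕ) {m : ℕ}
    (hm : m + o ≤ N) :
    IsTable N o (translate N o T S m) fun x => f (x + point n 0 (S % 2 ^ m)) := by
  induction m with
  | zero =>
    intro k hk
    change bitZ (T.testBit k) = _
    simpa [Nat.mod_one] using h k hk
  | succ m ih =>
    have ih := ih (by omega)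
    have hS : S % 2 ^ (m + 1) = (S % 2 ^ m) ^^^ cond (S.testBit m) (2 ^ m) 0 := by
      refine Nat.eq_of_testBit_eq fun i => ?_
      rw [Nat.testBit_xor, Nat.testBit_mod_two_pow, Nat.testBit_mod_two_pow]
      rcases lt_trichotomy i m with hi | rfl | hi
      · cases S.testBit m <;>
          simp [hi, hi.trans (Nat.lt_succ_self m), hi.ne']
      · cases hb : S.testBit i <;> simp
      · cases S.testBit m <;>
          simp [show ¬ i < m + 1 by omega, show ¬ i < m by omega, hi.ne]
    have ht : BitTable.translate N o T S (m + 1) = Bool.rec (BitTable.translate N o T S m)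
      (BitTable.flip N (m + o) (BitTable.translate N o T S m)) (bitSet S m) := rfl
    rw [ht, bitSet_eq, hS, point_xor]
    cases S.testBit m
    · simpa using ih
    · have := ih.flip (i := m) (by omega)
      intro k hk
      rw [this k hk]
      simp only [cond_true, add_assoc]
      rw [add_comm (point n 0 (2 ^ m))]

theorem IsTable.translate' {n T : ℕ} {f : BoolFn n} (h : IsTable n 0 T f) (S : ℕ) :
    IsTable n 0 (BitTable.translate n 0 T S n) fun x => f (x + point n 0 S) := by
  have := h.translate S (m := n) le_rfl
  rwa [point_mod n 0 S n le_rfl] at this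

/-! ### Vectors over `ZMod 8` as triples of bit tables -/

/-- A vector over `ZMod 8`, given by the bit tables of the binary digits of its entries. -/
structure V3 where
  a : ℕ
  b : ℕ
  c : ℕ

/-- `k n`, evaluated after `n`. -/
def forced {α : Type} (n : ℕ) (k : ℕ → α) : α := Bool.rec (k n) (k n) (Nat.beq n 0)

@[simp] theorem forced_eq {α : Type} (n : ℕ) (k : ℕ → α) : forced n k = k n := by
  rw [forced]; cases Nat.beq n 0 <;> rfl

/-- The number with the bit `b` as its only binary digit, modulo `8`. -/
def bit8 (b : Bool) : ZMod 8 := cond b 1 0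

namespace V3

/-- The entry with index `k`. -/
def val (v : V3) (k : ℕ) : ZMod 8 :=
  bit8 (v.a.testBit k) + 2 * bit8 (v.b.testBit k) + 4 * bit8 (v.c.testBit k)

/-- `k v`, evaluated after `v`. -/
def forced {α : Type} (v : V3) (k : V3 → α) : α :=
  BitTable.forced v.a fun a => BitTable.forced v.b fun b => BitTable.forced v.c fun c => k ⟨a, b, c⟩

@[simp] theorem forced_eq {α : Type} (v : V3) (k : V3 → α) : forced v k = k v := by
  simp [forced]

/-- The sum of two vectors. -/
def add (u v : V3) : V3 :=
  (fun t s => ⟨Nat.xor u.a v.a, Nat.xor t s,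
    Nat.xor (Nat.xor u.c v.c) (Nat.lor (Nat.land u.b v.b) (Nat.land s t))⟩)
    (Nat.xor u.b v.b) (Nat.land u.a v.a)

/-- A binary adder on three digit planes; dropping the carry out of the third plane is reduction
modulo 8. -/
theorem val_add (u v : V3) (k : ℕ) : (u.add v).val k = u.val k + v.val k := by
  have h : u.add v = ⟨u.a ^^^ v.a, (u.b ^^^ v.b) ^^^ (u.a &&& v.a),
    (u.c ^^^ v.c) ^^^ ((u.b &&& v.b) ||| ((u.a &&& v.a) &&& (u.b ^^^ v.b)))⟩ := rfl
  rw [h]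
  simp only [val, Nat.testBit_xor, Nat.testBit_and, Nat.testBit_or]
  generalize u.a.testBit k = a
  generalize u.b.testBit k = b
  generalize u.c.testBit k = c
  generalize v.a.testBit k = d
  generalize v.b.testBit k = e
  generalize v.c.testBit k = f
  revert a b c d e f
  decide

/-- Twice a vector. -/
def dbl (u : V3) : V3 := ⟨0, u.a, u.b⟩

theorem val_dbl (u : V3) (k : ℕ) : u.dbl.val k = 2 * u.val k := by
  simp only [val, dbl, Nat.zero_testBit]
  generalize u.a.testBit k = a
  generalize u.b.testBit k = b
  generalize u.c.testBit k = c
  revert a b c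
  decide

/-- All digits of `u` multiplied by `s`. -/
def smul (s : ℕ) (u : V3) : V3 := ⟨Nat.mul u.a s, Nat.mul u.b s, Nat.mul u.c s⟩

end V3

/-- The number of points. -/
def width : ℕ := Nat.pow 2 12

theorem width_eq : width = 2 ^ 12 := rfl

/-- The number with ones as its lowest `w` binary digits. -/
def mask (w : ℕ) : ℕ := Nat.sub (Nat.pow 2 w) 1

theorem mask_eq (w : ℕ) : mask w = 2 ^ w - 1 := rfl

/-- The number with ones as its lowest `width` binary digits. -/
def ones : ℕ := mask width

theorem ones_eq : ones = 2 ^ width - 1 := mask_eq width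

theorem testBit_land_ones (v k : ℕ) :
    (Nat.land v ones).testBit k = (decide (k < width) && v.testBit k) := by
  change (v &&& ones).testBit k = _
  rw [ones_eq, Nat.testBit_and, Nat.testBit_two_pow_sub_one, Bool.and_comm]

theorem width_pos : 0 < width := by rw [width_eq]; norm_num

/-- The number with the bits at the multiples of `width` set. -/
def spread : ℕ := repunit width 32

/-- The bits of `v` at the positions `p + width * j`, moved to `width * j`. -/
def column (v p : ℕ) : ℕ := Nat.land (Nat.shiftRight v p) spread

/-- The entries of the digits `u` are bounded by `2 ^ width`. -/
def V3.Small (u : V3) : Prop := u.a < 2 ^ width ∧ u.b < 2 ^ width ∧ u.c < 2 ^ width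

theorem testBit_mul_column {e : ℕ} (he : e < 2 ^ width) (v p j : ℕ) {k : ℕ} (hk : k < width) :
    (Nat.mul e (column v p)).testBit (width * j + k) =
      ((decide (j < 32) && v.testBit (p + width * j)) && e.testBit k) := by
  have h := testBit_mul_and_repunit width_pos he 32 (v >>> p) j hk
  rw [Nat.testBit_shiftRight] at h
  exact h

/-- `v` plus the multiples of `r` by the bits of `m` in the column `p`. -/
def addMul (r : V3) (p m : ℕ) (v : V3) : V3 := v.add (r.smul (column m p))

/-- The coefficient `t` may depend on the block index `j` but not on the position `k`: it is the
digit found in the pivot column of the `j`-th vector. -/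
theorem val_addMul {r : V3} (hr : r.Small) (p m : ℕ) (v : V3) (j : ℕ) :
    ∃ t : ZMod 8, ∀ k < width,
      (addMul r p m v).val (width * j + k) = v.val (width * j + k) + t * r.val k := by
  refine ⟨bit8 (decide (j < 32) && m.testBit (p + width * j)), fun k hk => ?_⟩
  rw [addMul, V3.val_add]
  congr 1
  simp only [V3.val, V3.smul, testBit_mul_column hr.1 _ _ _ hk, testBit_mul_column hr.2.1 _ _ _ hk,
    testBit_mul_column hr.2.2 _ _ _ hk]
  cases (decide (j < 32) && m.testBit (p + width * j)) <;> simp [bit8]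

/-- `addMul` when only the last digit of `r` is nonzero. -/
def addMulLast (r : V3) (p : ℕ) (v : V3) : V3 :=
  ⟨v.a, v.b, Nat.xor v.c (Nat.mul r.c (column v.c p))⟩

/-- With only the top digit present, addition is an exclusive or on that plane, as carries would be
multiples of 8. -/
theorem val_addMulLast {r : V3} (hr : r.Small) (ha : r.a = 0) (hb : r.b = 0) (p : ℕ) (v : V3)
    (j : ℕ) : ∃ t : ZMod 8, ∀ k < width,
      (addMulLast r p v).val (width * j + k) = v.val (width * j + k) + t * r.val k := by
  refine ⟨bit8 (decide (j < 32) && v.c.testBit (p + width * j)), fun k hk => ?_⟩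
  have h : addMulLast r p v = ⟨v.a, v.b, v.c ^^^ Nat.mul r.c (column v.c p)⟩ := rfl
  rw [h]
  simp only [V3.val, Nat.testBit_xor, testBit_mul_column hr.2.2 _ _ _ hk, ha, hb, Nat.zero_testBit]
  generalize v.a.testBit (width * j + k) = a
  generalize v.b.testBit (width * j + k) = b
  generalize v.c.testBit (width * j + k) = c
  generalize r.c.testBit k = d
  generalize (decide (j < 32) && v.c.testBit (p + width * j)) = e
  revert a b c d e
  decide

/-! ### Row reduction of blocks of vectors. -/

/-- A vector that is divisible by `2 ^ l`, with a pivot at `p`. -/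
structure Row where
  l : ℕ
  p : ℕ
  v : V3

/-- Clear the column of the pivot of `r`. -/
noncomputable def step (r : Row) (v : V3) : V3 :=
  Nat.rec (addMulLast r.v.dbl.dbl r.p ((fun w => addMul r.v.dbl r.p w.b w) (addMul r.v r.p v.a v)))
    (fun l _ => Nat.rec (addMulLast r.v.dbl r.p (addMul r.v r.p v.b v))
      (fun _ _ => addMulLast r.v r.p v) l) r.l

/-- The digits of `r` are bounded, and the lowest `r.l` digits vanish. -/
def Row.Good (r : Row) : Prop :=
  r.v.Small ∧ (1 ≤ r.l → r.v.a = 0) ∧ (2 ≤ r.l → r.v.b = 0)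

theorem V3.Small.dbl {u : V3} (h : u.Small) : u.dbl.Small :=
  ⟨by simp [V3.dbl], h.1, h.2.1⟩

/-- Only the fact that a multiple of the row is added is proved. That the pivot column has really
been cleared is left to the final tests `isEchelon` and `reducesToZero`. -/
theorem val_step {r : Row} (hr : r.Good) (v : V3) (j : ℕ) :
    ∃ t : ZMod 8, ∀ k < width,
      (step r v).val (width * j + k) = v.val (width * j + k) + t * r.v.val k := by
  obtain ⟨l, p, r⟩ := r
  obtain ⟨hs, ha, hb⟩ := hr
  simp only at hs ha hb
  rcases l with _ | _ | l
  · obtain ⟨t₁, h₁⟩ := val_addMul hs p v.a v j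
    obtain ⟨t₂, h₂⟩ := val_addMul hs.dbl p (addMul r p v.a v).b (addMul r p v.a v) j
    obtain ⟨t₃, h₃⟩ := val_addMulLast hs.dbl.dbl rfl rfl p
      (addMul r.dbl p (addMul r p v.a v).b (addMul r p v.a v)) j
    refine ⟨t₁ + 2 * t₂ + 4 * t₃, fun k hk => (h₃ k hk).trans ?_⟩
    simp only [h₂ k hk, h₁ k hk, V3.val_dbl]
    ring
  · obtain ⟨t₁, h₁⟩ := val_addMul hs p v.b v j
    obtain ⟨t₂, h₂⟩ := val_addMulLast hs.dbl rfl (ha le_rfl) p (addMul r p v.b v) j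
    refine ⟨t₁ + 2 * t₂, fun k hk => (h₂ k hk).trans ?_⟩
    rw [h₁ k hk, V3.val_dbl]
    ring
  · exact val_addMulLast hs (ha (by omega)) (hb (by omega)) p v j

/-- The vectors on the points of `𝔽₂¹²`. -/
abbrev PointFn : Type := (Fin 12 → ZMod 2) → ZMod 8

/-- The `j`-th vector of a block of vectors. -/
def V3.fn (v : V3) (j : ℕ) : PointFn := fun x => v.val (width * j + code x)

theorem fn_step {r : Row} (hr : r.Good) (v : V3) (j : ℕ) :
    ∃ t : ZMod 8, (step r v).fn j = v.fn j + t • r.v.fn 0 := by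
  obtain ⟨t, ht⟩ := val_step hr v j
  refine ⟨t, funext fun x => ?_⟩
  have := ht (code x) (code_lt x)
  simpa [V3.fn] using this

/-- Reduce a block of vectors by the rows of `E`. -/
noncomputable def reduce (E : List Row) : V3 → V3 :=
  List.rec (fun v => v) (fun r _ ih v => V3.forced (step r v) ih) E

theorem reduce_cons (r : Row) (E : List Row) (v : V3) :
    reduce (r :: E) v = reduce E (step r v) :=
  V3.forced_eq _ _

/-- Both directions are used: reduced generators stay in the module, and a generator that reduces to
zero belongs to it. -/
theorem fn_reduce_mem_iff {W : Submodule (ZMod 8) PointFn} {E : List Row}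
    (hE : ∀ r ∈ E, r.Good ∧ r.v.fn 0 ∈ W) (v : V3) (j : ℕ) :
    (reduce E v).fn j ∈ W ↔ v.fn j ∈ W := by
  induction E generalizing v with
  | nil => rfl
  | cons r E ih =>
    rw [reduce_cons, ih fun s hs => hE s (List.mem_cons_of_mem _ hs)]
    obtain ⟨hr, hW⟩ := hE r List.mem_cons_self
    obtain ⟨t, ht⟩ := fn_step hr v j
    rw [ht]
    exact W.add_mem_iff_left (W.smul_mem t hW)

/-- The first vector of a block. -/
def V3.first (v : V3) : V3 := ⟨Nat.land v.a ones, Nat.land v.b ones, Nat.land v.c ones⟩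

/-- A block without its first vector. -/
def V3.rest (v : V3) : V3 :=
  ⟨Nat.shiftRight v.a width, Nat.shiftRight v.b width, Nat.shiftRight v.c width⟩

theorem fn_first (v : V3) : v.first.fn 0 = v.fn 0 := by
  ext x
  have := code_lt x
  rw [← width_eq] at this
  simp only [V3.fn, V3.val, V3.first, testBit_land_ones, mul_zero, zero_add, this, decide_true,
    Bool.true_and]

theorem fn_rest (v : V3) (j : ℕ) : v.rest.fn j = v.fn (j + 1) := by
  ext x
  have h : ∀ n, (Nat.shiftRight n width).testBit (width * j + code x) =
      n.testBit (width * (j + 1) + code x) := fun n => by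
    refine (Nat.testBit_shiftRight (x := n)).trans ?_
    congr 1; ring
  simp only [V3.fn, V3.val, V3.rest, h]

/-- Extract the vectors of a block as rows with the pivots in the list `ps`. -/
noncomputable def extract (l : ℕ) (ps : List ℕ) : V3 → List Row :=
  List.rec (fun _ => []) (fun p _ ih v => V3.forced v.first fun e => V3.forced v.rest fun w =>
    V3.forced (step ⟨l, p, e⟩ w) fun w => ⟨l, p, e⟩ :: ih w) ps

theorem extract_cons (l p : ℕ) (ps : List ℕ) (v : V3) :
    extract l (p :: ps) v = ⟨l, p, v.first⟩ :: extract l ps (step ⟨l, p, v.first⟩ v.rest) := by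
  have : extract l (p :: ps) v = V3.forced v.first fun e => V3.forced v.rest fun w =>
    V3.forced (step ⟨l, p, e⟩ w) fun w => ⟨l, p, e⟩ :: extract l ps w := rfl
  simp [this]

theorem fn_extract_mem {W : Submodule (ZMod 8) PointFn} {l : ℕ} {ps : List ℕ} {v : V3}
    (hW : ∀ j, v.fn j ∈ W) (hg : ∀ r ∈ extract l ps v, r.Good) :
    ∀ r ∈ extract l ps v, r.v.fn 0 ∈ W := by
  induction ps generalizing v with
  | nil => intro r hr; exact absurd hr List.not_mem_nil
  | cons p ps ih =>
    rw [extract_cons] at hg ⊢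
    have h0 : v.first.fn 0 ∈ W := by rw [fn_first]; exact hW 0
    intro r hr
    rcases List.mem_cons.1 hr with rfl | hr
    · exact h0
    · refine ih (fun j => ?_) (fun s hs => hg s (List.mem_cons_of_mem _ hs)) r hr
      obtain ⟨t, ht⟩ := fn_step (hg _ List.mem_cons_self) v.rest j
      rw [ht, fn_rest]
      exact W.add_mem (hW _) (W.smul_mem t h0)

/-- The block with the given digit in the plane `i` and zeros in the others. -/
noncomputable def plane (i v : ℕ) : V3 :=
  Nat.rec ⟨v, 0, 0⟩ (fun i _ => Nat.rec ⟨0, v, 0⟩ (fun _ _ => ⟨0, 0, v⟩) i) i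

theorem val_plane {i : ℕ} (hi : i ≤ 2) (v k : ℕ) :
    (plane i v).val k = 2 ^ i * bit8 (v.testBit k) := by
  have h0 : plane 0 v = ⟨v, 0, 0⟩ := rfl
  have h1 : plane 1 v = ⟨0, v, 0⟩ := rfl
  have h2 : plane 2 v = ⟨0, 0, v⟩ := rfl
  interval_cases i <;> simp only [h0, h1, h2, V3.val, Nat.zero_testBit] <;>
    cases v.testBit k <;> decide

/-- The table of a translate of the table `T`, or of the constant `1` if the code `S` is not the
code of a point. -/
noncomputable def generator (T S : ℕ) : ℕ :=
  Bool.rec (translate 12 0 T S 12) ones (Nat.ble width S)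

/-- The tables of several generators, one after another. -/
noncomputable def batch (T : ℕ) (l : List ℕ) : ℕ :=
  List.rec 0 (fun S _ ih => Nat.lor (Nat.land (generator T S) ones) (Nat.shiftLeft ih width)) l

/-- The function with the table `generator T S`, multiplied by `c`. -/
def generatorFn (c : ZMod 8) (f : BoolFn 12) (S : ℕ) : PointFn :=
  cond (Nat.ble width S) (fun _ => c) (c • translateFn f (point 12 0 S))

theorem bit8_eq (b : Bool) : bit8 b = ((bitZ b).val : ZMod 8) := by
  revert b; decide

theorem bit8_generator {f : BoolFn 12} {T : ℕ} (hT : IsTable 12 0 T f) (S : ℕ) (c : ZMod 8)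
    (x : Fin 12 → ZMod 2) :
    c * bit8 ((generator T S).testBit (code x)) = generatorFn c f S x := by
  have : code x < width := code_lt x
  rw [generator, generatorFn]
  cases Nat.ble width S
  · simp only [cond_false, Pi.smul_apply, smul_eq_mul, translateFn, bit8_eq]
    rw [(hT.translate' S).apply]
  · simp [ones_eq, Nat.testBit_two_pow_sub_one, this, bit8]

/-- Positions beyond the end of the list hold the zero vector, which is the default value and is
harmless for membership in a module. -/
theorem fn_batch {f : BoolFn 12} {T : ℕ} (hT : IsTable 12 0 T f) {i : ℕ} (hi : i ≤ 2)
    (l : List ℕ) (j : ℕ) :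
    (plane i (batch T l)).fn j = ((l[j]?).map (generatorFn (2 ^ i) f)).getD 0 := by
  induction l generalizing j with
  | nil => ext x; simp [V3.fn, val_plane hi, batch, bit8]
  | cons S l ih =>
    have hb : batch T (S :: l) = (Nat.land (generator T S) ones) ||| (batch T l <<< width) := rfl
    ext x
    have hx : code x < width := code_lt x
    rw [V3.fn, val_plane hi, hb, Nat.testBit_or, testBit_land_ones, Nat.testBit_shiftLeft]
    rcases j with _ | j
    · have := bit8_generator hT S (2 ^ i) x
      simpa [hx, show ¬ width ≤ code x by omega] using this
    · have h1 : width * (j + 1) + code x = (width * j + code x) + width := by ring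
      rw [h1]
      have := congrFun (ih j) x
      rw [V3.fn, val_plane hi] at this
      simpa [show ¬ width * j + code x + width < width by omega] using this

theorem fn_batch_mem {W : Submodule (ZMod 8) PointFn} {f : BoolFn 12} {T : ℕ}
    (hT : IsTable 12 0 T f) {i : ℕ} (hi : i ≤ 2) {l : List ℕ} :
    (∀ j, (plane i (batch T l)).fn j ∈ W) ↔ ∀ S ∈ l, generatorFn (2 ^ i) f S ∈ W := by
  constructor
  · intro h S hS
    obtain ⟨j, hj, rfl⟩ := List.mem_iff_getElem.1 hS
    have := h j
    rwa [fn_batch hT hi, List.getElem?_eq_getElem hj] at this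
  · intro h j
    rw [fn_batch hT hi]
    by_cases hj : j < l.length
    · rw [List.getElem?_eq_getElem hj]
      exact h _ (List.getElem_mem hj)
    · rw [List.getElem?_eq_none (not_lt.1 hj)]
      exact W.zero_mem

end BitTable

/-! ### Echelon systems and lower bounds. -/

/-- Evaluate a relation at the pivots in order. At `x i` the later terms vanish by the triangular
shape, and the earlier ones because a coefficient that annihilates the pivot entry annihilates the
whole vector; so `u i` annihilates its own pivot entry. -/
theorem Matrix.evenIndep_of_pivots {κ : Type*} {m : ℕ} {w : Fin m → κ → ZMod 8} (x : Fin m → κ)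
    (h0 : ∀ i j, i < j → w j (x i) = 0)
    (h : ∀ i t, t * w i (x i) = 0 → t • w i = 0 ∧ 4 * t = 0) : Matrix.EvenIndep w := by
  intro u hu i
  have key : ∀ i, u i * w i (x i) = 0 := by
    intro i
    induction i using WellFoundedLT.induction with
    | _ i ih =>
      have := congrFun hu (x i)
      rw [Finset.sum_apply, Finset.sum_eq_single i] at this
      · exact this
      · intro j _ hj
        rcases lt_or_gt_of_ne hj with hlt | hlt
        · exact congrFun (h j (u j) (ih j hlt)).1 (x i)
        · simp [h0 i j hlt]
      · simp
  exact (h i (u i) (key i)).2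

namespace BitTable

/-- The concatenation of two lists. -/
def concat {α : Type} (l m : List α) : List α := List.rec m (fun a _ ih => a :: ih) l

theorem concat_eq {α : Type} (l m : List α) : concat l m = l ++ m := by
  induction l with
  | nil => rfl
  | cons a l ih =>
    have : concat (a :: l) m = a :: concat l m := rfl
    rw [this, ih, List.cons_append]

/-- Add to `E` the rows obtained by eliminating further generators `S.2.1`, which give rows of
level `S.1` with the pivots `S.2.2`. -/
noncomputable def extend (T i : ℕ) (S : ℕ × List ℕ × List ℕ) (E : List Row) : List Row :=
  concat E (extract S.1 S.2.2 (reduce E (plane i (batch T S.2.1))))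

/-- Gaussian elimination of the generators of a list of blocks. -/
noncomputable def eliminate (T i : ℕ) (R : List (ℕ × List ℕ × List ℕ)) : List Row → List Row :=
  List.rec (fun E => E) (fun S _ ih E => ih (extend T i S E)) R

/-- Rows are only added, so a test of the final list also covers the rows used at intermediate
stages. -/
theorem subset_eliminate (T i : ℕ) (R : List (ℕ × List ℕ × List ℕ)) (E : List Row) :
    E ⊆ eliminate T i R E := by
  induction R generalizing E with
  | nil => exact List.Subset.refl _
  | cons S R ih =>
    refine List.Subset.trans ?_ (ih (extend T i S E))
    rw [extend, concat_eq]
    exact List.subset_append_left _ _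

/-- Every row is obtained from generators by adding multiples of earlier rows; that the rows have
the required shape is supplied by the final list. -/
theorem fn_eliminate_mem {W : Submodule (ZMod 8) PointFn} {f : BoolFn 12} {T : ℕ}
    (hT : IsTable 12 0 T f) {i : ℕ} (hi : i ≤ 2) {R : List (ℕ × List ℕ × List ℕ)} {E : List Row}
    (hE : ∀ r ∈ E, r.v.fn 0 ∈ W) (hR : ∀ C ∈ R, ∀ S ∈ C.2.1, generatorFn (2 ^ i) f S ∈ W)
    (hg : ∀ r ∈ eliminate T i R E, r.Good) : ∀ r ∈ eliminate T i R E, r.v.fn 0 ∈ W := by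
  induction R generalizing E with
  | nil => exact hE
  | cons C R ih =>
    have hg' : ∀ r ∈ extend T i C E, r.Good := fun r hr =>
      hg r (subset_eliminate T i R (extend T i C E) hr)
    refine ih (E := extend T i C E) ?_ (fun D hD => hR D (List.mem_cons_of_mem _ hD)) hg
    rw [extend, concat_eq] at hg' ⊢
    intro r hr
    rcases List.mem_append.1 hr with hr | hr
    · exact hE r hr
    · refine fn_extract_mem (fun j => ?_) (fun s hs => hg' s (List.mem_append_right _ hs)) r hr
      rw [fn_reduce_mem_iff fun s hs => ⟨hg' s (List.mem_append_left _ hs), hE s hs⟩]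
      exact (fn_batch_mem hT hi).2 (hR C List.mem_cons_self) j

/-- The union of the binary digits of `v`. -/
def V3.support (v : V3) : ℕ := Nat.lor v.a (Nat.lor v.b v.c)

/-- The row `r` has the level and the pivot it claims, and vanishes on the set `P`. -/
noncomputable def Row.check (r : Row) (P : ℕ) : Bool :=
  Nat.ble r.v.support ones && (Nat.beq (Nat.land r.v.support P) 0 &&
    (Nat.rec (bitSet r.v.a r.p) (fun l _ => Nat.beq r.v.a 0 &&
      Nat.rec (bitSet r.v.b r.p) (fun _ _ => Nat.beq r.v.b 0 && bitSet r.v.c r.p) l) r.l))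

theorem V3.testBit_support (v : V3) (k : ℕ) :
    v.support.testBit k = (v.a.testBit k || (v.b.testBit k || v.c.testBit k)) := by
  change (v.a ||| (v.b ||| v.c)).testBit k = _
  rw [Nat.testBit_or, Nat.testBit_or]

theorem V3.small_of_support {v : V3} (h : v.support ≤ ones) : v.Small := by
  have h2 : v.support < 2 ^ width := by
    rw [ones_eq] at h
    exact lt_of_le_of_lt h (Nat.sub_lt (Nat.two_pow_pos _) one_pos)
  have : v.support = v.a ||| (v.b ||| v.c) := rfl
  rw [this] at h2
  exact ⟨Nat.left_le_or.trans_lt h2, (Nat.left_le_or.trans Nat.right_le_or).trans_lt h2,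
    (Nat.right_le_or.trans Nat.right_le_or).trans_lt h2⟩

/-- On level `l` the vector is divisible by 2^l (levels above 2 being treated as 2) and its pivot
entry is 2^l times a unit. A scalar annihilating that entry is divisible by 2^(3-l), so it
annihilates the vector and is even. -/
theorem Row.check_spec {r : Row} {P : ℕ} (h : r.check P = true) :
    r.Good ∧ r.p < width ∧ (∀ k, P.testBit k = true → r.v.val k = 0) ∧
      ∀ t : ZMod 8, t * r.v.val r.p = 0 → (∀ k, t * r.v.val k = 0) ∧ 4 * t = 0 := by
  obtain ⟨l, p, v⟩ := r
  rw [Row.check, Bool.and_eq_true, Bool.and_eq_true, Nat.ble_eq, Nat.beq_eq] at h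
  obtain ⟨h1, h2, h3⟩ := h
  simp only at h1 h2 h3
  have hs := V3.small_of_support h1
  have hlt : ∀ {u}, u < 2 ^ width → u.testBit p = true → p < width := fun hu hp => by
    by_contra hcon
    rw [Nat.testBit_lt_two_pow (hu.trans_le (Nat.pow_le_pow_right (by norm_num) (not_lt.1 hcon)))]
      at hp
    exact absurd hp (by simp)
  have hP : ∀ k, P.testBit k = true → v.val k = 0 := by
    intro k hk
    have := congrArg (fun n => n.testBit k) h2
    have hl : (Nat.land v.support P).testBit k = (v.support.testBit k && P.testBit k) :=
      Nat.testBit_and _ _ _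
    simp only [hl, hk, Bool.and_true, V3.testBit_support, Nat.zero_testBit, Bool.or_eq_false_iff]
      at this
    simp [V3.val, this.1, this.2.1, this.2.2, bit8]
  rcases l with _ | _ | l
  · have ha : v.a.testBit p = true := by rw [← bitSet_eq]; exact h3
    refine ⟨⟨hs, by simp, by simp⟩, hlt hs.1 ha, hP, fun t ht => ?_⟩
    have : t = 0 := by
      simp only [V3.val, ha] at ht
      generalize v.b.testBit p = b at ht
      generalize v.c.testBit p = c at ht
      revert t b c
      decide
    simp [this]
  · have h3' : (Nat.beq v.a 0 && bitSet v.b p) = true := h3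
    rw [Bool.and_eq_true, Nat.beq_eq, bitSet_eq] at h3'
    obtain ⟨ha, hb⟩ := h3'
    refine ⟨⟨hs, fun _ => ha, by simp⟩, hlt hs.2.1 hb, hP, fun t ht => ?_⟩
    simp only [V3.val, ha, hb, Nat.zero_testBit] at ht ⊢
    -- The pivot entry is 2 or 6, so `t` is a multiple of 4; in particular `2 * t = 0`, obtained
    -- after a finite case check.
    have ht2 : 2 * t = 0 ∨ 2 * t = 4 * t ∧ 4 * t = 0 := by
      generalize v.c.testBit p = c at ht
      revert t c
      decide
    have ht3 : 2 * t = 0 := by rcases ht2 with h | ⟨h, h'⟩ <;> simp_all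
    refine ⟨fun k => ?_, by rw [show (4 : ZMod 8) = 2 * 2 from by decide, mul_assoc, ht3, mul_zero]⟩
    generalize v.b.testBit k = b
    generalize v.c.testBit k = c
    clear ht ht2
    revert t b c
    decide
  · have h3' : (Nat.beq v.a 0 && (Nat.beq v.b 0 && bitSet v.c p)) = true := h3
    rw [Bool.and_eq_true, Bool.and_eq_true, Nat.beq_eq, Nat.beq_eq, bitSet_eq] at h3'
    obtain ⟨ha, hb, hc⟩ := h3'
    refine ⟨⟨hs, fun _ => ha, fun _ => hb⟩, hlt hs.2.2 hc, hP, fun t ht => ?_⟩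
    simp only [V3.val, ha, hb, hc, Nat.zero_testBit] at ht ⊢
    have ht2 : 4 * t = 0 := by
      revert t
      decide
    refine ⟨fun k => ?_, ht2⟩
    generalize v.c.testBit k = c
    clear ht
    revert t c
    decide

/-- All rows of `E` have the levels and pivots they claim, and vanish on the earlier pivots and on
the set `P`. -/
noncomputable def isEchelon (E : List Row) : ℕ → Bool :=
  List.rec (fun _ => true)
    (fun r _ ih P => r.check P && ih (Nat.lor P (Nat.shiftLeft 1 r.p))) E

theorem isEchelon_cons (r : Row) (E : List Row) (P : ℕ) :
    isEchelon (r :: E) P = (r.check P && isEchelon E (P ||| 1 <<< r.p)) := rfl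

theorem check_of_isEchelon {E : List Row} {P : ℕ} (h : isEchelon E P = true) :
    ∀ r ∈ E, ∃ Q, r.check Q = true ∧ ∀ k, P.testBit k = true → Q.testBit k = true := by
  induction E generalizing P with
  | nil => simp
  | cons r E ih =>
    rw [isEchelon_cons, Bool.and_eq_true] at h
    intro s hs
    rcases List.mem_cons.1 hs with rfl | hs
    · exact ⟨P, h.1, fun _ hk => hk⟩
    · obtain ⟨Q, hQ, hPQ⟩ := ih h.2 s hs
      exact ⟨Q, hQ, fun k hk => hPQ k (by simp [Nat.testBit_or, hk])⟩

theorem pairwise_of_isEchelon {E : List Row} {P : ℕ} (h : isEchelon E P = true) :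
    E.Pairwise fun r s => s.v.val r.p = 0 := by
  induction E generalizing P with
  | nil => exact List.Pairwise.nil
  | cons r E ih =>
    rw [isEchelon_cons, Bool.and_eq_true] at h
    refine List.Pairwise.cons (fun s hs => ?_) (ih h.2)
    obtain ⟨Q, hQ, hPQ⟩ := check_of_isEchelon h.2 s hs
    refine (Row.check_spec hQ).2.2.1 _ (hPQ _ ?_)
    rw [Nat.testBit_or, Nat.shiftLeft_eq, one_mul, Nat.testBit_two_pow_self, Bool.or_true]

theorem good_of_isEchelon {E : List Row} {P : ℕ} (h : isEchelon E P = true) :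
    ∀ r ∈ E, r.Good := fun r hr => by
  obtain ⟨Q, hQ, -⟩ := check_of_isEchelon h r hr
  exact (Row.check_spec hQ).1

theorem evenIndep_of_isEchelon {E : List Row} {P : ℕ} (h : isEchelon E P = true) :
    Matrix.EvenIndep fun i : Fin E.length => (E.get i).v.fn 0 := by
  have hval : ∀ (r : Row), r ∈ E → ∀ s : Row, s.v.fn 0 (point 12 0 r.p) = s.v.val r.p := by
    intro r hr s
    obtain ⟨Q, hQ, -⟩ := check_of_isEchelon h r hr
    have : code (point 12 0 r.p) = r.p := code_point (Row.check_spec hQ).2.1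
    rw [V3.fn, this, mul_zero, zero_add]
  refine Matrix.evenIndep_of_pivots (fun i => point 12 0 (E.get i).p) ?_ ?_
  · intro i j hij
    rw [hval _ (List.get_mem E i)]
    exact List.pairwise_iff_get.1 (pairwise_of_isEchelon h) i j hij
  · intro i t ht
    rw [hval _ (List.get_mem E i)] at ht
    obtain ⟨Q, hQ, -⟩ := check_of_isEchelon h _ (List.get_mem E i)
    obtain ⟨h1, h2⟩ := (Row.check_spec hQ).2.2.2 t ht
    exact ⟨funext fun x => h1 _, h2⟩

/-- The length of a list. -/
def count {α : Type} (l : List α) : ℕ := List.rec 0 (fun _ _ n => Nat.succ n) l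

theorem count_eq {α : Type} (l : List α) : count l = l.length := by
  induction l with
  | nil => rfl
  | cons a l ih => exact congrArg Nat.succ ih

/-- Elimination of the generators in `R` leads to `m` rows. -/
noncomputable def lowerCheck (T i : ℕ) (R : List (ℕ × List ℕ × List ℕ)) (m : ℕ) : Bool :=
  (fun E => isEchelon E 0 && Nat.beq (count E) m) (eliminate T i R [])

theorem generatorFn_mem {c : ZMod 8} {f : BoolFn 12} (S : ℕ) :
    generatorFn c f S ∈ Submodule.span (ZMod 8)
      (insert (fun _ => c) (Set.range fun a => c • translateFn f a)) := by
  rw [generatorFn]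
  cases Nat.ble width S
  · exact Submodule.subset_span (Or.inr ⟨_, rfl⟩)
  · exact Submodule.subset_span (Or.inl rfl)

/-- The echelon rows lie in the span of the scaled translates and the constant and are
even-independent, so their number bounds the inner dimension from below. -/
theorem le_of_lowerCheck {f : BoolFn 12} {T : ℕ} (hT : IsTable 12 0 T f) {i : ℕ} (hi : i ≤ 2)
    {R : List (ℕ × List ℕ × List ℕ)} {m k : ℕ} (h : lowerCheck T i R m = true)
    (hk : (((2 : ZMod 8) ^ i) • devMod f).FactorsThrough k) : m ≤ k := by
  have h' : (isEchelon (eliminate T i R []) 0 && Nat.beq (count (eliminate T i R [])) m) = true := h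
  rw [Bool.and_eq_true, Nat.beq_eq, count_eq] at h'
  obtain ⟨h1, rfl⟩ := h'
  refine le_of_factorsThrough hk (evenIndep_of_isEchelon h1) fun j => ?_
  exact fn_eliminate_mem hT hi (fun r hr => absurd hr List.not_mem_nil)
    (fun _ _ S _ => generatorFn_mem S) (good_of_isEchelon h1) _ (List.get_mem _ j)

/-! ### Upper bounds from spans closed under translation. -/

/-- The set of numbers in a list, as a bit table. -/
def codeMask (l : List ℕ) : ℕ := List.rec 0 (fun S _ ih => Nat.lor (Nat.shiftLeft 1 S) ih) l

theorem testBit_codeMask (l : List ℕ) (k : ℕ) : (codeMask l).testBit k = true ↔ k ∈ l := by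
  induction l with
  | nil => simp [codeMask]
  | cons S l ih =>
    have : codeMask (S :: l) = (1 <<< S) ||| codeMask l := rfl
    rw [this, Nat.testBit_or, Bool.or_eq_true, ih, Nat.shiftLeft_eq, one_mul, List.mem_cons,
      Nat.testBit_two_pow, decide_eq_true_iff, eq_comm]

/-- The generators of a list of blocks. -/
def codes (R : List (ℕ × List ℕ × List ℕ)) : List ℕ :=
  List.rec [] (fun C _ ih => concat C.2.1 ih) R

theorem mem_codes {R : List (ℕ × List ℕ × List ℕ)} {C : ℕ × List ℕ × List ℕ} (hC : C ∈ R) {S : ℕ}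
    (hS : S ∈ C.2.1) : S ∈ codes R := by
  induction R with
  | nil => exact absurd hC List.not_mem_nil
  | cons D R ih =>
    have : codes (D :: R) = concat D.2.1 (codes R) := rfl
    rw [this, concat_eq, List.mem_append]
    rcases List.mem_cons.1 hC with rfl | h
    · exact Or.inl hS
    · exact Or.inr (ih h)

/-- The rows of `E` reduce the generators in the blocks `B` to zero. -/
noncomputable def reducesToZero (T i : ℕ) (E : List Row) (B : List (List ℕ)) : Bool :=
  List.rec true (fun l _ ih =>
    (fun v : V3 => Nat.beq v.support 0) (reduce E (plane i (batch T l))) && ih) B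

/-- The numbers that arise from those in `P` by changing one digit are in `Q`. -/
noncomputable def isClosed (P Q m : ℕ) : Bool :=
  Nat.rec true (fun i ih => Nat.beq (Nat.lor (flip 12 i P) Q) Q && ih) m

/-- Flipping digit `i` is an involution, so a member `k` of `P` is found in the flipped table at `k
^^^ 2 ^ i`. -/
theorem isClosed_spec {P Q m : ℕ} (h : isClosed P Q m = true) (hm : m ≤ 12) {i : ℕ} (hi : i < m)
    {k : ℕ} (hk : k < width) (hP : P.testBit k = true) : Q.testBit (k ^^^ 2 ^ i) = true := by
  induction m with
  | zero => omega
  | succ m ih =>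
    have h' : (Nat.beq (Nat.lor (flip 12 m P) Q) Q && isClosed P Q m) = true := h
    rw [Bool.and_eq_true, Nat.beq_eq] at h'
    rcases Nat.lt_succ_iff_lt_or_eq.1 hi with hi | rfl
    · exact ih h'.2 (by omega) hi
    · have h1 : Nat.lor (flip 12 i P) Q = flip 12 i P ||| Q := rfl
      rw [← h'.1, h1, Nat.testBit_or, testBit_flip (by omega)
        (Nat.xor_lt_two_pow hk (Nat.pow_lt_pow_right (by norm_num) (by omega))),
        Nat.xor_assoc, Nat.xor_self, Nat.xor_zero, hP, Bool.true_or]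

/-- The `m` generators in `R` span a module which contains all generators. -/
noncomputable def upperCheck (T i : ℕ) (R : List (ℕ × List ℕ × List ℕ)) (B : List (List ℕ))
    (m : ℕ) : Bool :=
  (fun E P => isEchelon E 0 && (reducesToZero T i E B && (Nat.beq (count P) m &&
    (fun Q => bitSet Q 0 && (bitSet Q width && isClosed (codeMask P) Q 12))
      (codeMask (concat P (List.rec [] (fun l _ ih => concat l ih) B))))))
    (eliminate T i R []) (codes R)

theorem generatorFn_mem_of_reducesToZero {W : Submodule (ZMod 8) PointFn} {f : BoolFn 12} {T : ℕ}
    (hT : IsTable 12 0 T f) {i : ℕ} (hi : i ≤ 2) {E : List Row}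
    (hE : ∀ r ∈ E, r.Good ∧ r.v.fn 0 ∈ W) {B : List (List ℕ)} (h : reducesToZero T i E B = true)
    {S : ℕ} (hS : S ∈ (List.rec [] (fun l _ ih => concat l ih) B : List ℕ)) :
    generatorFn (2 ^ i) f S ∈ W := by
  induction B with
  | nil => exact absurd hS List.not_mem_nil
  | cons l B ih =>
    have h' : (Nat.beq (reduce E (plane i (batch T l))).support 0 && reducesToZero T i E B) = true :=
      h
    rw [Bool.and_eq_true, Nat.beq_eq] at h'
    have hS' : S ∈ concat l (List.rec [] (fun l _ ih => concat l ih) B : List ℕ) := hS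
    rw [concat_eq, List.mem_append] at hS'
    rcases hS' with hS' | hS'
    · refine (fn_batch_mem hT hi).1 (fun j => (fn_reduce_mem_iff hE _ j).1 ?_) S hS'
      have : (reduce E (plane i (batch T l))).fn j = 0 := by
        ext x
        have := V3.testBit_support (reduce E (plane i (batch T l))) (width * j + code x)
        rw [h'.1, Nat.zero_testBit, eq_comm, Bool.or_eq_false_iff, Bool.or_eq_false_iff] at this
        simp [V3.fn, V3.val, this.1, this.2.1, this.2.2, bit8]
      rw [this]
      exact W.zero_mem
    · exact ih h'.2 hS'

/-- Let W be the span of the generators with codes in `P`. Those with codes in `N` lie in W because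
they reduce to zero, and changing one digit of a code in `P` leads into `P` or `N`. So W is stable
under translation by unit vectors, hence by all vectors, and it contains every translate of f. -/
theorem factorsThrough_of_upperCheck {f : BoolFn 12} {T : ℕ} (hT : IsTable 12 0 T f) {i : ℕ}
    (hi : i ≤ 2) {R : List (ℕ × List ℕ × List ℕ)} {B : List (List ℕ)} {m : ℕ}
    (h : upperCheck T i R B m = true) :
    (((2 : ZMod 8) ^ i) • devMod f).FactorsThrough (m + 1) := by
  set E := eliminate T i R [] with hEdef
  set P := codes R with hPdef
  set N : List ℕ := List.rec [] (fun l _ ih => concat l ih) B with hN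
  have h' : (isEchelon E 0 && (reducesToZero T i E B && (Nat.beq (count P) m &&
    (bitSet (codeMask (concat P N)) 0 && (bitSet (codeMask (concat P N)) width &&
      isClosed (codeMask P) (codeMask (concat P N)) 12))))) = true := h
  simp only [Bool.and_eq_true, Nat.beq_eq, bitSet_eq, testBit_codeMask, concat_eq,
    count_eq] at h'
  obtain ⟨h1, h2, rfl, h3, h4, h5⟩ := h'
  set G : Fin P.length → PointFn := fun j => generatorFn (2 ^ i) f (P.get j)
  set W := Submodule.span (ZMod 8) (Set.range G) with hW
  have hPW : ∀ S ∈ P, generatorFn (2 ^ i) f S ∈ W := fun S hS => by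
    obtain ⟨j, hj⟩ := List.get_of_mem hS
    exact Submodule.subset_span ⟨j, by simp only [G, hj]⟩
  have hEW : ∀ r ∈ E, r.v.fn 0 ∈ W :=
    fn_eliminate_mem hT hi (fun r hr => absurd hr List.not_mem_nil)
      (fun C hC S hS => hPW S (mem_codes hC hS)) (good_of_isEchelon h1)
  have hPNW : ∀ S ∈ P ++ N, generatorFn (2 ^ i) f S ∈ W := fun S hS => by
    rcases List.mem_append.1 hS with hS | hS
    · exact hPW S hS
    · exact generatorFn_mem_of_reducesToZero hT hi
        (fun r hr => ⟨good_of_isEchelon h1 r hr, hEW r hr⟩) h2 hS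
  have hlt : ∀ {S}, S < width → Nat.ble width S = false := fun hS => by
    rw [Bool.eq_false_iff, Ne, Nat.ble_eq]; omega
  let tr : (Fin 12 → ZMod 2) → PointFn →ₗ[ZMod 8] PointFn := fun a =>
    LinearMap.funLeft (ZMod 8) (ZMod 8) fun x => x + a
  -- Stability needs to be tested on the spanning generators only, and translating a generator by a
  -- unit vector flips one digit of its code.
  have hsingle : ∀ j : Fin 12, W ≤ W.comap (tr (Pi.single j 1)) := by
    intro j
    rw [hW, Submodule.span_le, ← hW]
    rintro _ ⟨k, rfl⟩
    have hk : P.get k ∈ P := List.get_mem P k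
    change tr _ (generatorFn _ f (P.get k)) ∈ W
    generalize P.get k = S at hk ⊢
    by_cases hS : S < width
    · have hS' : S ^^^ 2 ^ (j : ℕ) < width :=
        Nat.xor_lt_two_pow hS (Nat.pow_lt_pow_right (by norm_num) j.2)
      have hmem := isClosed_spec h5 le_rfl j.2 hS ((testBit_codeMask _ _).2 hk)
      rw [testBit_codeMask] at hmem
      have := hPNW _ hmem
      have heq : tr (Pi.single j 1) (generatorFn (2 ^ i) f S) =
          generatorFn (2 ^ i) f (S ^^^ 2 ^ (j : ℕ)) := by
        rw [generatorFn, generatorFn, hlt hS, hlt hS', point_xor, point_two_pow]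
        ext x
        simp [tr, translateFn, LinearMap.funLeft_apply, add_assoc, add_comm (point 12 0 S)]
      rwa [heq]
    -- A code that is at least `width` stands for the constant function, which every translation
    -- fixes.
    · have heq : tr (Pi.single j 1) (generatorFn (2 ^ i) f S) = generatorFn (2 ^ i) f S := by
        have : Nat.ble width S = true := by rw [Nat.ble_eq]; omega
        rw [generatorFn, this]
        rfl
      rw [heq]
      exact hPW S hk
  have htr : ∀ a, W ≤ W.comap (tr a) := by
    -- The vectors whose translations preserve W form a submonoid; it contains the unit vectors,
    -- hence everything.
    let H : AddSubmonoid (Fin 12 → ZMod 2) :=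
      { carrier := {a | W ≤ W.comap (tr a)}
        zero_mem' := fun w hw => by
          have : tr 0 w = w := by ext x; simp [tr, LinearMap.funLeft_apply]
          rwa [Submodule.mem_comap, this]
        add_mem' := by
          intro a b ha hb w hw
          have : tr (a + b) w = tr a (tr b w) := by
            ext x; simp [tr, LinearMap.funLeft_apply, add_assoc]
          rw [Submodule.mem_comap, this]
          exact ha (hb hw) }
    intro a
    change a ∈ H
    rw [← Finset.univ_sum_single a]
    refine H.sum_mem fun j _ => ?_
    have : ∀ s : ZMod 2, s = 0 ∨ s = 1 := by decide
    rcases this (a j) with hs | hs <;> rw [hs]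
    · rw [Pi.single_zero]; exact H.zero_mem
    · exact hsingle j
  refine factorsThrough_of_span G (fun a => ?_) ?_
  -- The untranslated function has code 0, so its translate by `a` is an arbitrary generator.
  · have h0 := htr a (hPNW 0 h3)
    have heq : tr a (generatorFn (2 ^ i) f 0) = (2 : ZMod 8) ^ i • translateFn f a := by
      rw [generatorFn, hlt width_pos, point_zero]
      ext x
      simp [tr, translateFn, LinearMap.funLeft_apply]
    rwa [Submodule.mem_comap, heq] at h0
  · have := hPNW width h4
    rwa [generatorFn, show Nat.ble width width = true by rw [Nat.ble_eq]] at this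

theorem le_of_lowerCheck_cubicOf {L : List (Fin 12 × Fin 12 × Fin 12)} (i : ℕ)
    (R : List (ℕ × List ℕ × List ℕ)) {m : ℕ} (hi : i ≤ 2)
    (h : lowerCheck (cubicTable 12 0 L) i R m = true) {k : ℕ}
    (hk : (((2 : ZMod 8) ^ i) • devMod (cubicOf L)).FactorsThrough k) : m ≤ k :=
  le_of_lowerCheck (isTable_cubicTable (N := 12) (o := 0) le_rfl L) hi h hk

theorem factorsThrough_cubicOf {L : List (Fin 12 × Fin 12 × Fin 12)} (i : ℕ)
    (R : List (ℕ × List ℕ × List ℕ)) (B : List (List ℕ)) {m : ℕ} (hi : i ≤ 2)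
    (h : upperCheck (cubicTable 12 0 L) i R B m = true) :
    (((2 : ZMod 8) ^ i) • devMod (cubicOf L)).FactorsThrough (m + 1) :=
  factorsThrough_of_upperCheck (isTable_cubicTable (N := 12) (o := 0) le_rfl L) hi h

end BitTable

/-! ### Homogeneity and bentness of sums of cubic monomials -/

/-- The coefficient of a monomial is its number of occurrences modulo 2, so the list need not be
free of repetitions; strictly increasing triples are needed for degree 3. -/
theorem isHomogeneousFn_cubicOf {n : ℕ} {L : List (Fin n × Fin n × Fin n)}
    (h : ∀ t ∈ L, t.1 < t.2.1 ∧ t.2.1 < t.2.2) : IsHomogeneousFn 3 (cubicOf L) := by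
  let s : Fin n × Fin n × Fin n → Finset (Fin n) := fun t => {t.1, t.2.1, t.2.2}
  refine ⟨fun S => (L.map fun t => if S = s t then 1 else 0).sum, fun x => ?_, fun S hS => ?_⟩
  · induction L with
    | nil => simp [cubicOf]
    | cons t L ih =>
      obtain ⟨h1, h2⟩ := h t List.mem_cons_self
      have hL : cubicOf (t :: L) x = x t.1 * x t.2.1 * x t.2.2 + cubicOf L x := by simp [cubicOf]
      rw [hL, ih fun u hu => h u (List.mem_cons_of_mem _ hu)]
      simp only [List.map_cons, List.sum_cons, add_mul, Finset.sum_add_distrib, ite_mul, one_mul,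
        zero_mul, Finset.sum_ite_eq', Finset.mem_univ, if_true]
      congr 1
      rw [Finset.prod_insert, Finset.prod_insert, Finset.prod_singleton, mul_assoc]
      · simpa using h2.ne
      · simpa using ⟨h1.ne, (h1.trans h2).ne⟩
  · obtain ⟨t, ht, hSt⟩ : ∃ t ∈ L, S = s t := by
      by_contra! hcon
      refine hS (List.sum_eq_zero fun a ha => ?_)
      obtain ⟨t, ht, rfl⟩ := List.mem_map.1 ha
      exact if_neg (hcon t ht)
    obtain ⟨h1, h2⟩ := h t ht
    rw [hSt]
    exact Finset.card_eq_three.2 ⟨_, _, _, h1.ne, (h1.trans h2).ne, h2.ne, rfl⟩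

namespace BitTable

/-- The functions with the tables `T` and `g` differ at `2048` points, and likewise for all
translates of `g` by points with `i` digits, except `0` if `z` is set. -/
noncomputable def bentCheckAux (T i : ℕ) : Bool → ℕ → Bool :=
  Nat.rec (fun z g => z ||
      Nat.beq (Nat.mod (Nat.land (Nat.xor g T) (repunit 16 width)) 65535) 2048)
    (fun i ih z g => ih z g && ih false (flip 16 (Nat.add i 4) g)) i

/-- With offset 4 each value is repeated 16 times, so the positions divisible by 16 list every value
once, as digits in base 2^16. Modulo 2^16 - 1 the number equals its digit sum, and this is at most
4096. -/
theorem card_filter_eq_one {f : BoolFn 12} {T : ℕ} (hT : IsTable 16 4 T f) :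
    (Nat.land T (repunit 16 width)) % 65535 = (Finset.univ.filter fun x => f x = 1).card := by
  have h := and_repunit_mod (w := 16) (by norm_num) (n := width) (by rw [width_eq]; norm_num) T
  refine h.trans ?_
  rw [Finset.card_filter]
  refine Finset.sum_nbij' (point 12 0) code (fun _ _ => Finset.mem_univ _)
    (fun x _ => Finset.mem_range.2 (code_lt x)) (fun j hj => code_point (Finset.mem_range.1 hj))
    (fun x _ => point_code x) (fun j hj => ?_)
  have hj : j < 2 ^ 12 := Finset.mem_range.1 hj
  have h16 : 16 * j = j <<< 4 := by rw [Nat.shiftLeft_eq]; ring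
  have := hT (16 * j) (by omega)
  rw [h16, point_shiftLeft] at this
  rw [h16, ← this]
  cases (T.testBit (j <<< 4)) <;> simp [bitZ]

/-- The recursion is a binary tree over the digits of the direction, each branch flipping one digit
of the current translate. The flag `z` follows the branch without flips, which ends at the excluded
direction 0. -/
theorem bentCheckAux_spec {f g : BoolFn 12} {T U : ℕ} (hT : IsTable 16 4 T f)
    (hU : IsTable 16 4 U g) {i : ℕ} (hi : i ≤ 12) {z : Bool} (h : bentCheckAux T i z U = true)
    {m : ℕ} (hm : m < 2 ^ i) (hz : z = true → m ≠ 0) :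
    (Finset.univ.filter fun x => g (x + point 12 0 m) + f x = 1).card = 2048 := by
  induction i generalizing g U z m with
  | zero =>
    obtain rfl : m = 0 := by simpa using hm
    have hz : z = false := by simpa using hz
    have h' : (z || Nat.beq (Nat.mod (Nat.land (Nat.xor U T) (repunit 16 width)) 65535) 2048) = true
      := h
    rw [hz, Bool.false_or, Nat.beq_eq] at h'
    have := card_filter_eq_one (hU.xor hT)
    simpa using this.symm.trans h'
  | succ i ih =>
    have h' : (bentCheckAux T i z U && bentCheckAux T i false (flip 16 (i + 4) U)) = true := h
    rw [Bool.and_eq_true] at h'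
    cases hb : m.testBit i
    · refine ih hU (by omega) h'.1 ?_ hz
      rw [Nat.testBit_eq_decide_div_mod_eq, decide_eq_false_iff_not] at hb
      have : m / 2 ^ i < 2 := Nat.div_lt_of_lt_mul (by rwa [← pow_succ])
      have h0 : ∀ k, k < 2 → ¬ k % 2 = 1 → k = 0 := by omega
      exact Nat.lt_of_div_eq_zero (by positivity) (h0 _ this hb)
    · have h1 := Nat.xor_two_pow_of_testBit_true hb
      -- The flip accounts for the digit `i` of the direction, so the remaining direction is `m`
      -- without that digit.
      have := ih (hU.flip (i := i) (by omega)) (by omega) h'.2 (m := m ^^^ 2 ^ i)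
        (by rw [pow_succ] at hm; omega) (by simp)
      rw [← this]
      congr! 4 with x
      rw [add_assoc, ← point_xor, Nat.xor_assoc, Nat.xor_self, Nat.xor_zero]

theorem isBent_of_bentCheckAux {f : BoolFn 12} {T : ℕ} (hT : IsTable 16 4 T f)
    (h : bentCheckAux T 12 true T = true) : IsBent f := by
  have h1 : ∀ a, a ≠ 0 → (Finset.univ.filter fun x => derivFn a f x = 1).card = 2048 := by
    intro a ha
    have := bentCheckAux_spec hT hT le_rfl h (code_lt a) fun _ h0 => ha <| by
      rw [← point_code a, h0, point_zero]
    rw [point_code] at this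
    exact this
  intro a ha b
  have hb : b = 1 ∨ b = 0 := by revert b; decide
  rcases hb with rfl | rfl
  · exact h1 a ha
  -- The value 0 is taken at the remaining 4096 - 2048 points.
  · have h2 := Finset.card_filter_add_card_filter_not (s := Finset.univ)
      fun x => derivFn a f x = 1
    rw [h1 a ha] at h2
    have h3 : ∀ s : ZMod 2, ¬ s = 1 ↔ s = 0 := by decide
    simp only [h3] at h2
    have h4 : (Finset.univ : Finset (Fin 12 → ZMod 2)).card = 4096 := by simp
    omega

theorem isBent_cubicOf {L : List (Fin 12 × Fin 12 × Fin 12)}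
    (h : bentCheckAux (cubicTable 16 4 L) 12 true (cubicTable 16 4 L) = true) :
    IsBent (cubicOf L) :=
  isBent_of_bentCheckAux (isTable_cubicTable (N := 16) (o := 4) le_rfl L) h

end BitTable

/-! ### Third derivatives -/

theorem derivFn_comm {n : ℕ} (a b : Fin n → ZMod 2) (f : BoolFn n) :
    derivFn a (derivFn b f) = derivFn b (derivFn a f) := by
  ext x
  simp only [derivFn, add_right_comm x a b]
  ring

/-- The third derivatives of `f` in direction `a` vanish. -/
def IsFlat {n : ℕ} (f : BoolFn n) (a : Fin n → ZMod 2) : Prop :=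
  ∀ b c x, derivFn c (derivFn b (derivFn a f)) x = 0

/-- In the coordinates of `T` the derivative of ⟨x, y⟩ + φ(y) in direction (u, 0) is ⟨u, y⟩. It is
linear, so its second derivatives vanish, and there are 2^m such directions. -/
theorem IsPrimary.exists_injective {m : ℕ} {h : BoolFn (2 * m)} (hp : IsPrimary m h) :
    ∃ a : (Fin m → ZMod 2) → (Fin (2 * m) → ZMod 2), Function.Injective a ∧ ∀ u, IsFlat h (a u) := by
  obtain ⟨-, -, φ, -, -, T, hT⟩ := hp
  refine ⟨fun u => T.symm (u, 0), fun u v huv => ?_, fun u b c x => ?_⟩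
  · simpa using huv
  · have hu : derivFn (T.symm (u, 0)) h = fun x => u ⬝ᵥ (T x).2 := by
      ext x
      simp only [derivFn, hT, mmFn, map_add, LinearEquiv.apply_symm_apply, Prod.fst_add,
        Prod.snd_add, add_zero, id, add_dotProduct]
      rw [add_add_add_comm, CharTwo.add_self_eq_zero, add_zero, add_comm (_ ⬝ᵥ _), add_assoc,
        CharTwo.add_self_eq_zero, add_zero]
    rw [hu]
    simp only [derivFn, map_add, Prod.snd_add, dotProduct_add]
    generalize u ⬝ᵥ (T x).2 = s
    generalize u ⬝ᵥ (T c).2 = t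
    generalize u ⬝ᵥ (T b).2 = r
    revert s t r
    decide

/-- Third derivatives do not see the affine summand, and the composition with `A` transports
directions by the linear part of `A`. -/
theorem EquivalentFn.exists_injective_isFlat {n : ℕ} {f h : BoolFn n} (he : EquivalentFn f h) :
    ∃ a : (Fin n → ZMod 2) → (Fin n → ZMod 2), Function.Injective a ∧
      ∀ u, IsFlat h u → IsFlat f (a u) := by
  obtain ⟨A, l, ⟨v, w, hl⟩, hf⟩ := he
  refine ⟨A.linear, A.linear.injective, fun u hu b c x => ?_⟩
  have hA : ∀ x y, A (x + y) = A x + A.linear y := by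
    intro x y
    have := A.toAffineMap.map_vadd x y
    simp only [vadd_eq_add, AffineEquiv.coe_toAffineMap] at this
    rw [add_comm x, this, add_comm]
    rfl
  have := hu (A.linear.symm b) (A.linear.symm c) (A.symm x)
  simp only [derivFn, hf, hA, hl, dotProduct_add, AffineEquiv.apply_symm_apply,
    LinearEquiv.apply_symm_apply] at this ⊢
  rw [← this]
  generalize v ⬝ᵥ A.symm x = s
  generalize v ⬝ᵥ u = t
  generalize v ⬝ᵥ A.linear.symm b = r
  generalize v ⬝ᵥ A.linear.symm c = q
  generalize f (x + c + b + A.linear u) = z₁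
  generalize f (x + c + b) = z₂
  generalize f (x + c + A.linear u) = z₃
  generalize f (x + c) = z₄
  generalize f (x + b + A.linear u) = z₅
  generalize f (x + b) = z₆
  generalize f (x + A.linear u) = z₇
  generalize f x = z₈
  have h2 : ∀ z : ZMod 2, z + z = 0 := by decide
  -- The eight values of `l` in the third derivative contribute 8s + 4(t + r + q) + 8w, twice the
  -- argument given to `h2`.
  linear_combination -h2 (4 * s + 2 * q + 2 * r + 2 * t + 4 * w)

namespace BitTable

/-- The points at which the function with the table `T` has its value at `0`. -/
noncomputable def level (T : ℕ) : ℕ := Bool.rec (Nat.xor ones T) T (bitSet T 0)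

/-- The table of the derivative in the direction of the unit vector `i`. -/
def derivTable (i T : ℕ) : ℕ := Nat.xor (flip 12 i T) T

/-- The points `a` such that the first `m` mixed third derivatives in the direction `a` and the
directions of two unit vectors vanish at `0`. -/
noncomputable def flatSet (T m : ℕ) : ℕ :=
  Nat.rec ones (fun m S =>
    Nat.land S (level (derivTable (Nat.div m 12) (derivTable (Nat.mod m 12) T)))) m

theorem IsTable.derivTable {T : ℕ} {f : BoolFn 12} (h : IsTable 12 0 T f) {i : ℕ} (hi : i < 12) :
    IsTable 12 0 (derivTable i T) (derivFn (point 12 0 (2 ^ i)) f) :=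
  (h.flip (i := i) hi).xor h

theorem testBit_level {T : ℕ} {f : BoolFn 12} (h : IsTable 12 0 T f) {a : Fin 12 → ZMod 2}
    (ha : f a = f 0) : (level T).testBit (code a) = true := by
  have h0 := h 0 (by norm_num)
  rw [point_zero, ← ha, ← h.apply] at h0
  have : code a < width := code_lt a
  rw [level, bitSet_eq]
  revert h0
  cases T.testBit 0 <;> cases hb : T.testBit (code a) <;>
    simp [bitZ, hb, ones_eq, Nat.testBit_two_pow_sub_one, this]

/-- Only pairs of unit directions and only the origin are tested, so `flatSet` may contain further
points; an upper bound for the flat directions is all that is needed. The number 144 is that of the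
ordered pairs of unit vectors. -/
theorem testBit_flatSet {T : ℕ} {f : BoolFn 12} (h : IsTable 12 0 T f) {a : Fin 12 → ZMod 2}
    (ha : IsFlat f a) {m : ℕ} (hm : m ≤ 144) : (flatSet T m).testBit (code a) = true := by
  induction m with
  | zero =>
    have h1 : flatSet T 0 = ones := rfl
    have : code a < width := code_lt a
    simp [h1, ones_eq, Nat.testBit_two_pow_sub_one, this]
  | succ m ih =>
    have h1 : flatSet T (m + 1) =
      flatSet T m &&& level (derivTable (m / 12) (derivTable (m % 12) T)) := rfl
    rw [h1, Nat.testBit_and, ih (by omega), Bool.true_and]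
    refine testBit_level ((h.derivTable (i := m % 12) (by omega)).derivTable (by omega)) ?_
    -- Moving the derivative in direction `a` to the outside turns its vanishing at 0 into equality
    -- of the values of a mixed second derivative at `a` and at 0.
    have := ha (point 12 0 (2 ^ (m % 12))) (point 12 0 (2 ^ (m / 12))) 0
    rw [derivFn_comm _ a, derivFn_comm _ a, derivFn, zero_add] at this
    exact CharTwo.add_eq_zero.1 this

/-- An equivalence would inject the 2^6 flat directions of a primary function into a list of fewer
than 64 codes. -/
theorem not_equivalentFn_of_isPrimary {f h : BoolFn 12} {T : ℕ} (hT : IsTable 12 0 T f)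
    {l : List ℕ} (hl : Nat.beq (flatSet T 144) (codeMask l) = true) (hlen : l.length < 64)
    (hp : IsPrimary 6 h) : ¬ EquivalentFn f h := by
  intro he
  obtain ⟨a, ha, haf⟩ := hp.exists_injective
  obtain ⟨b, hb, hbf⟩ := he.exists_injective_isFlat
  rw [Nat.beq_eq] at hl
  have hmem : ∀ u, code (b (a u)) ∈ l.toFinset := fun u => by
    rw [List.mem_toFinset, ← testBit_codeMask, ← hl]
    exact testBit_flatSet hT (hbf _ (haf u)) le_rfl
  have hcard := Finset.card_le_card_of_injOn (s := Finset.univ) (fun u => code (b (a u)))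
    (fun u _ => hmem u) fun u _ v _ huv => ha <| hb <| by
      rw [← point_code (b (a u)), ← point_code (b (a v)), show code (b (a u)) = _ from huv]
  have h64 : (Finset.univ : Finset (Fin 6 → ZMod 2)).card = 64 := by simp
  have := l.toFinset_card_le
  omega

theorem not_equivalentFn_cubicOf_of_isPrimary {L : List (Fin 12 × Fin 12 × Fin 12)} (l : List ℕ)
    (hl : Nat.beq (flatSet (cubicTable 12 0 L) 144) (codeMask l) = true) (hlen : l.length < 64)
    (h : BoolFn 12) (hp : IsPrimary 6 h) : ¬ EquivalentFn (cubicOf L) h :=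
  not_equivalentFn_of_isPrimary (isTable_cubicTable (N := 12) (o := 0) le_rfl L) hl hlen hp

end BitTable

/-! ### The modification algorithm -/

theorem derivFn_add_left {n : ℕ} (a b : Fin n → ZMod 2) (f : BoolFn n) (x : Fin n → ZMod 2) :
    derivFn (a + b) f x = derivFn a f (x + b) + derivFn b f x := by
  have h2 : f (x + b) + f (x + b) = 0 := CharTwo.add_self_eq_zero _
  simp only [derivFn, add_assoc, add_comm b a]
  linear_combination -h2

theorem derivFn_zero_left {n : ℕ} (f : BoolFn n) (x : Fin n → ZMod 2) : derivFn 0 f x = 0 := by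
  rw [derivFn, add_zero, CharTwo.add_self_eq_zero]

/-- A property of directions that is closed under addition holds on a span if it holds on the
generators. -/
theorem forall_mem_span_zmod_two {E : Type*} [AddCommGroup E] [Module (ZMod 2) E] {s : Set E}
    {P : E → Prop} (hs : ∀ a ∈ s, P a) (h0 : P 0) (hadd : ∀ a b, P a → P b → P (a + b)) :
    ∀ a ∈ Submodule.span (ZMod 2) s, P a := by
  intro a ha
  induction ha using Submodule.span_induction with
  | mem a ha => exact hs a ha
  | zero => exact h0
  | add a b _ _ ha hb => exact hadd a b ha hb
  | smul c a _ ha =>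
    have : c = 0 ∨ c = 1 := by revert c; decide
    rcases this with rfl | rfl
    · rwa [zero_smul]
    · rwa [one_smul]

/-- When the second derivatives vanish, the derivative is additive in its direction; the condition
therefore extends from generators to the span in each direction separately. -/
theorem isMSubspace_span {n : ℕ} {f : BoolFn n} {s : Set (Fin n → ZMod 2)}
    (hs : ∀ a ∈ s, ∀ b ∈ s, ∀ x, derivFn b (derivFn a f) x = 0) :
    IsMSubspace f (Submodule.span (ZMod 2) s) := by
  refine forall_mem_span_zmod_two (fun a ha => ?_) ?_ ?_
  · refine forall_mem_span_zmod_two (hs a ha) (fun x => derivFn_zero_left _ x) ?_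
    intro b c hb hc x
    rw [derivFn_add_left, hb, hc, add_zero]
  · intro b _ x
    rw [derivFn_comm, derivFn_zero_left]
  · intro a c ha hc b hb x
    rw [derivFn_comm, derivFn_add_left, derivFn_comm, ha b hb, derivFn_comm, hc b hb, add_zero]

theorem eq_dotProduct_of_map_add {m : ℕ} (g : (Fin m → ZMod 2) → ZMod 2)
    (hg : ∀ x y, g (x + y) = g x + g y) (x : Fin m → ZMod 2) :
    g x = x ⬝ᵥ fun i => g (Pi.single i 1) := by
  let G : (Fin m → ZMod 2) →ₗ[ZMod 2] ZMod 2 := (AddMonoidHom.mk' g hg).toZModLinearMap 2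
  have := G.pi_apply_eq_sum_univ x
  have h1 : ∀ i : Fin m, (fun j => if i = j then (1 : ZMod 2) else 0) = Pi.single i 1 := fun i => by
    ext j; rw [Pi.single_apply]; simp only [eq_comm]
  simp only [h1] at this
  exact this

/-- On the span of the rows of `B` the second derivatives of `f` vanish, so in adapted coordinates
`f` is affine in x with slope π(y) given by its derivatives. As `g` has the same derivatives along
the rows, it has the same slope, and f + g depends on y only. -/
theorem mem_newFromOld {r s n : ℕ} (hn : r + s = n) {d : ℕ} {f g : BoolFn n}
    (hg : IsHomogeneousFn d g) (hg' : IsBent g) {B : Matrix (Fin r) (Fin n) (ZMod 2)}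
    {p : Fin r → Fin n} {q : Fin s → Fin n} (hB : IsGaussJordan B p) (hq : StrictMono q)
    (hqp : Set.range q = (Set.range p)ᶜ)
    (hf : ∀ i j x, derivFn (B j) (derivFn (B i) f) x = 0)
    (hfg : ∀ i x, derivFn (B i) f x = derivFn (B i) g x) : g ∈ newFromOld r s d f := by
  obtain ⟨hp, hBp, -⟩ := id hB
  let A₀ : ((Fin r → ZMod 2) × (Fin s → ZMod 2)) →ₗ[ZMod 2] (Fin n → ZMod 2) :=
    LinearMap.coprod B.vecMulLinear
      (∑ j, (LinearMap.proj j).smulRight (Pi.single (q j) 1 : Fin n → ZMod 2))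
  have hA₀ : ∀ x y, A₀ (x, y) = x ᵥ* B + ∑ j, y j • (Pi.single (q j) 1 : Fin n → ZMod 2) := by
    intro x y
    simp [A₀, LinearMap.coprod_apply, LinearMap.sum_apply]
  have hne : ∀ i j, p i ≠ q j := by
    intro i j hij
    have : q j ∈ (Set.range p)ᶜ := hqp ▸ Set.mem_range_self j
    exact this ⟨i, hij⟩
  have hinj : Function.Injective A₀ := by
    rw [injective_iff_map_eq_zero]
    rintro ⟨x, y⟩ hxy
    rw [hA₀] at hxy
    have hx : x = 0 := by
      ext i
      have := congrFun hxy (p i)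
      simpa [Matrix.vecMul, dotProduct, hBp, Finset.sum_apply, hne] using this
    have hy : y = 0 := by
      ext j
      have := congrFun hxy (q j)
      simpa [hx, Finset.sum_apply, Pi.single_apply, hq.injective.eq_iff] using this
    rw [hx, hy]; rfl
  let A : ((Fin r → ZMod 2) × (Fin s → ZMod 2)) ≃ₗ[ZMod 2] (Fin n → ZMod 2) :=
    LinearEquiv.ofBijective A₀ <| by
      rw [Fintype.bijective_iff_injective_and_card]
      exact ⟨hinj, by simp [← hn, pow_add]⟩
  have hA : ∀ x y, A (x, y) = x ᵥ* B + ∑ j, y j • (Pi.single (q j) 1 : Fin n → ZMod 2) := hA₀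
  have hA' : ∀ x y, A (x, y) = A (0, y) + x ᵥ* B := by
    intro x y
    rw [hA, hA 0, Matrix.zero_vecMul, zero_add, add_comm]
  have hlin : LinearIndependent (ZMod 2) B := by
    refine (Fintype.linearIndependent_iff (v := fun i => B i)).2 fun c hc i => ?_
    have := congrFun hc (p i)
    simpa [Finset.sum_apply, hBp] using this
  have hmem : ∀ x, x ᵥ* B ∈ Submodule.span (ZMod 2) (Set.range B) := by
    intro x
    refine (Submodule.mem_span_range_iff_exists_fun (v := fun i => B i) _).2 ⟨x, ?_⟩
    ext j; simp [Matrix.vecMul, dotProduct, Finset.sum_apply]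
  have hM : IsMSubspace f (Submodule.span (ZMod 2) (Set.range B)) := by
    refine isMSubspace_span ?_
    rintro _ ⟨i, rfl⟩ _ ⟨j, rfl⟩
    exact hf i j
  have hfg' : ∀ a ∈ Submodule.span (ZMod 2) (Set.range B), ∀ x, derivFn a f x = derivFn a g x := by
    refine forall_mem_span_zmod_two ?_ (fun x => ?_) fun a b ha hb x => ?_
    · rintro _ ⟨i, rfl⟩
      exact hfg i
    · rw [derivFn_zero_left, derivFn_zero_left]
    · rw [derivFn_add_left, derivFn_add_left, ha, hb]
  let π : (Fin s → ZMod 2) → (Fin r → ZMod 2) := fun y i =>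
    derivFn (Pi.single i 1 ᵥ* B) f (A (0, y))
  -- The derivative in direction `x ᵥ* B` does not change under shifts by `z ᵥ* B`; this makes it
  -- additive, hence linear, in x.
  have hπ : ∀ x y, derivFn (x ᵥ* B) f (A (0, y)) = x ⬝ᵥ π y := by
    intro x y
    refine eq_dotProduct_of_map_add (fun x => derivFn (x ᵥ* B) f (A (0, y))) (fun x z => ?_) x
    have := hM _ (hmem x) _ (hmem z) (A (0, y))
    simp only [Matrix.add_vecMul, derivFn_add_left]
    rw [derivFn] at this
    rw [CharTwo.add_eq_zero.1 this]
  have hz : ∀ a b : ZMod 2, a = (a + b) + b := by decide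
  have hfA : ∀ w, f (A w) = mmFn π (fun y => f (A (0, y))) w := by
    rintro ⟨x, y⟩
    rw [mmFn, ← hπ, derivFn, ← hA']
    exact hz _ _
  -- Here ω(y) is the value of f + g at A(0, y); adding it to the values of f leaves those of g in
  -- characteristic two.
  have hgA : ∀ w, g (A w) =
      mmFn π ((fun y => f (A (0, y))) + fun y => f (A (0, y)) + g (A (0, y))) w := by
    rintro ⟨x, y⟩
    rw [mmFn, ← hπ, hfg' _ (hmem x), derivFn, ← hA', Pi.add_apply]
    generalize g (A (x, y)) = a
    generalize g (A (0, y)) = b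
    generalize f (A (0, y)) = c
    revert a b c
    decide
  have hgz : (fun z => mmFn π ((fun y => f (A (0, y))) + fun y => f (A (0, y)) + g (A (0, y)))
      (A.symm z)) = g := by
    ext z
    rw [← hgA, LinearEquiv.apply_symm_apply]
  refine ⟨Submodule.span (ZMod 2) (Set.range B), ?_, hM, A, ⟨B, p, q, hB, rfl, hq, hqp, hA⟩, π,
    fun y => f (A (0, y)), hfA, fun y => f (A (0, y)) + g (A (0, y)), ⟨?_, ?_⟩,
    fun z => (congrFun hgz z).symm⟩
  · rw [finrank_span_eq_card hlin, Fintype.card_fin]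
  · rwa [hgz]
  · rwa [hgz]

namespace BitTable

/-- The table of the derivative in the direction of the point with the code `S`. -/
noncomputable def directionalTable (T S : ℕ) : ℕ := Nat.xor (translate 12 0 T S 12) T

theorem IsTable.directionalTable {T : ℕ} {f : BoolFn 12} (h : IsTable 12 0 T f) (S : ℕ) :
    IsTable 12 0 (directionalTable T S) (derivFn (point 12 0 S) f) :=
  (h.translate' S).xor h

theorem IsTable.congr {T U : ℕ} {f g : BoolFn 12} (hf : IsTable 12 0 T f) (hg : IsTable 12 0 U g)
    (h : T = U) (x : Fin 12 → ZMod 2) : f x = g x := by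
  rw [← hf.apply, ← hg.apply, h]

theorem isTable_zero : IsTable 12 0 0 (0 : BoolFn 12) := by
  intro k _
  rw [Nat.zero_testBit]; rfl

/-- The derivatives in the directions with codes in `l` coincide for the functions with the tables
`T` and `U`, and have zero derivatives in these directions. -/
noncomputable def modificationCheck (T U : ℕ) (l : List ℕ) : Bool :=
  l.all fun S => Nat.beq (directionalTable T S) (directionalTable U S) &&
    l.all fun S' => Nat.beq (directionalTable (directionalTable T S) S') 0

theorem mem_newFromOld_of_modificationCheck {f g : BoolFn 12} {T U : ℕ} (hf : IsTable 12 0 T f)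
    (hg : IsTable 12 0 U g) {r s d : ℕ} (hn : r + s = 12) (hg3 : IsHomogeneousFn d g)
    (hgb : IsBent g) {B : Fin r → ℕ} {p : Fin r → Fin 12} {q : Fin s → Fin 12}
    (hB : IsGaussJordan (Matrix.of fun i => point 12 0 (B i)) p) (hq : StrictMono q)
    (hqp : Set.range q = (Set.range p)ᶜ)
    (h : modificationCheck T U (List.ofFn B) = true) : g ∈ newFromOld r s d f := by
  have hmem : ∀ i, B i ∈ List.ofFn B := fun i => List.mem_ofFn.2 ⟨i, rfl⟩
  simp only [modificationCheck, List.all_eq_true, Bool.and_eq_true, Nat.beq_eq] at h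
  refine mem_newFromOld hn hg3 hgb hB hq hqp (fun i j x => ?_) fun i x => ?_
  · exact ((hf.directionalTable (B i)).directionalTable (B j)).congr isTable_zero
      ((h _ (hmem i)).2 _ (hmem j)) x
  · exact (hf.directionalTable (B i)).congr (hg.directionalTable (B i)) (h _ (hmem i)).1 x

theorem cubicOf_mem_newFromOld {L M : List (Fin 12 × Fin 12 × Fin 12)} {r s d : ℕ}
    (hn : r + s = 12) (h3 : IsHomogeneousFn d (cubicOf M)) (hb : IsBent (cubicOf M))
    (B : Fin r → ℕ) (p : Fin r → Fin 12) (q : Fin s → Fin 12)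
    (hB : IsGaussJordan (Matrix.of fun i => point 12 0 (B i)) p) (hq : StrictMono q)
    (hqp : Set.range q = (Set.range p)ᶜ)
    (h : modificationCheck (cubicTable 12 0 L) (cubicTable 12 0 M) (List.ofFn B) = true) :
    cubicOf M ∈ newFromOld r s d (cubicOf L) :=
  mem_newFromOld_of_modificationCheck (isTable_cubicTable (N := 12) (o := 0) le_rfl L)
    (isTable_cubicTable (N := 12) (o := 0) le_rfl M) hn h3 hb hB hq hqp h

/-! ### The seven functions: homogeneity, bentness, flat directions and modification. -/

theorem isHomogeneousFn_cubicOf_of_all {n : ℕ} {L : List (Fin n × Fin n × Fin n)}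
    (h : (L.all fun t => Nat.blt t.1 t.2.1 && Nat.blt t.2.1 t.2.2) = true) :
    IsHomogeneousFn 3 (cubicOf L) := by
  refine isHomogeneousFn_cubicOf fun t ht => ?_
  have := List.all_eq_true.1 h t ht
  rwa [Bool.and_eq_true, Nat.blt_eq, Nat.blt_eq] at this

theorem isHomogeneousFn_h12 (i : Fin 7) : IsHomogeneousFn 3 (h12 i) := by
  fin_cases i <;> exact isHomogeneousFn_cubicOf_of_all (by decide +kernel)

set_option maxRecDepth 100000 in
theorem isBent_h12 (i : Fin 7) : IsBent (h12 i) := by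
  fin_cases i <;> exact isBent_cubicOf (by decide +kernel)

-- The lists are the codes of the directions that pass the test. There are at most four, with 4095
-- standing for the all-one vector.
set_option maxRecDepth 100000 in
theorem not_equivalentFn_h12_of_isPrimary (i : Fin 7) (h : BoolFn 12) (hp : IsPrimary 6 h) :
    ¬ EquivalentFn (h12 i) h := by
  fin_cases i
  · exact not_equivalentFn_cubicOf_of_isPrimary [0, 1366, 2729, 4095] (by decide +kernel)
      (by norm_num) h hp
  · exact not_equivalentFn_cubicOf_of_isPrimary [0, 1366, 2729, 4095] (by decide +kernel)
      (by norm_num) h hp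
  · exact not_equivalentFn_cubicOf_of_isPrimary [0, 4095] (by decide +kernel) (by norm_num) h hp
  · exact not_equivalentFn_cubicOf_of_isPrimary [0, 1365, 2730, 4095] (by decide +kernel)
      (by norm_num) h hp
  · exact not_equivalentFn_cubicOf_of_isPrimary [0] (by decide +kernel) (by norm_num) h hp
  · exact not_equivalentFn_cubicOf_of_isPrimary [0, 4095] (by decide +kernel) (by norm_num) h hp
  · exact not_equivalentFn_cubicOf_of_isPrimary [0, 4095] (by decide +kernel) (by norm_num) h hp

/-- The codes are those of e₀ + e₁ and of eᵢ + eᵢ₊₅ for 2 ≤ i ≤ 6. Their span is the M-subspace of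
h₃ that produces both h₆ and h₇. -/
theorem isGaussJordan_basis :
    IsGaussJordan (Matrix.of fun i => point 12 0 (![3, 132, 264, 528, 1056, 2112] i))
      ![0, 2, 3, 4, 5, 6] := by
  have h : ∀ (i : Fin 6) (k : Fin 12), k < (![0, 2, 3, 4, 5, 6] : Fin 6 → Fin 12) i →
      point 12 0 (![3, 132, 264, 528, 1056, 2112] i) k = 0 := by decide +kernel
  refine ⟨fun i j => ?_, ?_, h⟩
  · revert i j; decide
  · decide +kernel

theorem strictMono_complement : StrictMono (![1, 7, 8, 9, 10, 11] : Fin 6 → Fin 12) := by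
  intro i j; revert i j; decide

theorem range_complement : Set.range (![1, 7, 8, 9, 10, 11] : Fin 6 → Fin 12) =
    (Set.range (![0, 2, 3, 4, 5, 6] : Fin 6 → Fin 12))ᶜ := by
  ext k
  simp only [Set.mem_compl_iff, Set.mem_range]
  revert k
  decide

set_option maxRecDepth 100000 in
theorem h12_6_mem_newFromOld : h12_6 ∈ newFromOld 6 6 3 h12_3 :=
  cubicOf_mem_newFromOld (by norm_num) (isHomogeneousFn_h12 5) (isBent_h12 5) _ _ _
    isGaussJordan_basis strictMono_complement range_complement (by decide +kernel)

set_option maxRecDepth 100000 in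
theorem h12_7_mem_newFromOld : h12_7 ∈ newFromOld 6 6 3 h12_3 :=
  cubicOf_mem_newFromOld (by norm_num) (isHomogeneousFn_h12 6) (isBent_h12 6) _ _ _
    isGaussJordan_basis strictMono_complement range_complement (by decide +kernel)

/-! ### Certified bounds on the ranks modulo 2, 4 and 8. -/

-- Exponent 2 means multiplication by 4, so this concerns the 2-rank. A certificate consists of
-- blocks (level, codes of translates, pivots) for the generators, and of batches of further codes,
-- reached by changing a digit, that must reduce to zero. The code 4096 denotes the constant, and 23
-- is 22 generators plus `e₀`.
set_option maxRecDepth 100000 in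
set_option maxHeartbeats 0 in
theorem h12_1_factorsThrough2 :
    (((2 : ZMod 8) ^ 2) • devMod h12_1).FactorsThrough 23 :=
  factorsThrough_cubicOf 2
    [(2, [0, 1, 2, 4, 8, 16, 32, 64, 128, 256, 512, 5, 6, 9, 10, 12, 17, 18, 20, 34, 65, 14],
     [4094, 4095, 4083, 4085, 4089, 4090, 4078, 4077, 4086, 4061, 4030, 4079, 4087, 3967, 4091,
     4093, 4063, 4031, 4081, 3839, 3583, 4075])]
    [[3, 7, 11, 13, 15, 19, 21, 22, 24, 25, 26, 28, 30, 33, 35, 36, 37, 38, 40, 41, 42, 44, 46,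
     48, 49, 50, 52, 66, 67, 68, 69, 70], [72, 73, 74, 76, 78, 80, 81, 82, 84, 96, 97, 98, 129,
     130, 132, 133, 134, 136, 137, 138, 140, 142, 144, 145, 146, 148, 160, 162, 192, 193, 257,
     258], [260, 261, 262, 264, 265, 266, 268, 270, 272, 273, 274, 276, 288, 290, 320, 321, 384,
     513, 514, 516, 517, 518, 520, 521, 522, 524, 526, 528, 529, 530, 532, 544], [546, 576, 577,
     640, 768, 1024, 1025, 1026, 1028, 1029, 1030, 1032, 1033, 1034, 1036, 1038, 1040, 1041, 1042,
     1044, 1056, 1058, 1088, 1089, 1152, 1280, 1536, 2048, 2049, 2050, 2052, 2053], [2054, 2056,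
     2057, 2058, 2060, 2062, 2064, 2065, 2066, 2068, 2080, 2082, 2112, 2113, 2176, 2304, 2560,
     4096]] (m := 22)
    (by norm_num) (by decide +kernel)

set_option maxRecDepth 100000 in
set_option maxHeartbeats 0 in
theorem h12_2_factorsThrough2 :
    (((2 : ZMod 8) ^ 2) • devMod h12_2).FactorsThrough 23 :=
  factorsThrough_cubicOf 2
    [(2, [0, 1, 2, 4, 8, 16, 32, 64, 128, 256, 512, 5, 6, 9, 10, 12, 17, 18, 20, 33, 34, 14],
     [4094, 4095, 4083, 4085, 4089, 4090, 4086, 4077, 4062, 4078, 4061, 4079, 4087, 4063, 4091,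
     4093, 3839, 4031, 4081, 3967, 3583, 4075])]
    [[3, 7, 11, 13, 15, 19, 21, 22, 24, 25, 26, 28, 30, 35, 36, 37, 38, 40, 41, 42, 44, 46, 48,
     49, 50, 52, 65, 66, 68, 69, 70, 72], [73, 74, 76, 78, 80, 81, 82, 84, 96, 97, 98, 129, 130,
     132, 133, 134, 136, 137, 138, 140, 142, 144, 145, 146, 148, 160, 161, 162, 192, 257, 258,
     260], [261, 262, 264, 265, 266, 268, 270, 272, 273, 274, 276, 288, 289, 290, 320, 384, 513,
     514, 516, 517, 518, 520, 521, 522, 524, 526, 528, 529, 530, 532, 544, 545], [546, 576, 640,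
     768, 1024, 1025, 1026, 1028, 1029, 1030, 1032, 1033, 1034, 1036, 1038, 1040, 1041, 1042,
     1044, 1056, 1057, 1058, 1088, 1152, 1280, 1536, 2048, 2049, 2050, 2052, 2053, 2054], [2056,
     2057, 2058, 2060, 2062, 2064, 2065, 2066, 2068, 2080, 2081, 2082, 2112, 2176, 2304, 2560,
     4096]] (m := 22)
    (by norm_num) (by decide +kernel)

set_option maxRecDepth 100000 in
set_option maxHeartbeats 0 in
theorem h12_3_factorsThrough2 :
    (((2 : ZMod 8) ^ 2) • devMod h12_3).FactorsThrough 25 :=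
  factorsThrough_cubicOf 2
    [(2, [0, 1, 2, 4, 8, 16, 32, 64, 128, 256, 512, 1024, 5, 6, 9, 10, 12, 17, 18, 20, 24, 33, 34,
     13], [4094, 4095, 4083, 4086, 4090, 4089, 4085, 4078, 4061, 4077, 4075, 4062, 4087, 4079,
     4091, 4063, 4093, 4031, 3839, 4082, 3583, 3071, 3967, 4071])]
    [[3, 7, 11, 14, 15, 19, 21, 22, 25, 26, 28, 29, 35, 36, 37, 38, 40, 41, 42, 44, 45, 48, 49,
     50, 52, 56, 65, 66, 68, 69, 70, 72], [73, 74, 76, 77, 80, 81, 82, 84, 88, 96, 97, 98, 129,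
     130, 132, 133, 134, 136, 137, 138, 140, 141, 144, 145, 146, 148, 152, 160, 161, 162, 192,
     257], [258, 260, 261, 262, 264, 265, 266, 268, 269, 272, 273, 274, 276, 280, 288, 289, 290,
     320, 384, 513, 514, 516, 517, 518, 520, 521, 522, 524, 525, 528, 529, 530], [532, 536, 544,
     545, 546, 576, 640, 768, 1025, 1026, 1028, 1029, 1030, 1032, 1033, 1034, 1036, 1037, 1040,
     1041, 1042, 1044, 1048, 1056, 1057, 1058, 1088, 1152, 1280, 1536, 2048, 2049], [2050, 2052,
     2053, 2054, 2056, 2057, 2058, 2060, 2061, 2064, 2065, 2066, 2068, 2072, 2080, 2081, 2082,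
     2112, 2176, 2304, 2560, 3072, 4096]] (m := 24)
    (by norm_num) (by decide +kernel)

set_option maxRecDepth 100000 in
set_option maxHeartbeats 0 in
theorem h12_4_factorsThrough2 :
    (((2 : ZMod 8) ^ 2) • devMod h12_4).FactorsThrough 23 :=
  factorsThrough_cubicOf 2
    [(2, [0, 1, 2, 4, 8, 16, 32, 64, 128, 256, 512, 5, 6, 9, 10, 12, 17, 18, 24, 33, 34, 13],
     [4094, 4095, 4083, 4086, 4090, 4085, 4089, 4077, 4062, 4078, 4061, 4087, 4063, 4091, 4079,
     4093, 3839, 4031, 4082, 3967, 3583, 4071])]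
    [[3, 7, 11, 14, 15, 19, 20, 21, 22, 25, 26, 28, 29, 35, 36, 37, 38, 40, 41, 42, 44, 45, 48,
     49, 50, 56, 65, 66, 68, 69, 70, 72], [73, 74, 76, 77, 80, 81, 82, 88, 96, 97, 98, 129, 130,
     132, 133, 134, 136, 137, 138, 140, 141, 144, 145, 146, 152, 160, 161, 162, 192, 257, 258,
     260], [261, 262, 264, 265, 266, 268, 269, 272, 273, 274, 280, 288, 289, 290, 320, 384, 513,
     514, 516, 517, 518, 520, 521, 522, 524, 525, 528, 529, 530, 536, 544, 545], [546, 576, 640,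
     768, 1024, 1025, 1026, 1028, 1029, 1030, 1032, 1033, 1034, 1036, 1037, 1040, 1041, 1042,
     1048, 1056, 1057, 1058, 1088, 1152, 1280, 1536, 2048, 2049, 2050, 2052, 2053, 2054], [2056,
     2057, 2058, 2060, 2061, 2064, 2065, 2066, 2072, 2080, 2081, 2082, 2112, 2176, 2304, 2560,
     4096]] (m := 22)
    (by norm_num) (by decide +kernel)

set_option maxRecDepth 100000 in
set_option maxHeartbeats 0 in
theorem h12_6_factorsThrough2 :
    (((2 : ZMod 8) ^ 2) • devMod h12_6).FactorsThrough 25 :=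
  factorsThrough_cubicOf 2
    [(2, [0, 1, 2, 4, 8, 16, 32, 64, 128, 256, 512, 1024, 5, 6, 9, 10, 12, 17, 18, 33, 34, 48,
     132, 14], [4094, 4095, 4083, 4085, 4089, 4061, 4077, 4047, 4090, 4086, 4078, 4062, 3967,
     4087, 3839, 4091, 4093, 3583, 4063, 3071, 4079, 4031, 4081, 3963])]
    [[3, 7, 11, 13, 15, 19, 20, 21, 22, 24, 25, 26, 28, 30, 35, 36, 37, 38, 40, 41, 42, 44, 46,
     49, 50, 52, 56, 65, 66, 68, 69, 70], [72, 73, 74, 76, 78, 80, 81, 82, 96, 97, 98, 112, 129,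
     130, 133, 134, 136, 137, 138, 140, 142, 144, 145, 146, 148, 160, 161, 162, 164, 176, 192,
     196], [257, 258, 260, 261, 262, 264, 265, 266, 268, 270, 272, 273, 274, 288, 289, 290, 304,
     320, 384, 388, 513, 514, 516, 517, 518, 520, 521, 522, 524, 526, 528, 529], [530, 544, 545,
     546, 560, 576, 640, 644, 768, 1025, 1026, 1028, 1029, 1030, 1032, 1033, 1034, 1036, 1038,
     1040, 1041, 1042, 1056, 1057, 1058, 1072, 1088, 1152, 1156, 1280, 1536, 2048], [2049, 2050,
     2052, 2053, 2054, 2056, 2057, 2058, 2060, 2062, 2064, 2065, 2066, 2080, 2081, 2082, 2096,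
     2112, 2176, 2180, 2304, 2560, 3072, 4096]] (m := 24)
    (by norm_num) (by decide +kernel)

set_option maxRecDepth 100000 in
set_option maxHeartbeats 0 in
theorem h12_7_factorsThrough2 :
    (((2 : ZMod 8) ^ 2) • devMod h12_7).FactorsThrough 25 :=
  factorsThrough_cubicOf 2
    [(2, [0, 1, 2, 4, 8, 16, 32, 64, 128, 256, 512, 1024, 5, 6, 9, 10, 12, 17, 18, 33, 34, 40,
     132, 14], [4094, 4095, 4083, 4085, 4089, 4061, 4077, 4055, 4090, 4086, 4078, 4062, 3967,
     4087, 3839, 4091, 4093, 3583, 4063, 3071, 4079, 4031, 4081, 3963])]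
    [[3, 7, 11, 13, 15, 19, 20, 21, 22, 24, 25, 26, 28, 30, 35, 36, 37, 38, 41, 42, 44, 46, 48,
     49, 50, 56, 65, 66, 68, 69, 70, 72], [73, 74, 76, 78, 80, 81, 82, 96, 97, 98, 104, 129, 130,
     133, 134, 136, 137, 138, 140, 142, 144, 145, 146, 148, 160, 161, 162, 164, 168, 192, 196,
     257], [258, 260, 261, 262, 264, 265, 266, 268, 270, 272, 273, 274, 288, 289, 290, 296, 320,
     384, 388, 513, 514, 516, 517, 518, 520, 521, 522, 524, 526, 528, 529, 530], [544, 545, 546,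
     552, 576, 640, 644, 768, 1025, 1026, 1028, 1029, 1030, 1032, 1033, 1034, 1036, 1038, 1040,
     1041, 1042, 1056, 1057, 1058, 1064, 1088, 1152, 1156, 1280, 1536, 2048, 2049], [2050, 2052,
     2053, 2054, 2056, 2057, 2058, 2060, 2062, 2064, 2065, 2066, 2080, 2081, 2082, 2088, 2112,
     2176, 2180, 2304, 2560, 3072, 4096]] (m := 24)
    (by norm_num) (by decide +kernel)

-- The lower bound 24 exceeds the upper bound 23 for h₁, h₂ and h₄.
set_option maxRecDepth 100000 in
set_option maxHeartbeats 0 in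
theorem h12_3_le2 {k : ℕ}
    (h : (((2 : ZMod 8) ^ 2) • devMod h12_3).FactorsThrough k) : 24 ≤ k :=
  le_of_lowerCheck_cubicOf 2
    [(2, [0, 1, 2, 4, 8, 16, 32, 64, 128, 256, 512, 1024, 5, 6, 9, 10, 12, 17, 18, 20, 24, 33, 34,
     13], [4094, 4095, 4083, 4086, 4090, 4089, 4085, 4078, 4061, 4077, 4075, 4062, 4087, 4079,
     4091, 4063, 4093, 4031, 3839, 4082, 3583, 3071, 3967, 4071])]
    (by norm_num) (by decide +kernel) h

-- The 2-rank of h₅ exceeds the upper bounds 23 and 25 of all the other functions.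
set_option maxRecDepth 100000 in
set_option maxHeartbeats 0 in
theorem h12_5_le2 {k : ℕ}
    (h : (((2 : ZMod 8) ^ 2) • devMod h12_5).FactorsThrough k) : 26 ≤ k :=
  le_of_lowerCheck_cubicOf 2
    [(2, [0, 1, 2, 4, 8, 16, 32, 64, 128, 256, 512, 1024, 2048, 5, 6, 9, 10, 12, 17, 18, 20, 24,
     33, 34, 40, 21], [4094, 4095, 4075, 4087, 4091, 4090, 4085, 4071, 4089, 4086, 4078, 4062,
     4083, 4079, 3967, 3839, 4063, 4055, 4061, 3583, 4093, 4031, 3071, 4077, 4074, 2047])]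
    (by norm_num) (by decide +kernel) h

set_option maxRecDepth 100000 in
set_option maxHeartbeats 0 in
theorem h12_6_le2 {k : ℕ}
    (h : (((2 : ZMod 8) ^ 2) • devMod h12_6).FactorsThrough k) : 24 ≤ k :=
  le_of_lowerCheck_cubicOf 2
    [(2, [0, 1, 2, 4, 8, 16, 32, 64, 128, 256, 512, 1024, 5, 6, 9, 10, 12, 17, 18, 33, 34, 48,
     132, 14], [4094, 4095, 4083, 4085, 4089, 4061, 4077, 4047, 4090, 4086, 4078, 4062, 3967,
     4087, 3839, 4091, 4093, 3583, 4063, 3071, 4079, 4031, 4081, 3963])]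
    (by norm_num) (by decide +kernel) h

set_option maxRecDepth 100000 in
set_option maxHeartbeats 0 in
theorem h12_7_le2 {k : ℕ}
    (h : (((2 : ZMod 8) ^ 2) • devMod h12_7).FactorsThrough k) : 24 ≤ k :=
  le_of_lowerCheck_cubicOf 2
    [(2, [0, 1, 2, 4, 8, 16, 32, 64, 128, 256, 512, 1024, 5, 6, 9, 10, 12, 17, 18, 33, 34, 40,
     132, 14], [4094, 4095, 4083, 4085, 4089, 4061, 4077, 4055, 4090, 4086, 4078, 4062, 3967,
     4087, 3839, 4091, 4093, 3583, 4063, 3071, 4079, 4031, 4081, 3963])]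
    (by norm_num) (by decide +kernel) h

-- With exponent 1 the elementary divisors not divisible by 4 are counted; the echelon rows now have
-- levels 1 and 2. The bounds 126 for h₄, 147 to 148 for h₂ and at least 163 for h₁ separate these
-- three.
set_option maxRecDepth 100000 in
set_option maxHeartbeats 0 in
theorem h12_4_factorsThrough1 :
    (((2 : ZMod 8) ^ 1) • devMod h12_4).FactorsThrough 126 :=
  factorsThrough_cubicOf 1
    [(1, [0, 1, 2, 4, 8, 16, 32, 64, 128, 256, 512, 5, 6, 9, 10, 12, 17, 18, 24, 33, 34, 13],
     [4094, 4095, 4083, 4086, 4090, 4085, 4089, 4077, 4062, 4078, 4061, 4087, 4063, 4091, 4079,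
     4093, 3839, 4031, 4082, 3967, 3583, 4071]), (2, [1024, 2048, 3, 20, 36, 40, 48, 65, 66, 68,
     72, 80, 96, 129, 130, 132, 136, 144, 160, 192, 257, 258, 260, 264, 272, 288, 320, 384, 513,
     514, 516, 520], [4084, 4088, 4067, 4075, 4092, 4074, 4080, 4073, 4070, 4076, 4072, 4081,
     4068, 4069, 4059, 4058, 4060, 4055, 4057, 4053, 4066, 4065, 4056, 4052, 4054, 4049, 4051,
     4047, 4045, 4050, 4044, 4046]), (2, [528, 544, 576, 640, 768, 1025, 1026, 1028, 1032, 1040,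
     1056, 1088, 1152, 1280, 1536, 2049, 2050, 2052, 2056, 2064, 2080, 2112, 7, 11, 14, 19, 21,
     22, 25, 26, 28, 35], [4028, 4043, 4030, 4042, 4025, 4023, 4029, 4024, 4021, 3966, 3964, 4037,
     4022, 4015, 4013, 4027, 3071, 3997, 3838, 3965, 3961, 3582, 4039, 4041, 4026, 4038, 3998,
     4014, 3962, 3960, 3837, 4035]), (2, [37, 38, 41, 42, 44, 49, 50, 52, 56, 67, 69, 70, 73, 74,
     81, 97, 98, 131, 133, 134, 137, 145, 146, 161, 259, 261, 262, 265, 273, 289, 515, 517],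
     [3999, 3959, 3963, 4012, 3581, 3958, 3957, 3836, 3580, 3951, 3950, 3935, 3835, 3933, 3934,
     3834, 3931, 3995, 3833, 3903, 3830, 3831, 3575, 3823, 4011, 3822, 3070, 3775, 3807, 3806,
     3983, 3069]), (2, [521, 545, 15, 23, 27, 39, 4096], [2047, 3578, 3579, 3551, 3574, 3567,
     2046])]
    [[29, 30, 31, 43, 45, 46, 47, 51, 53, 54, 55, 57, 58, 59, 60, 71, 75, 76, 77, 78, 79, 82, 83,
     84, 85, 86, 87, 88, 89, 90, 91, 92], [99, 100, 101, 102, 103, 104, 105, 106, 108, 112, 113,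
     114, 116, 120, 135, 138, 139, 140, 141, 142, 143, 147, 148, 149, 150, 151, 152, 153, 154,
     155, 156, 162], [163, 164, 165, 166, 167, 168, 169, 170, 172, 176, 177, 178, 180, 184, 193,
     194, 195, 196, 197, 198, 200, 201, 202, 208, 209, 210, 224, 225, 226, 263, 266, 267], [268,
     269, 270, 271, 274, 275, 276, 277, 278, 279, 280, 281, 282, 283, 284, 290, 291, 292, 293,
     294, 295, 296, 297, 298, 300, 304, 305, 306, 308, 312, 321, 322], [323, 324, 325, 326, 328,
     329, 330, 336, 337, 352, 353, 354, 385, 386, 387, 388, 389, 390, 392, 393, 400, 401, 402,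
     416, 417, 448, 518, 519, 522, 523, 524, 525], [526, 527, 529, 530, 531, 532, 533, 534, 535,
     536, 537, 538, 539, 540, 546, 547, 548, 549, 550, 551, 552, 553, 554, 556, 560, 561, 562,
     564, 568, 577, 578, 579], [580, 581, 582, 584, 585, 586, 592, 593, 608, 609, 610, 641, 642,
     643, 644, 645, 646, 648, 649, 656, 657, 658, 672, 673, 704, 769, 770, 771, 772, 773, 774,
     776], [777, 784, 785, 800, 801, 832, 896, 1027, 1029, 1030, 1031, 1033, 1034, 1035, 1036,
     1037, 1038, 1039, 1041, 1042, 1043, 1044, 1045, 1046, 1047, 1048, 1049, 1050, 1051, 1052,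
     1057, 1058], [1059, 1060, 1061, 1062, 1063, 1064, 1065, 1066, 1068, 1072, 1073, 1074, 1076,
     1080, 1089, 1090, 1091, 1092, 1093, 1094, 1096, 1097, 1098, 1104, 1105, 1120, 1121, 1122,
     1153, 1154, 1155, 1156], [1157, 1158, 1160, 1161, 1168, 1169, 1170, 1184, 1185, 1216, 1281,
     1282, 1283, 1284, 1285, 1286, 1288, 1289, 1296, 1297, 1312, 1313, 1344, 1408, 1537, 1538,
     1539, 1540, 1541, 1544, 1545, 1552], [1568, 1569, 1600, 1664, 1792, 2051, 2053, 2054, 2055,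
     2057, 2058, 2059, 2060, 2061, 2062, 2063, 2065, 2066, 2067, 2068, 2069, 2070, 2071, 2072,
     2073, 2074, 2075, 2076, 2081, 2082, 2083, 2084], [2085, 2086, 2087, 2088, 2089, 2090, 2092,
     2096, 2097, 2098, 2100, 2104, 2113, 2114, 2115, 2116, 2117, 2118, 2120, 2121, 2122, 2128,
     2129, 2144, 2145, 2146, 2176, 2177, 2178, 2179, 2180, 2181], [2182, 2184, 2185, 2192, 2193,
     2194, 2208, 2209, 2240, 2304, 2305, 2306, 2307, 2308, 2309, 2310, 2312, 2313, 2320, 2321,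
     2336, 2337, 2368, 2432, 2560, 2561, 2562, 2563, 2564, 2565, 2568, 2569], [2576, 2592, 2593,
     2624, 2688, 2816, 3072, 3073, 3074, 3076, 3080, 3088, 3104, 3136, 3200, 3328, 3584]] (m := 125)
    (by norm_num) (by decide +kernel)

set_option maxRecDepth 100000 in
set_option maxHeartbeats 0 in
theorem h12_2_le1 {k : ℕ}
    (h : (((2 : ZMod 8) ^ 1) • devMod h12_2).FactorsThrough k) : 147 ≤ k :=
  le_of_lowerCheck_cubicOf 1
    [(1, [0, 1, 2, 4, 8, 16, 32, 64, 128, 256, 512, 5, 6, 9, 10, 12, 17, 18, 20, 33, 34, 14],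
     [4094, 4095, 4083, 4085, 4089, 4090, 4086, 4077, 4062, 4078, 4061, 4079, 4087, 4063, 4091,
     4093, 3839, 4031, 4081, 3967, 3583, 4075]), (2, [1024, 2048, 3, 24, 36, 40, 48, 65, 66, 68,
     72, 80, 96, 129, 130, 132, 136, 144, 160, 192, 257, 258, 260, 264, 272, 288, 320, 384, 513,
     514, 516, 520], [4084, 4088, 4059, 4060, 4092, 4071, 4076, 4073, 4082, 4080, 4072, 4057,
     4074, 4070, 4069, 4068, 4067, 4054, 4058, 4056, 4065, 4066, 4052, 4051, 4053, 4055, 4029,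
     4050, 4049, 4046, 4044, 4045]), (2, [528, 544, 576, 640, 768, 1025, 1026, 1028, 1032, 1040,
     1056, 1088, 1152, 1280, 1536, 2049, 2050, 2052, 2056, 2064, 2080, 2112, 2176, 2304, 2560,
     3072, 7, 11, 13, 19, 21, 22], [4047, 4041, 4042, 4043, 4027, 4030, 4026, 4022, 4028, 4024,
     4025, 3966, 4015, 4013, 4023, 4021, 4020, 3838, 3836, 3964, 4014, 3837, 3581, 3582, 3965,
     3580, 4012, 3998, 3997, 3963, 3996, 3999]), (2, [25, 26, 35, 37, 38, 41, 42, 49, 50, 67, 69,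
     70, 73, 74, 81, 82, 97, 98, 131, 133, 134, 137, 138, 145, 146, 161, 162, 193, 194, 259, 261,
     262], [3962, 3959, 4019, 3995, 3991, 3961, 3960, 3958, 3957, 4039, 3956, 3951, 3950, 3949,
     3948, 3934, 3935, 3933, 4011, 3902, 3903, 3931, 3901, 3835, 3834, 3833, 3831, 3823, 3832,
     4038, 3830, 3829]), (2, [265, 266, 273, 274, 289, 290, 321, 322, 385, 386, 515, 517, 518,
     521, 529, 530, 545, 546, 1027, 2051, 15, 23, 27, 39, 43, 51, 71, 99, 4096], [3805, 3822,
     3820, 3821, 3774, 3071, 3806, 3775, 3711, 3579, 4037, 3577, 3807, 3710, 3575, 3578, 3566,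
     2047, 3455, 3069, 3576, 3574, 3567, 3551, 3454, 3519, 3550, 3327, 3070])]
    (by norm_num) (by decide +kernel) h

set_option maxRecDepth 100000 in
set_option maxHeartbeats 0 in
theorem h12_2_factorsThrough1 :
    (((2 : ZMod 8) ^ 1) • devMod h12_2).FactorsThrough 148 :=
  factorsThrough_cubicOf 1
    [(1, [0, 1, 2, 4, 8, 16, 32, 64, 128, 256, 512, 5, 6, 9, 10, 12, 17, 18, 20, 33, 34, 14],
     [4094, 4095, 4083, 4085, 4089, 4090, 4086, 4077, 4062, 4078, 4061, 4079, 4087, 4063, 4091,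
     4093, 3839, 4031, 4081, 3967, 3583, 4075]), (2, [1024, 2048, 3, 24, 36, 40, 48, 65, 66, 68,
     72, 80, 96, 129, 130, 132, 136, 144, 160, 192, 257, 258, 260, 264, 272, 288, 320, 384, 513,
     514, 516, 520], [4084, 4088, 4059, 4060, 4092, 4071, 4076, 4073, 4082, 4080, 4072, 4057,
     4074, 4070, 4069, 4068, 4067, 4054, 4058, 4056, 4065, 4066, 4052, 4051, 4053, 4055, 4029,
     4050, 4049, 4046, 4044, 4045]), (2, [528, 544, 576, 640, 768, 1025, 1026, 1028, 1032, 1040,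
     1056, 1088, 1152, 1280, 1536, 2049, 2050, 2052, 2056, 2064, 2080, 2112, 2176, 2304, 2560,
     3072, 7, 11, 13, 19, 21, 22], [4047, 4041, 4042, 4043, 4027, 4030, 4026, 4022, 4028, 4024,
     4025, 3966, 4015, 4013, 4023, 4021, 4020, 3838, 3836, 3964, 4014, 3837, 3581, 3582, 3965,
     3580, 4012, 3998, 3997, 3963, 3996, 3999]), (2, [25, 26, 35, 37, 38, 41, 42, 49, 50, 67, 69,
     70, 73, 74, 81, 82, 97, 98, 131, 133, 134, 137, 138, 145, 146, 161, 162, 193, 194, 259, 261,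
     262], [3962, 3959, 4019, 3995, 3991, 3961, 3960, 3958, 3957, 4039, 3956, 3951, 3950, 3949,
     3948, 3934, 3935, 3933, 4011, 3902, 3903, 3931, 3901, 3835, 3834, 3833, 3831, 3823, 3832,
     4038, 3830, 3829]), (2, [265, 266, 273, 274, 289, 290, 321, 322, 385, 386, 515, 517, 518,
     521, 529, 530, 545, 546, 1027, 2051, 15, 23, 27, 39, 43, 51, 71, 99, 4096], [3805, 3822,
     3820, 3821, 3774, 3071, 3806, 3775, 3711, 3579, 4037, 3577, 3807, 3710, 3575, 3578, 3566,
     2047, 3455, 3069, 3576, 3574, 3567, 3551, 3454, 3519, 3550, 3327, 3070])]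
    [[28, 29, 30, 31, 44, 45, 46, 47, 52, 53, 54, 55, 56, 57, 58, 59, 75, 76, 77, 78, 79, 83, 84,
     85, 86, 87, 88, 89, 90, 91, 100, 101], [102, 103, 104, 105, 106, 107, 112, 113, 114, 115,
     135, 139, 140, 141, 142, 143, 147, 148, 149, 150, 151, 152, 153, 154, 155, 163, 164, 165,
     166, 167, 168, 169], [170, 171, 176, 177, 178, 179, 195, 196, 197, 198, 199, 200, 201, 202,
     208, 209, 210, 224, 225, 226, 227, 263, 267, 268, 269, 270, 271, 275, 276, 277, 278, 279],
     [280, 281, 282, 283, 291, 292, 293, 294, 295, 296, 297, 298, 299, 304, 305, 306, 307, 323,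
     324, 325, 326, 327, 328, 329, 330, 336, 337, 338, 352, 353, 354, 355], [387, 388, 389, 390,
     392, 393, 394, 400, 401, 402, 416, 417, 418, 448, 449, 450, 519, 522, 523, 524, 525, 526,
     527, 531, 532, 533, 534, 535, 536, 537, 538, 539], [547, 548, 549, 550, 551, 552, 553, 554,
     555, 560, 561, 562, 563, 577, 578, 579, 580, 581, 582, 583, 584, 585, 586, 592, 593, 594,
     608, 609, 610, 611, 641, 642], [643, 644, 645, 646, 648, 649, 650, 656, 657, 658, 672, 673,
     674, 704, 705, 706, 769, 770, 771, 772, 773, 774, 776, 777, 778, 784, 785, 786, 800, 801,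
     802, 832], [833, 834, 896, 897, 898, 1029, 1030, 1031, 1033, 1034, 1035, 1036, 1037, 1038,
     1039, 1041, 1042, 1043, 1044, 1045, 1046, 1047, 1048, 1049, 1050, 1051, 1057, 1058, 1059,
     1060, 1061, 1062], [1063, 1064, 1065, 1066, 1067, 1072, 1073, 1074, 1075, 1089, 1090, 1091,
     1092, 1093, 1094, 1095, 1096, 1097, 1098, 1104, 1105, 1106, 1120, 1121, 1122, 1123, 1153,
     1154, 1155, 1156, 1157, 1158], [1160, 1161, 1162, 1168, 1169, 1170, 1184, 1185, 1186, 1216,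
     1217, 1218, 1281, 1282, 1283, 1284, 1285, 1286, 1288, 1289, 1290, 1296, 1297, 1298, 1312,
     1313, 1314, 1344, 1345, 1346, 1408, 1409], [1410, 1537, 1538, 1539, 1540, 1541, 1542, 1544,
     1545, 1552, 1553, 1554, 1568, 1569, 1570, 1600, 1664, 1792, 2053, 2054, 2055, 2057, 2058,
     2059, 2060, 2061, 2062, 2063, 2065, 2066, 2067, 2068], [2069, 2070, 2071, 2072, 2073, 2074,
     2075, 2081, 2082, 2083, 2084, 2085, 2086, 2087, 2088, 2089, 2090, 2091, 2096, 2097, 2098,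
     2099, 2113, 2114, 2115, 2116, 2117, 2118, 2119, 2120, 2121, 2122], [2128, 2129, 2130, 2144,
     2145, 2146, 2147, 2177, 2178, 2179, 2180, 2181, 2182, 2184, 2185, 2186, 2192, 2193, 2194,
     2208, 2209, 2210, 2240, 2241, 2242, 2305, 2306, 2307, 2308, 2309, 2310, 2312], [2313, 2314,
     2320, 2321, 2322, 2336, 2337, 2338, 2368, 2369, 2370, 2432, 2433, 2434, 2561, 2562, 2563,
     2564, 2565, 2566, 2568, 2569, 2576, 2577, 2578, 2592, 2593, 2594, 2624, 2688, 2816, 3073],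
     [3074, 3075, 3076, 3080, 3088, 3104, 3136, 3200, 3328, 3584]] (m := 147)
    (by norm_num) (by decide +kernel)

set_option maxRecDepth 100000 in
set_option maxHeartbeats 0 in
theorem h12_1_le1 {k : ℕ}
    (h : (((2 : ZMod 8) ^ 1) • devMod h12_1).FactorsThrough k) : 163 ≤ k :=
  le_of_lowerCheck_cubicOf 1
    [(1, [0, 1, 2, 4, 8, 16, 32, 64, 128, 256, 512, 5, 6, 9, 10, 12, 17, 18, 20, 34, 65, 14],
     [4094, 4095, 4083, 4085, 4089, 4090, 4078, 4077, 4086, 4061, 4030, 4079, 4087, 3967, 4091,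
     4093, 4063, 4031, 4081, 3839, 3583, 4075]), (2, [1024, 2048, 3, 24, 33, 36, 40, 48, 66, 68,
     72, 80, 96, 129, 130, 132, 136, 144, 160, 192, 257, 258, 260, 264, 272, 288, 320, 384, 513,
     514, 516, 520], [4084, 4088, 4043, 4060, 4073, 4076, 4072, 4082, 4074, 4069, 4071, 4080,
     4068, 4070, 4059, 4092, 4058, 4062, 4055, 4057, 4065, 4053, 4056, 4052, 4050, 4054, 4049,
     4047, 4066, 4067, 4044, 4042]), (2, [528, 544, 576, 640, 768, 1025, 1026, 1028, 1032, 1040,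
     1056, 1088, 1152, 1280, 1536, 2049, 2050, 2052, 2056, 2064, 2080, 2112, 7, 11, 13, 19, 21,
     22, 25, 26, 28, 35], [4046, 4013, 4045, 4029, 4051, 4038, 4028, 3966, 4026, 4027, 4025, 4024,
     4023, 4021, 4022, 4020, 4015, 3838, 3965, 4014, 3964, 3837, 4039, 4035, 4012, 4041, 3999,
     3963, 3998, 3996, 3836, 4018]), (2, [37, 38, 41, 42, 44, 49, 50, 52, 56, 67, 69, 70, 73, 74,
     81, 82, 97, 98, 131, 133, 134, 137, 138, 145, 146, 161, 162, 193, 194, 259, 261, 262], [3997,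
     3962, 3961, 3959, 3580, 3960, 3957, 3581, 3582, 3958, 3951, 3935, 3956, 3948, 3943, 3950,
     3933, 3949, 4007, 3934, 3932, 3902, 3901, 3903, 3900, 3834, 3833, 3835, 3831, 3995, 3828,
     3575]), (2, [265, 266, 273, 274, 289, 290, 321, 322, 385, 386, 515, 517, 518, 521, 522, 529,
     530, 545, 546, 577, 578, 641, 642, 1027, 15, 23, 27, 39, 43, 51, 71, 75], [3830, 3832, 3823,
     3829, 3822, 3821, 3807, 3774, 3775, 3574, 4019, 3820, 3806, 3711, 3805, 3772, 3804, 3773,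
     3579, 3710, 2047, 3709, 3071, 3708, 3577, 3572, 3578, 3566, 3327, 3573, 3567, 3550]), (2,
     [83, 99, 135, 139, 147, 163, 195, 263, 267, 291, 387, 523, 4096], [3454, 3519, 3518, 3325,
     3326, 3565, 3549, 3551, 3455, 3517, 3564, 3548, 3453])]
    (by norm_num) (by decide +kernel) h

set_option maxRecDepth 100000 in
set_option maxHeartbeats 0 in
theorem h12_6_factorsThrough1 :
    (((2 : ZMod 8) ^ 1) • devMod h12_6).FactorsThrough 147 :=
  factorsThrough_cubicOf 1
    [(1, [0, 1, 2, 4, 8, 16, 32, 64, 128, 256, 512, 1024, 5, 6, 9, 10, 12, 17, 18, 33, 34, 48,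
     132, 14], [4094, 4095, 4083, 4085, 4089, 4061, 4077, 4047, 4090, 4086, 4078, 4062, 3967,
     4087, 3839, 4091, 4093, 3583, 4063, 3071, 4079, 4031, 4081, 3963]), (2, [2048, 3, 20, 24, 36,
     40, 65, 66, 68, 72, 80, 96, 129, 130, 136, 144, 160, 192, 257, 258, 260, 264, 272, 288, 320,
     384, 513, 514, 516, 520, 528, 544], [4088, 3959, 4053, 4057, 4069, 4073, 3965, 4075, 4045,
     4041, 4055, 4071, 4059, 4082, 4092, 4058, 4080, 4084, 4067, 4074, 4076, 4072, 4013, 4060,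
     4070, 4066, 4051, 4056, 4046, 4052, 4054, 4043]), (2, [576, 640, 768, 1025, 1026, 1028, 1032,
     1040, 1056, 1088, 1152, 1280, 1536, 2049, 2052, 2056, 2064, 2080, 2112, 7, 11, 13, 19, 21,
     22, 25, 26, 28, 35, 37, 38, 41], [4049, 4050, 4068, 4042, 4065, 4037, 4029, 4030, 4007, 4044,
     4027, 4026, 4039, 4035, 4038, 4014, 4023, 4025, 4015, 3955, 3931, 3961, 3835, 3935, 4011,
     3833, 4022, 3999, 3947, 3957, 4021, 3915]), (2, [42, 44, 49, 50, 52, 56, 67, 69, 70, 73, 74,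
     76, 81, 82, 84, 88, 97, 98, 100, 104, 112, 131, 133, 134, 137, 138, 140, 145, 146, 148, 152,
     161], [4010, 3995, 3899, 4019, 4009, 3998, 3951, 3919, 3993, 3871, 4006, 3997, 3903, 3990,
     4005, 3989, 3927, 3994, 3991, 3962, 3966, 3946, 3923, 3958, 3950, 3983, 3934, 3933, 3926,
     3838, 3834, 3830]), (2, [162, 164, 176, 193, 196, 259, 261, 265, 273, 289, 517, 521, 529,
     545, 1029, 1033, 1041, 15, 23, 27, 29, 39, 45, 53, 57, 60], [3837, 3822, 3930, 3582, 2046,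
     3070, 3823, 3807, 3831, 3827, 3806, 3579, 3574, 3055, 3575, 3567, 3566, 3551, 3550, 3039,
     3819, 2047, 3791, 3818, 3775, 3067])]
    [[30, 31, 43, 46, 47, 51, 54, 55, 58, 59, 61, 62, 71, 75, 77, 78, 79, 83, 85, 86, 87, 89, 90,
     91, 92, 93, 99, 101, 102, 103, 105, 106], [108, 109, 113, 114, 116, 117, 120, 121, 124, 135,
     139, 141, 142, 143, 147, 149, 150, 151, 153, 154, 155, 156, 157, 163, 165, 166, 167, 168,
     169, 170, 172, 173], [177, 178, 180, 181, 184, 185, 188, 194, 195, 197, 198, 200, 201, 202,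
     204, 208, 209, 210, 212, 216, 224, 225, 226, 228, 232, 240, 262, 263, 266, 267, 268, 269],
     [270, 271, 274, 275, 276, 277, 278, 279, 280, 281, 282, 283, 284, 285, 290, 291, 292, 293,
     294, 295, 296, 297, 298, 300, 301, 304, 305, 306, 308, 309, 312, 313], [316, 321, 322, 323,
     324, 325, 326, 328, 329, 330, 332, 336, 337, 338, 340, 344, 352, 353, 354, 356, 360, 368,
     385, 386, 387, 388, 389, 390, 392, 393, 394, 396], [400, 401, 402, 404, 408, 416, 417, 418,
     420, 432, 448, 449, 452, 515, 518, 519, 522, 523, 524, 525, 526, 527, 530, 531, 532, 533,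
     534, 535, 536, 537, 538, 539], [540, 541, 546, 547, 548, 549, 550, 551, 552, 553, 554, 556,
     557, 560, 561, 562, 564, 565, 568, 569, 572, 577, 578, 579, 580, 581, 582, 584, 585, 586,
     588, 592], [593, 594, 596, 600, 608, 609, 610, 612, 616, 624, 641, 642, 643, 644, 645, 646,
     648, 649, 650, 652, 656, 657, 658, 660, 664, 672, 673, 674, 676, 688, 704, 705], [708, 769,
     770, 771, 772, 773, 776, 777, 784, 785, 800, 801, 832, 896, 1027, 1030, 1031, 1034, 1035,
     1036, 1037, 1038, 1039, 1042, 1043, 1044, 1045, 1046, 1047, 1048, 1049, 1050], [1051, 1052,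
     1053, 1057, 1058, 1059, 1060, 1061, 1062, 1063, 1064, 1065, 1066, 1068, 1069, 1072, 1073,
     1074, 1076, 1077, 1080, 1081, 1084, 1089, 1090, 1091, 1092, 1093, 1094, 1096, 1097, 1098],
     [1100, 1104, 1105, 1106, 1108, 1112, 1120, 1121, 1122, 1124, 1128, 1136, 1153, 1154, 1155,
     1156, 1157, 1158, 1160, 1161, 1162, 1164, 1168, 1169, 1170, 1172, 1176, 1184, 1185, 1186,
     1188, 1200], [1216, 1217, 1220, 1281, 1282, 1283, 1284, 1285, 1288, 1289, 1296, 1297, 1312,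
     1313, 1344, 1408, 1537, 1538, 1540, 1541, 1544, 1545, 1552, 1553, 1568, 1569, 1600, 1664,
     1792, 2050, 2051, 2053], [2054, 2055, 2057, 2058, 2059, 2060, 2061, 2062, 2063, 2065, 2066,
     2067, 2068, 2069, 2070, 2071, 2072, 2073, 2074, 2075, 2076, 2077, 2081, 2082, 2083, 2084,
     2085, 2086, 2087, 2088, 2089, 2090], [2092, 2093, 2096, 2097, 2098, 2100, 2101, 2104, 2105,
     2108, 2113, 2114, 2115, 2116, 2117, 2118, 2120, 2121, 2122, 2124, 2128, 2129, 2130, 2132,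
     2136, 2144, 2145, 2146, 2148, 2152, 2160, 2176], [2177, 2178, 2179, 2180, 2181, 2182, 2184,
     2185, 2186, 2188, 2192, 2193, 2194, 2196, 2200, 2208, 2209, 2210, 2212, 2224, 2240, 2241,
     2244, 2304, 2305, 2306, 2307, 2308, 2309, 2312, 2313, 2320], [2321, 2336, 2337, 2368, 2432,
     2560, 2561, 2562, 2564, 2565, 2568, 2569, 2576, 2577, 2592, 2593, 2624, 2688, 2816, 3072,
     3073, 3074, 3076, 3077, 3080, 3081, 3088, 3089, 3104, 3136, 3200, 3328], [3584, 4096]] (m := 146)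
    (by norm_num) (by decide +kernel)

set_option maxRecDepth 100000 in
set_option maxHeartbeats 0 in
theorem h12_7_factorsThrough1 :
    (((2 : ZMod 8) ^ 1) • devMod h12_7).FactorsThrough 147 :=
  factorsThrough_cubicOf 1
    [(1, [0, 1, 2, 4, 8, 16, 32, 64, 128, 256, 512, 1024, 5, 6, 9, 10, 12, 17, 18, 33, 34, 40,
     132, 14], [4094, 4095, 4083, 4085, 4089, 4061, 4077, 4055, 4090, 4086, 4078, 4062, 3967,
     4087, 3839, 4091, 4093, 3583, 4063, 3071, 4079, 4031, 4081, 3963]), (2, [2048, 3, 20, 24, 36,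
     48, 65, 66, 68, 72, 80, 96, 129, 130, 136, 144, 160, 192, 257, 258, 260, 264, 272, 288, 320,
     384, 513, 514, 516, 520, 528, 544], [4088, 3959, 4053, 4057, 4069, 4029, 3965, 4075, 4023,
     4051, 3999, 4047, 4059, 4082, 4092, 4058, 4080, 4084, 4073, 4074, 4076, 4072, 4019, 4060,
     4071, 4067, 4045, 4056, 4070, 4054, 4044, 4050]), (2, [576, 640, 768, 1025, 1026, 1028, 1032,
     1040, 1056, 1088, 1152, 1280, 1536, 2049, 2052, 2056, 2064, 2080, 2112, 7, 11, 13, 19, 21,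
     22, 25, 26, 28, 35, 37, 38, 41], [4039, 4043, 4068, 4041, 4066, 4022, 4049, 4027, 4006, 4065,
     4052, 4030, 4038, 4037, 4018, 4046, 3995, 4015, 4026, 3955, 3931, 3961, 3835, 3935, 3934,
     3833, 4014, 3837, 3947, 3957, 3998, 3923]), (2, [42, 44, 49, 50, 52, 56, 67, 69, 70, 73, 74,
     76, 81, 82, 88, 97, 98, 100, 104, 131, 133, 134, 137, 138, 140, 145, 146, 148, 161, 162, 164,
     168], [3990, 3927, 3899, 3966, 3964, 3871, 3951, 3926, 3962, 3903, 3838, 3831, 3807, 3582,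
     3798, 3919, 3070, 3958, 3915, 4042, 3991, 3950, 3994, 3932, 3960, 3836, 3823, 3933, 4007,
     3834, 3956, 3954]), (2, [193, 196, 259, 261, 265, 273, 289, 517, 521, 529, 545, 1027, 1029,
     1033, 1041, 15, 27, 29, 39, 43, 45, 53, 57, 77, 89, 101], [3832, 3902, 3827, 3830, 3579,
     3574, 3578, 3822, 3567, 3806, 3551, 3826, 3575, 3566, 3550, 3067, 3055, 3799, 3063, 2047,
     3819, 3775, 3774, 3054, 3062, 2046])]
    [[23, 30, 31, 46, 47, 51, 54, 55, 58, 59, 60, 61, 71, 75, 78, 79, 83, 84, 85, 86, 90, 91, 92,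
     93, 99, 102, 103, 105, 106, 107, 108, 109], [112, 113, 114, 116, 117, 120, 121, 135, 139,
     141, 142, 143, 147, 149, 150, 152, 153, 154, 155, 156, 157, 163, 165, 166, 167, 169, 170,
     171, 172, 173, 176, 177], [178, 180, 181, 184, 185, 194, 195, 197, 198, 200, 201, 202, 204,
     205, 208, 209, 210, 212, 216, 217, 224, 225, 226, 228, 229, 232, 262, 263, 266, 267, 268,
     269], [270, 271, 274, 275, 276, 277, 278, 280, 281, 282, 283, 284, 285, 290, 291, 292, 293,
     294, 295, 296, 297, 298, 299, 300, 301, 304, 305, 306, 308, 309, 312, 313], [321, 322, 323,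
     324, 325, 326, 328, 329, 330, 332, 333, 336, 337, 338, 344, 345, 352, 353, 354, 356, 357,
     360, 385, 386, 387, 388, 389, 390, 392, 393, 394, 396], [400, 401, 402, 404, 416, 417, 418,
     420, 424, 448, 449, 452, 515, 518, 519, 522, 523, 524, 525, 526, 527, 530, 531, 532, 533,
     534, 536, 537, 538, 539, 540, 541], [546, 547, 548, 549, 550, 551, 552, 553, 554, 555, 556,
     557, 560, 561, 562, 564, 565, 568, 569, 577, 578, 579, 580, 581, 582, 584, 585, 586, 588,
     589, 592, 593], [594, 600, 601, 608, 609, 610, 612, 613, 616, 641, 642, 643, 644, 645, 646,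
     648, 649, 650, 652, 656, 657, 658, 660, 672, 673, 674, 676, 680, 704, 705, 708, 769], [770,
     771, 772, 773, 776, 777, 784, 785, 800, 801, 832, 896, 1030, 1031, 1034, 1035, 1036, 1037,
     1038, 1039, 1042, 1043, 1044, 1045, 1046, 1048, 1049, 1050, 1051, 1052, 1053, 1057], [1058,
     1059, 1060, 1061, 1062, 1063, 1064, 1065, 1066, 1067, 1068, 1069, 1072, 1073, 1074, 1076,
     1077, 1080, 1081, 1089, 1090, 1091, 1092, 1093, 1094, 1096, 1097, 1098, 1100, 1101, 1104,
     1105], [1106, 1112, 1113, 1120, 1121, 1122, 1124, 1125, 1128, 1153, 1154, 1155, 1156, 1157,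
     1158, 1160, 1161, 1162, 1164, 1168, 1169, 1170, 1172, 1184, 1185, 1186, 1188, 1192, 1216,
     1217, 1220, 1281], [1282, 1283, 1284, 1285, 1288, 1289, 1296, 1297, 1312, 1313, 1344, 1408,
     1537, 1538, 1539, 1540, 1541, 1544, 1545, 1552, 1553, 1568, 1569, 1600, 1664, 1792, 2050,
     2051, 2053, 2054, 2055, 2057], [2058, 2059, 2060, 2061, 2062, 2063, 2065, 2066, 2067, 2068,
     2069, 2070, 2072, 2073, 2074, 2075, 2076, 2077, 2081, 2082, 2083, 2084, 2085, 2086, 2087,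
     2088, 2089, 2090, 2091, 2092, 2093, 2096], [2097, 2098, 2100, 2101, 2104, 2105, 2113, 2114,
     2115, 2116, 2117, 2118, 2120, 2121, 2122, 2124, 2125, 2128, 2129, 2130, 2136, 2137, 2144,
     2145, 2146, 2148, 2149, 2152, 2176, 2177, 2178, 2179], [2180, 2181, 2182, 2184, 2185, 2186,
     2188, 2192, 2193, 2194, 2196, 2208, 2209, 2210, 2212, 2216, 2240, 2241, 2244, 2304, 2305,
     2306, 2307, 2308, 2309, 2312, 2313, 2320, 2321, 2336, 2337, 2368], [2432, 2560, 2561, 2562,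
     2564, 2565, 2568, 2569, 2576, 2577, 2592, 2593, 2624, 2688, 2816, 3072, 3073, 3074, 3075,
     3076, 3077, 3080, 3081, 3088, 3089, 3104, 3136, 3200, 3328, 3584, 4096]] (m := 146)
    (by norm_num) (by decide +kernel)

-- The value 150 exceeds the common upper bound 147 for h₆ and h₇.
set_option maxRecDepth 100000 in
set_option maxHeartbeats 0 in
theorem h12_3_le1 {k : ℕ}
    (h : (((2 : ZMod 8) ^ 1) • devMod h12_3).FactorsThrough k) : 150 ≤ k :=
  le_of_lowerCheck_cubicOf 1
    [(1, [0, 1, 2, 4, 8, 16, 32, 64, 128, 256, 512, 1024, 5, 6, 9, 10, 12, 17, 18, 20, 24, 33, 34,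
     13], [4094, 4095, 4083, 4086, 4090, 4089, 4085, 4078, 4061, 4077, 4075, 4062, 4087, 4079,
     4091, 4063, 4093, 4031, 3839, 4082, 3583, 3071, 3967, 4071]), (2, [2048, 3, 36, 40, 48, 65,
     66, 68, 72, 80, 96, 129, 130, 132, 136, 144, 160, 192, 257, 258, 260, 264, 272, 288, 320,
     384, 513, 514, 516, 520, 528, 544], [4088, 4067, 4092, 4081, 4072, 4074, 4070, 4076, 4084,
     4057, 4069, 4059, 4073, 4058, 4060, 4056, 4080, 4066, 4065, 4055, 4068, 4053, 4054, 4052,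
     4050, 4051, 4049, 4047, 4037, 4046, 4044, 4045]), (2, [576, 640, 768, 1025, 1026, 1028, 1032,
     1040, 1056, 1088, 1152, 1280, 1536, 2049, 2052, 2056, 2064, 2080, 2112, 7, 11, 14, 19, 21,
     22, 25, 26, 28, 35, 37, 38, 41], [4043, 4042, 4041, 4039, 4038, 4028, 4035, 4029, 4030, 4027,
     4025, 4026, 4023, 4024, 4019, 4022, 4021, 4015, 4018, 4014, 4007, 4013, 4011, 4009, 3998,
     4006, 3997, 3999, 3995, 4010, 3991, 3983]), (2, [42, 44, 49, 50, 52, 56, 67, 69, 70, 73, 74,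
     76, 81, 82, 84, 88, 97, 98, 100, 104, 112, 131, 133, 134, 137, 138, 140, 145, 148, 152, 161,
     162], [3966, 3979, 3994, 3965, 3963, 3964, 3993, 3962, 3961, 3959, 3955, 3954, 3951, 3950,
     3987, 3958, 3947, 3946, 3927, 3943, 3935, 3933, 3942, 3934, 3902, 3903, 3931, 3899, 3838,
     3831, 3837, 3834]), (2, [164, 168, 176, 224, 261, 265, 268, 273, 276, 289, 517, 521, 529,
     545, 1029, 1033, 1041, 15, 23, 27, 29, 39, 45, 53, 57, 60, 77, 85, 89, 101], [3582, 3835,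
     3827, 3830, 3822, 3819, 3070, 3579, 2046, 3807, 3806, 3823, 3575, 3578, 2047, 3574, 3567,
     3067, 3551, 3566, 3836, 3063, 3818, 3815, 3775, 3062, 3054, 3039, 3550, 3055])]
    (by norm_num) (by decide +kernel) h

-- The pair h₆, h₇ is separated by the elementary divisors not divisible by 8: at most 420 for h₇
-- against at least 439 for h₆.
set_option maxRecDepth 100000 in
set_option maxHeartbeats 0 in
theorem h12_7_factorsThrough0 :
    (((2 : ZMod 8) ^ 0) • devMod h12_7).FactorsThrough 420 :=
  factorsThrough_cubicOf 0
    [(0, [0, 1, 2, 4, 8, 16, 32, 64, 128, 256, 512, 1024, 5, 6, 9, 10, 12, 17, 18, 33, 34, 40,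
     132, 14], [4094, 4095, 4083, 4085, 4089, 4061, 4077, 4055, 4090, 4086, 4078, 4062, 3967,
     4087, 3839, 4091, 4093, 3583, 4063, 3071, 4079, 4031, 4081, 3963]), (1, [2048, 3, 20, 24, 36,
     48, 65, 66, 68, 72, 80, 96, 129, 130, 136, 144, 160, 192, 257, 258, 260, 264, 272, 288, 320,
     384, 513, 514, 516, 520, 528, 544], [4088, 3959, 4053, 4057, 4069, 4029, 3965, 4075, 4023,
     4051, 3999, 4047, 4059, 4082, 4092, 4058, 4080, 4084, 4073, 4074, 4076, 4072, 4019, 4060,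
     4071, 4067, 4045, 4056, 4070, 4054, 4044, 4050]), (1, [576, 640, 768, 1025, 1026, 1028, 1032,
     1040, 1056, 1088, 1152, 1280, 1536, 2049, 2052, 2056, 2064, 2080, 2112, 7, 11, 13, 19, 21,
     22, 25, 26, 28, 35, 37, 38, 41], [4039, 4043, 4068, 4041, 4066, 4022, 4049, 4027, 4006, 4065,
     4052, 4030, 4038, 4037, 4018, 4046, 3995, 4015, 4026, 3955, 3931, 3961, 3835, 3935, 3934,
     3833, 4014, 3837, 3947, 3957, 3998, 3923]), (1, [42, 44, 49, 50, 52, 56, 67, 69, 70, 73, 74,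
     76, 81, 82, 88, 97, 98, 100, 104, 131, 133, 134, 137, 138, 140, 145, 146, 148, 161, 162, 164,
     168], [3990, 3927, 3899, 3966, 3964, 3871, 3951, 3926, 3962, 3903, 3838, 3831, 3807, 3582,
     3798, 3919, 3070, 3958, 3915, 4042, 3991, 3950, 3994, 3932, 3960, 3836, 3823, 3933, 4007,
     3834, 3956, 3954]), (1, [193, 196, 259, 261, 265, 273, 289, 517, 521, 529, 545, 1027, 1029,
     1033, 1041, 15, 27, 29, 39, 43, 45, 53, 57, 77, 89, 101], [3832, 3902, 3827, 3830, 3579,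
     3574, 3578, 3822, 3567, 3806, 3551, 3826, 3575, 3566, 3550, 3067, 3055, 3799, 3063, 2047,
     3819, 3775, 3774, 3054, 3062, 2046]), (2, [2050, 2176, 2304, 2560, 3072, 84, 112, 152, 176,
     194, 200, 208, 224, 262, 266, 268, 274, 276, 280, 290, 292, 296, 304, 321, 322, 324, 328,
     336, 352, 385, 386, 388], [4064, 4048, 4040, 4035, 4036, 3870, 3922, 3997, 4034, 4025, 4028,
     4033, 4024, 4032, 4021, 4020, 4017, 4013, 3983, 4003, 4012, 4016, 3987, 4009, 4011, 3952,
     4010, 4005, 4002, 4004, 3982, 3996]), (2, [392, 400, 416, 448, 515, 518, 522, 524, 530, 532,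
     536, 546, 548, 552, 560, 577, 578, 580, 584, 592, 608, 641, 642, 644, 648, 656, 672, 704,
     769, 772, 776, 784], [3986, 3953, 3975, 3949, 3978, 3946, 3979, 3948, 3829, 3925, 3929, 3943,
     3945, 3944, 3942, 3941, 3938, 3939, 3820, 3918, 3802, 4008, 3930, 3924, 3974, 3911, 3917,
     3916, 3989, 3928, 3914, 3818]), (2, [800, 832, 1030, 1034, 1036, 1042, 1044, 1048, 1057,
     1058, 1060, 1064, 1072, 1089, 1090, 1092, 1096, 1104, 1120, 1153, 1156, 1160, 1168, 1184,
     1281, 1282, 1284, 1288, 1296, 1312, 1537, 1538], [3910, 3066, 3906, 3895, 3894, 3901, 3890,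
     3900, 3940, 3891, 3898, 3937, 3907, 3886, 3828, 3883, 3863, 3814, 3867, 3993, 3862, 3821,
     3813, 3815, 3992, 3887, 3878, 3790, 3810, 3805, 3988, 3766]), (2, [1540, 1544, 1552, 1568,
     1600, 2051, 2053, 2054, 2057, 2058, 2060, 2065, 2066, 2068, 2072, 2081, 2082, 2084, 2088,
     2096, 2113, 2116, 2120, 2128, 2144, 2177, 2208, 2305, 2312, 2561, 3073, 23], [3803, 3581,
     3804, 3795, 3783, 3811, 3797, 3791, 3817, 3571, 3787, 3825, 3580, 3770, 3782, 3879, 3559,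
     3794, 3786, 3759, 3758, 3570, 3563, 3562, 3543, 3546, 3038, 3518, 3039, 3558, 3547, 3936]),
     (2, [30, 46, 51, 54, 58, 60, 71, 75, 78, 83, 85, 86, 90, 92, 99, 102, 105, 106, 108, 113,
     116, 120, 135, 139, 141, 142, 147, 149, 150, 153, 154, 156], [3824, 3816, 3921, 3800, 3866,
     3711, 3703, 3710, 3707, 3678, 3709, 3679, 3326, 3671, 3694, 3454, 3913, 3455, 3702, 3706,
     3695, 3319, 3742, 3771, 3882, 3542, 3708, 3796, 3519, 3801, 3535, 3743]), (2, [163, 165, 166,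
     169, 170, 172, 177, 178, 180, 184, 195, 197, 201, 204, 209, 212, 216, 225, 228, 232, 240,
     263, 267, 269, 270, 275, 277, 278, 281, 282, 284, 291], [3576, 3812, 3534, 3855, 3069, 3698,
     3789, 3059, 3573, 3767, 3068, 3577, 3572, 3058, 3565, 3030, 3047, 3554, 3034, 3035, 3051,
     3548, 3564, 3854, 3031, 3549, 3788, 3046, 3773, 3050, 3555, 3539]), (2, [293, 294, 297, 298,
     300, 305, 306, 308, 312, 323, 325, 329, 332, 337, 340, 344, 353, 356, 360, 368, 393, 519,
     523, 525, 526, 531, 533, 537, 540, 547, 549, 553], [3779, 3023, 3772, 3007, 3530, 3763, 3006,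
     3053, 3527, 2043, 3526, 3538, 3022, 3061, 2042, 2031, 3531, 2039, 2038, 2015, 2014, 3327,
     3064, 3739, 2030, 3503, 3738, 3751, 3060, 3065, 3762, 3750]), (2, [556, 561, 564, 568, 581,
     585, 593, 1031, 1035, 1037, 1043, 1045, 1049, 1052, 1059, 1061, 1065, 1068, 1073, 1076, 1080,
     1093, 1097, 1105, 1121, 2061, 2073, 2085, 31, 47, 55, 59], [3052, 3699, 3042, 2943, 2942,
     3037, 3014, 3027, 3043, 3735, 3502, 3450, 3569, 3036, 3019, 3734, 3511, 3003, 3451, 3002,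
     2815, 3026, 3015, 2999, 3018, 2991, 2035, 2034, 3447, 3438, 3439, 3423]), (2, [61, 62, 79,
     87, 93, 103, 109, 117, 121, 157, 173, 181, 185, 285, 301, 1069, 4096], [3670, 2814, 2559,
     2558, 3422, 1983, 3057, 3446, 3318, 2998, 2990, 2975, 2974, 2044, 2045, 1982, 3920])]
    [[63, 91, 94, 95, 107, 110, 111, 114, 115, 118, 119, 122, 123, 124, 125, 126, 143, 151, 155,
     158, 159, 167, 171, 174, 175, 179, 182, 183, 186, 187, 188, 189], [190, 198, 199, 202, 203,
     205, 206, 207, 210, 211, 213, 214, 215, 217, 218, 220, 221, 226, 227, 229, 230, 231, 233,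
     234, 236, 237, 241, 242, 244, 245, 248, 249], [271, 279, 283, 286, 287, 295, 299, 302, 303,
     307, 309, 310, 311, 313, 314, 315, 316, 317, 318, 326, 327, 330, 331, 333, 334, 335, 338,
     339, 341, 342, 343, 345], [346, 348, 349, 354, 355, 357, 358, 359, 361, 362, 364, 365, 369,
     370, 372, 373, 376, 377, 387, 389, 390, 391, 394, 395, 396, 397, 398, 401, 402, 403, 404,
     405], [406, 408, 409, 410, 412, 413, 417, 418, 419, 420, 421, 422, 424, 425, 426, 428, 429,
     432, 433, 434, 436, 437, 440, 441, 449, 450, 451, 452, 453, 456, 457, 460], [464, 465, 468,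
     472, 480, 481, 484, 488, 496, 527, 534, 535, 538, 539, 541, 542, 543, 550, 551, 554, 555,
     557, 558, 559, 562, 563, 565, 566, 567, 569, 570, 571], [572, 573, 574, 579, 582, 583, 586,
     587, 588, 589, 590, 591, 594, 595, 596, 597, 598, 599, 600, 601, 602, 604, 605, 609, 610,
     611, 612, 613, 614, 615, 616, 617], [618, 620, 621, 624, 625, 628, 629, 632, 633, 643, 645,
     646, 647, 649, 650, 651, 652, 653, 654, 657, 658, 659, 660, 661, 662, 664, 665, 666, 668,
     669, 673, 674], [675, 676, 677, 678, 680, 681, 682, 684, 685, 688, 689, 690, 692, 693, 696,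
     697, 705, 706, 707, 708, 709, 712, 713, 716, 720, 721, 724, 728, 736, 737, 740, 744], [752,
     770, 771, 773, 774, 775, 777, 778, 779, 780, 781, 782, 785, 786, 787, 788, 789, 790, 792,
     793, 794, 796, 797, 801, 802, 803, 804, 805, 806, 808, 809, 810], [812, 813, 816, 817, 818,
     820, 824, 833, 834, 835, 836, 837, 840, 841, 844, 848, 849, 852, 856, 864, 865, 868, 872,
     880, 896, 897, 898, 900, 904, 905, 912, 928], [960, 1038, 1039, 1046, 1047, 1050, 1051, 1053,
     1054, 1055, 1062, 1063, 1066, 1067, 1070, 1071, 1074, 1075, 1077, 1078, 1079, 1081, 1082,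
     1083, 1084, 1085, 1086, 1091, 1094, 1095, 1098, 1099], [1100, 1101, 1102, 1103, 1106, 1107,
     1108, 1109, 1110, 1111, 1112, 1113, 1114, 1116, 1117, 1122, 1123, 1124, 1125, 1126, 1127,
     1128, 1129, 1130, 1132, 1133, 1136, 1137, 1140, 1141, 1144, 1145], [1154, 1155, 1157, 1158,
     1159, 1161, 1162, 1163, 1164, 1165, 1166, 1169, 1170, 1171, 1172, 1173, 1174, 1176, 1177,
     1178, 1180, 1181, 1185, 1186, 1187, 1188, 1189, 1190, 1192, 1193, 1194, 1196], [1197, 1200,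
     1201, 1202, 1204, 1205, 1208, 1209, 1216, 1217, 1218, 1219, 1220, 1221, 1224, 1225, 1228,
     1232, 1233, 1236, 1240, 1248, 1249, 1252, 1256, 1264, 1283, 1285, 1286, 1287, 1289, 1290],
     [1291, 1292, 1293, 1294, 1297, 1298, 1299, 1300, 1301, 1302, 1304, 1305, 1306, 1308, 1309,
     1313, 1314, 1315, 1316, 1317, 1318, 1320, 1321, 1322, 1324, 1325, 1328, 1329, 1330, 1332,
     1336, 1344], [1345, 1346, 1347, 1348, 1349, 1352, 1353, 1356, 1360, 1361, 1364, 1368, 1376,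
     1377, 1380, 1384, 1392, 1408, 1409, 1410, 1412, 1416, 1417, 1424, 1440, 1472, 1539, 1541,
     1542, 1543, 1545, 1546], [1547, 1548, 1549, 1550, 1553, 1554, 1555, 1556, 1557, 1560, 1561,
     1564, 1569, 1570, 1571, 1572, 1573, 1576, 1577, 1580, 1581, 1584, 1585, 1588, 1592, 1601,
     1602, 1604, 1605, 1608, 1609, 1616], [1617, 1632, 1633, 1664, 1665, 1666, 1668, 1672, 1680,
     1696, 1728, 1792, 1793, 1794, 1796, 1800, 1808, 1824, 1856, 2055, 2059, 2062, 2063, 2067,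
     2069, 2070, 2071, 2074, 2075, 2076, 2077, 2078], [2079, 2083, 2086, 2087, 2089, 2090, 2091,
     2092, 2093, 2094, 2095, 2097, 2098, 2099, 2100, 2101, 2102, 2103, 2104, 2105, 2106, 2107,
     2108, 2109, 2110, 2114, 2115, 2117, 2118, 2119, 2121, 2122], [2123, 2124, 2125, 2126, 2127,
     2129, 2130, 2131, 2132, 2133, 2134, 2135, 2136, 2137, 2138, 2140, 2141, 2145, 2146, 2147,
     2148, 2149, 2150, 2151, 2152, 2153, 2154, 2156, 2157, 2160, 2161, 2164], [2165, 2168, 2169,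
     2178, 2179, 2180, 2181, 2182, 2183, 2184, 2185, 2186, 2187, 2188, 2189, 2190, 2192, 2193,
     2194, 2195, 2196, 2197, 2198, 2200, 2201, 2202, 2204, 2205, 2209, 2210, 2211, 2212], [2213,
     2214, 2216, 2217, 2218, 2220, 2221, 2224, 2225, 2226, 2228, 2229, 2232, 2233, 2240, 2241,
     2242, 2243, 2244, 2245, 2248, 2249, 2252, 2256, 2257, 2260, 2264, 2272, 2273, 2276, 2280,
     2288], [2306, 2307, 2308, 2309, 2310, 2311, 2313, 2314, 2315, 2316, 2317, 2318, 2320, 2321,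
     2322, 2323, 2324, 2325, 2326, 2328, 2329, 2330, 2332, 2333, 2336, 2337, 2338, 2339, 2340,
     2341, 2342, 2344], [2345, 2346, 2348, 2349, 2352, 2353, 2354, 2356, 2360, 2368, 2369, 2370,
     2371, 2372, 2373, 2376, 2377, 2380, 2384, 2385, 2388, 2392, 2400, 2401, 2404, 2408, 2416,
     2432, 2433, 2434, 2436, 2440], [2441, 2448, 2464, 2496, 2562, 2563, 2564, 2565, 2566, 2567,
     2568, 2569, 2570, 2571, 2572, 2573, 2574, 2576, 2577, 2578, 2579, 2580, 2581, 2584, 2585,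
     2588, 2592, 2593, 2594, 2595, 2596, 2597], [2600, 2601, 2604, 2608, 2609, 2612, 2616, 2624,
     2625, 2626, 2628, 2629, 2632, 2633, 2640, 2641, 2656, 2688, 2689, 2690, 2692, 2696, 2704,
     2720, 2752, 2816, 2817, 2820, 2824, 2832, 2848, 2880], [3074, 3075, 3076, 3077, 3078, 3079,
     3080, 3081, 3082, 3083, 3084, 3085, 3088, 3089, 3090, 3091, 3092, 3093, 3096, 3097, 3100,
     3104, 3105, 3106, 3107, 3108, 3109, 3112, 3113, 3116, 3117, 3120], [3121, 3124, 3128, 3136,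
     3137, 3138, 3140, 3141, 3144, 3145, 3152, 3153, 3168, 3169, 3200, 3201, 3204, 3208, 3216,
     3232, 3328, 3329, 3330, 3332, 3336, 3344, 3360, 3584, 3585, 3586, 3588, 3592], [3600, 3616,
     3648]] (m := 419)
    (by norm_num) (by decide +kernel)

set_option maxRecDepth 100000 in
set_option maxHeartbeats 0 in
theorem h12_6_le0 {k : ℕ}
    (h : (((2 : ZMod 8) ^ 0) • devMod h12_6).FactorsThrough k) : 439 ≤ k :=
  le_of_lowerCheck_cubicOf 0
    [(0, [0, 1, 2, 4, 8, 16, 32, 64, 128, 256, 512, 1024, 5, 6, 9, 10, 12, 17, 18, 33, 34, 48,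
     132, 14], [4094, 4095, 4083, 4085, 4089, 4061, 4077, 4047, 4090, 4086, 4078, 4062, 3967,
     4087, 3839, 4091, 4093, 3583, 4063, 3071, 4079, 4031, 4081, 3963]), (1, [2048, 3, 20, 24, 36,
     40, 65, 66, 68, 72, 80, 96, 129, 130, 136, 144, 160, 192, 257, 258, 260, 264, 272, 288, 320,
     384, 513, 514, 516, 520, 528, 544], [4088, 3959, 4053, 4057, 4069, 4073, 3965, 4075, 4045,
     4041, 4055, 4071, 4059, 4082, 4092, 4058, 4080, 4084, 4067, 4074, 4076, 4072, 4013, 4060,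
     4070, 4066, 4051, 4056, 4046, 4052, 4054, 4043]), (1, [576, 640, 768, 1025, 1026, 1028, 1032,
     1040, 1056, 1088, 1152, 1280, 1536, 2049, 2052, 2056, 2064, 2080, 2112, 7, 11, 13, 19, 21,
     22, 25, 26, 28, 35, 37, 38, 41], [4049, 4050, 4068, 4042, 4065, 4037, 4029, 4030, 4007, 4044,
     4027, 4026, 4039, 4035, 4038, 4014, 4023, 4025, 4015, 3955, 3931, 3961, 3835, 3935, 4011,
     3833, 4022, 3999, 3947, 3957, 4021, 3915]), (1, [42, 44, 49, 50, 52, 56, 67, 69, 70, 73, 74,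
     76, 81, 82, 84, 88, 97, 98, 100, 104, 112, 131, 133, 134, 137, 138, 140, 145, 146, 148, 152,
     161], [4010, 3995, 3899, 4019, 4009, 3998, 3951, 3919, 3993, 3871, 4006, 3997, 3903, 3990,
     4005, 3989, 3927, 3994, 3991, 3962, 3966, 3946, 3923, 3958, 3950, 3983, 3934, 3933, 3926,
     3838, 3834, 3830]), (1, [162, 164, 176, 193, 196, 259, 261, 265, 273, 289, 517, 521, 529,
     545, 1029, 1033, 1041, 15, 23, 27, 29, 39, 45, 53, 57, 60], [3837, 3822, 3930, 3582, 2046,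
     3070, 3823, 3807, 3831, 3827, 3806, 3579, 3574, 3055, 3575, 3567, 3566, 3551, 3550, 3039,
     3819, 2047, 3791, 3818, 3775, 3067]), (2, [2050, 2176, 2304, 2560, 3072, 168, 194, 200, 208,
     224, 262, 266, 268, 274, 276, 280, 290, 292, 296, 304, 321, 322, 324, 328, 336, 352, 385,
     386, 388, 392, 400, 416], [4064, 4048, 4040, 4034, 4036, 4032, 4033, 4024, 4028, 4020, 4018,
     4017, 4016, 4008, 4012, 4002, 4004, 4003, 3992, 4000, 3987, 3996, 3964, 4001, 3988, 3986,
     3985, 3980, 3981, 3977, 3978, 3970]), (2, [448, 515, 518, 522, 524, 530, 532, 536, 546, 548,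
     552, 560, 577, 578, 580, 584, 592, 608, 641, 642, 644, 648, 656, 672, 704, 769, 770, 772,
     776, 784, 800, 832], [3982, 3974, 3975, 3979, 3973, 3984, 3972, 3971, 3960, 3952, 3948, 3976,
     3954, 3956, 3949, 3953, 3945, 3944, 3929, 3943, 3942, 3938, 3940, 3918, 3932, 3922, 3066,
     3911, 3914, 3925, 3939, 3063]), (2, [1027, 1030, 1034, 1036, 1042, 1044, 1048, 1057, 1058,
     1060, 1064, 1072, 1089, 1090, 1092, 1096, 1104, 1120, 1153, 1154, 1156, 1160, 1168, 1184,
     1281, 1284, 1288, 1296, 1312, 1344, 1537, 1538], [3928, 3902, 3894, 3924, 3910, 3941, 3906,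
     3937, 3898, 3917, 3836, 3901, 3907, 3886, 3870, 3895, 3887, 3832, 3828, 3578, 3815, 3799,
     3803, 3802, 3829, 3821, 3826, 3804, 3814, 3054, 3810, 3062]), (2, [1540, 1544, 1552, 1568,
     2051, 2053, 2054, 2057, 2058, 2060, 2065, 2066, 2068, 2072, 2081, 2082, 2084, 2088, 2096,
     2113, 2116, 2120, 2128, 2144, 2177, 2208, 2305, 2561, 3073, 30, 43, 46], [3798, 3571, 3790,
     3811, 3795, 3916, 3774, 3891, 3580, 3890, 3900, 3562, 3820, 3817, 3882, 3563, 3805, 3787,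
     3794, 3786, 3581, 3558, 3542, 3570, 3547, 3038, 3546, 3534, 3519, 3883, 3913, 3879]), (2,
     [51, 54, 58, 71, 75, 77, 78, 83, 85, 86, 89, 90, 92, 99, 101, 102, 105, 106, 108, 113, 114,
     116, 120, 135, 139, 141, 142, 147, 149, 150, 153, 154], [3921, 3878, 3867, 3863, 3862, 3866,
     3783, 3782, 3912, 3771, 3897, 3779, 3800, 3854, 3909, 3767, 3908, 3766, 3825, 3824, 3743,
     3855, 3813, 3770, 3711, 3789, 3535, 3759, 3816, 3069, 3801, 3518]), (2, [156, 163, 165, 166,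
     169, 170, 172, 177, 178, 180, 184, 195, 197, 201, 204, 209, 212, 216, 225, 228, 232, 240,
     263, 267, 269, 270, 275, 277, 278, 281, 282, 284], [3758, 3577, 3788, 3559, 3812, 3543, 3742,
     3778, 3058, 3710, 3576, 3068, 3573, 3572, 3047, 3564, 3051, 3050, 3565, 3046, 3034, 3059,
     3554, 3549, 3797, 3035, 3555, 3755, 3031, 3773, 3030, 3548]), (2, [291, 293, 294, 297, 298,
     300, 305, 306, 308, 312, 323, 325, 329, 332, 337, 340, 344, 353, 356, 360, 368, 393, 401,
     519, 523, 525, 531, 533, 537, 540, 547, 549], [3539, 3796, 3022, 3763, 3007, 3538, 3750,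
     3023, 3531, 3530, 3006, 3511, 3510, 2043, 3526, 2042, 2039, 3502, 2030, 2031, 2038, 2015,
     2014, 3515, 3527, 3762, 3503, 3754, 3739, 3514, 3486, 3751]), (2, [553, 556, 561, 564, 568,
     581, 585, 593, 609, 1031, 1035, 1037, 1043, 1045, 1049, 1052, 1059, 1061, 1065, 1068, 1073,
     1076, 1080, 1093, 1097, 1105, 1121, 2061, 2069, 2073, 2085, 2089], [3735, 3454, 3727, 3455,
     3065, 3060, 3326, 3064, 3026, 3487, 3053, 3699, 3327, 3707, 3706, 3052, 3061, 3709, 3569,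
     3042, 3678, 3043, 3036, 3014, 3037, 3018, 3027, 3015, 3019, 3002, 2998, 2991]), (2, [2097,
     31, 47, 55, 59, 61, 62, 79, 87, 91, 93, 103, 107, 109, 115, 117, 121, 124, 157, 173, 181,
     185, 285, 301, 309, 313, 541, 557, 565, 569, 1053, 1069], [3003, 3561, 3703, 3695, 3679,
     3533, 2999, 2975, 2990, 2943, 3423, 2815, 2559, 3439, 2035, 3451, 3323, 2942, 2558, 2974,
     2034, 2045, 2814, 2026, 2044, 2027, 2023, 2022, 2010, 2011, 2007, 2006]), (2, [1077, 1081,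
     63, 125, 4096], [1998, 1999, 1982, 1983, 3969])]
    (by norm_num) (by decide +kernel) h

end BitTable

/-! ### Separation of the seven functions. -/

/-- Two Boolean functions are separated by the factorizations of the incidence matrices modulo `8`
of their developments. -/
def Separated {n : ℕ} (f g : BoolFn n) : Prop :=
  ∃ (c : ZMod 8) (m : ℕ), ¬ ((c • devMod f).FactorsThrough m ↔ (c • devMod g).FactorsThrough m)

theorem Separated.symm {n : ℕ} {f g : BoolFn n} (h : Separated f g) : Separated g f := by
  obtain ⟨c, m, h⟩ := h
  exact ⟨c, m, fun h' => h h'.symm⟩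

theorem Separated.not_equivalentFn {n : ℕ} {f g : BoolFn n} (h : Separated f g) :
    ¬ EquivalentFn f g := by
  obtain ⟨c, m, h⟩ := h
  exact fun he => h (he.factorsThrough_iff c).symm

theorem Separated.snf_ne {n : ℕ} {f g : BoolFn n} (h : Separated f g) : snf f ≠ snf g := by
  obtain ⟨c, m, h⟩ := h
  exact fun he => h ⟨factorsThrough_of_snf_eq he c, factorsThrough_of_snf_eq he.symm c⟩

theorem separated_of_bounds {n : ℕ} {f g : BoolFn n} {c : ZMod 8} {m l : ℕ}
    (hf : (c • devMod f).FactorsThrough m)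
    (hg : ∀ {k : ℕ}, (c • devMod g).FactorsThrough k → l ≤ k) (h : m < l) : Separated f g :=
  ⟨c, m, fun h' => absurd (hg (h'.1 hf)) (not_le.2 h)⟩

namespace BitTable

/-- Of the 21 pairs, 15 are separated by the 2-rank, five by twice the matrix (the pairs inside {1,
2, 4}, and 3 against 6 and 7), and the pair 6, 7 by the matrix itself. In each name the function
with the smaller rank comes first. -/
theorem separated_h12 (i j : Fin 7) (hij : i < j) : Separated (h12 i) (h12 j) := by
  have h13 : Separated h12_1 h12_3 :=
    separated_of_bounds h12_1_factorsThrough2 h12_3_le2 (by norm_num)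
  have h15 : Separated h12_1 h12_5 :=
    separated_of_bounds h12_1_factorsThrough2 h12_5_le2 (by norm_num)
  have h16 : Separated h12_1 h12_6 :=
    separated_of_bounds h12_1_factorsThrough2 h12_6_le2 (by norm_num)
  have h17 : Separated h12_1 h12_7 :=
    separated_of_bounds h12_1_factorsThrough2 h12_7_le2 (by norm_num)
  have h23 : Separated h12_2 h12_3 :=
    separated_of_bounds h12_2_factorsThrough2 h12_3_le2 (by norm_num)
  have h25 : Separated h12_2 h12_5 :=
    separated_of_bounds h12_2_factorsThrough2 h12_5_le2 (by norm_num)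
  have h26 : Separated h12_2 h12_6 :=
    separated_of_bounds h12_2_factorsThrough2 h12_6_le2 (by norm_num)
  have h27 : Separated h12_2 h12_7 :=
    separated_of_bounds h12_2_factorsThrough2 h12_7_le2 (by norm_num)
  have h43 : Separated h12_4 h12_3 :=
    separated_of_bounds h12_4_factorsThrough2 h12_3_le2 (by norm_num)
  have h45 : Separated h12_4 h12_5 :=
    separated_of_bounds h12_4_factorsThrough2 h12_5_le2 (by norm_num)
  have h46 : Separated h12_4 h12_6 :=
    separated_of_bounds h12_4_factorsThrough2 h12_6_le2 (by norm_num)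
  have h47 : Separated h12_4 h12_7 :=
    separated_of_bounds h12_4_factorsThrough2 h12_7_le2 (by norm_num)
  have h35 : Separated h12_3 h12_5 :=
    separated_of_bounds h12_3_factorsThrough2 h12_5_le2 (by norm_num)
  have h65 : Separated h12_6 h12_5 :=
    separated_of_bounds h12_6_factorsThrough2 h12_5_le2 (by norm_num)
  have h75 : Separated h12_7 h12_5 :=
    separated_of_bounds h12_7_factorsThrough2 h12_5_le2 (by norm_num)
  have h42 : Separated h12_4 h12_2 :=
    separated_of_bounds h12_4_factorsThrough1 h12_2_le1 (by norm_num)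
  have h41 : Separated h12_4 h12_1 :=
    separated_of_bounds h12_4_factorsThrough1 h12_1_le1 (by norm_num)
  have h21 : Separated h12_2 h12_1 :=
    separated_of_bounds h12_2_factorsThrough1 h12_1_le1 (by norm_num)
  have h63 : Separated h12_6 h12_3 :=
    separated_of_bounds h12_6_factorsThrough1 h12_3_le1 (by norm_num)
  have h73 : Separated h12_7 h12_3 :=
    separated_of_bounds h12_7_factorsThrough1 h12_3_le1 (by norm_num)
  have h76 : Separated h12_7 h12_6 :=
    separated_of_bounds h12_7_factorsThrough0 h12_6_le0 (by norm_num)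
  fin_cases i <;> fin_cases j <;> first | exact absurd hij (by decide) | skip
  exacts [h21.symm, h13, h41.symm, h15, h16, h17, h23, h42.symm, h25, h26, h27, h43.symm, h35,
    h63.symm, h73.symm, h45, h46, h47, h65.symm, h75.symm, h76.symm]

theorem separated_h12_of_ne (i j : Fin 7) (hij : i ≠ j) : Separated (h12 i) (h12 j) := by
  rcases lt_or_gt_of_ne hij with h | h
  · exact separated_h12 i j h
  · exact (separated_h12 j i h).symm

end BitTable

theorem mainTheorem4 :
    (∀ i, IsHomogeneousFn 3 (h12 i) ∧ IsBent (h12 i)) ∧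
    (∀ i j, i ≠ j → ¬ EquivalentFn (h12 i) (h12 j)) ∧
    (∀ i, ∀ h : BoolFn 12, IsPrimary 6 h → ¬ EquivalentFn (h12 i) h) ∧
    (h12_6 ∈ newFromOld 6 6 3 h12_3 ∧ h12_7 ∈ newFromOld 6 6 3 h12_3) ∧
    (∀ i, i ≠ 5 → snf (h12 i) ≠ snf (h12 5)) ∧
    (∀ i, i ≠ 6 → snf (h12 i) ≠ snf (h12 6)) :=
  ⟨fun i => ⟨BitTable.isHomogeneousFn_h12 i, BitTable.isBent_h12 i⟩,
    fun i j hij => (BitTable.separated_h12_of_ne i j hij).not_equivalentFn,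
    BitTable.not_equivalentFn_h12_of_isPrimary, ⟨BitTable.h12_6_mem_newFromOld, BitTable.h12_7_mem_newFromOld⟩,
    fun i hi => (BitTable.separated_h12_of_ne i 5 hi).snf_ne,
    fun i hi => (BitTable.separated_h12_of_ne i 6 hi).snf_ne⟩
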